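/- **Byzantine secretary model.** There are $n$ elements with values $v(e)\ge 0$, divided into green elements $G$ and red elements $R$. An adversary fixes in advance the partition into $G$ and $R$, all values, and the arrival times in $[0,1]$ of the red elements (and the order of red elements with equal arrival times). Then each green element independently receives an arrival time uniform on $[0,1]$. The elements are presented in order of arrival. A randomized online algorithm, which knows $n$, $K$ and $\varepsilon$ but neither $G$ nor $R$, sees the value and the arrival time of each arriving element (not its colour), and must irrevocably select or discard it before the next element arrives, using only what it has seen so far and its own internal randomness, which is independent of the arrival times. In the case of the uniform matroid of rank $K$ the algorithm must never select more than $K$ elements. Let $g_{\max}$ be a green element of largest value, and let $$V^* := \max\Big\{\sum_{e\in S} v(e) \;:\; S\subseteq G\setminus\{g_{\max}\},\ |S|\le K\Big\}.$$ **Theorem (Uniform Matroids).** There is a polynomial $p$ such that for all $\varepsilon\in(0,1]$, all natural numbers $n$ and all natural numbers $K\ge p(\varepsilon^{-1}\log n)$ (with the convention $\log 0 = 0$), there is a randomized online algorithm that always selects at most $K$ elements and is $(1+\varepsilon)$-competitive with the benchmark $V^*$: on every instance with $n$ elements of which at least one is green, the expected total value of the selected elements, over the green arrival times and the internal randomness of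 the algorithm, is at least $V^*/(1+\varepsilon)$. -/

import Mathlib

open MeasureTheory
open scoped NNReal

/-- An input of the Byzantine secretary problem with `n` elements, fixed by the adversary in
advance: the set of green elements, the values of all elements, and the arrival times of the red
elements (those outside `green`). The entries of `redTime` at green elements play no role. -/
structure ByzInstance (n : ℕ) where
  green : Finset (Fin n)
  value : Fin n → ℝ≥0
  redTime : Fin n → unitInterval

namespace ByzInstance

variable {n : ℕ}

/-- The arrival times of all elements, when `u` holds the random draws: a green element `e`
arrives at time `u e`, a red one at the time chosen by the adversary. -/
noncomputable def time (P : ByzInstance n) (u : Fin n → unitInterval) (e : Fin n) : unitInterval :=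
  if e ∈ P.green then u e else P.redTime e

/-- The order of arrival: `P.order u i` is the element that arrives as number `i` (from `0`).
Elements are sorted by arrival time; red elements with equal times are presented in the order of
their labels, so that the adversary, who assigns the labels, chooses their order. -/
noncomputable def order (P : ByzInstance n) (u : Fin n → unitInterval) : Equiv.Perm (Fin n) :=
  Tuple.sort (P.time u)

/-- What an algorithm sees of the input: the arrival time and the value of each element, in order
of arrival. Neither colours nor labels are visible. -/
noncomputable def stream (P : ByzInstance n) (u : Fin n → unitInterval) (i : Fin n) : unitInterval × ℝ≥0 :=
  (P.time u (P.order u i), P.value (P.order u i))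

/-- `g` is a green element of the largest value (`g_max`). -/
def IsGreenMax (P : ByzInstance n) (g : Fin n) : Prop :=
  g ∈ P.green ∧ ∀ e ∈ P.green, P.value e ≤ P.value g

/-- The leave-one-out benchmark for the uniform matroid of rank `K`: the largest total value of a
set of at most `K` green elements that does not contain `g`. -/
noncomputable def benchmark (P : ByzInstance n) (K : ℕ) (g : Fin n) : ℝ≥0 :=
  ((P.green.erase g).powerset.filter fun S => S.card ≤ K).sup fun S => ∑ e ∈ S, P.value e

end ByzInstance

/-- A randomized online algorithm: a probability space of internal random seeds, and for each seed
a rule that decides on an arriving element from the times and values of the elements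
`0, …, k` that have arrived so far, the last one being the element under decision. -/
structure OnlineAlg where
  Seed : Type
  [measSeed : MeasurableSpace Seed]
  law : Measure Seed
  [probLaw : IsProbabilityMeasure law]
  select : Seed → (k : ℕ) → (Fin (k + 1) → unitInterval × ℝ≥0) → Bool
  measurable_select : ∀ k, Measurable
    fun z : Seed × (Fin (k + 1) → unitInterval × ℝ≥0) => select z.1 k z.2

attribute [instance] OnlineAlg.measSeed OnlineAlg.probLaw

namespace OnlineAlg

variable {n : ℕ}

/-- The set of elements selected by the algorithm, for the seed `s` and the random draws `u`. -/
noncomputable def selected (A : OnlineAlg) (P : ByzInstance n) (s : A.Seed) (u : Fin n → unitInterval) :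
    Finset (Fin n) :=
  (Finset.univ.filter fun i : Fin n =>
    A.select s i (fun j => P.stream u (Fin.castLE i.isLt j)) = true).map (P.order u).toEmbedding

/-- The expected total value of the selected elements. The draws `u` are independent and uniform
on `[0, 1]`, and independent of the seed. -/
noncomputable def expectedValue (A : OnlineAlg) (P : ByzInstance n) : ℝ :=
  ∫ z, ((∑ e ∈ A.selected P z.1 z.2, P.value e : ℝ≥0) : ℝ)
    ∂(A.law.prod (volume : Measure (Fin n → unitInterval)))

end OnlineAlg

/-! The algorithm is deterministic and follows many guesses for the scale of the benchmark `V` at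
once. Time is cut into coarse slots and these into fine slots; values are rounded down to levels,
powers of 1 + 1/N with N of order log n / ε. Pairs of earlier coarse slots supply the levels under
consideration, polynomially many in N, and two rules serve each of them. Exploration takes the first
P elements of a coarse slot above the level: it gets all such elements or P of them
(`explore_dichotomy`). The quota rule reserves, in each fine slot, about as many places above the
level as every earlier fine slot could have filled. The reservations are nested, so a greedy rule
honours all of them whenever each can be met (`quota_le_card_mainAccepts`). A reservation that
cannot be met shrinks a running minimum by a factor 1 - 1/N, so even an adversary causes few
failures (`card_fail_le`).

Why the right levels get considered: let J be the coarse slots with a red element worth V, and J'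
the last N + 1 of them. A fixed green element rarely falls into J'. Let F be the first coarse slot
outside J' with a green element of level at least β - B, where β is the level of V. If F is in J,
then N + 1 slots of J follow. In each of them the algorithm collects V, or the set of elements of F
that can still mislead it halves; as n < 2^N, it collects V in the end (`le_sum_of_chain`). If F is
not in J, its top is close to β (unless it holds a huge g), and all levels near β are considered
after F (`Outcome.mem_levels`).

Suppose the largest green element g is not huge. Split every value at about V/N^42. Exploration
collects the excess of all later elements, as P elements above that level would already be worth V.
The truncated values are summed level by level: where the optimal set S has many elements, Chebyshev
spreads them evenly over the fine slots and the quotas recover all but a fraction O(1/N); levels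
with few elements are negligible. There remains the excess lost in F. Two large green elements
rarely share a coarse slot, and a lone element of S in F is replaced by g, which then comes later
and is worth at least as much. This is where leaving g out of the benchmark is used
(`Outcome.of_moderate`).

If g is huge, then with probability 1/N^3, whatever the other arrivals, it comes in the last coarse
slot; typically it is selected there, or elements worth V already are, and its value of at least N^3
V yields V on average (`Outcome.of_huge`). -/

open scoped BigOperators

/-! ### The slotted algorithm on discretized data. -/

/-- The discretization and the budgets of the slotted algorithm: levels are powers of `1 + 1/N`,
a coarse slot consists of `m₁` fine slots, candidate levels are extended by `±4B`, at most `P`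
elements are explored per coarse slot and level, and the quota rule takes at most `c` elements per
fine slot. -/
structure SlotParams where
  N : ℕ
  m₁ : ℕ
  B : ℕ
  P : ℕ
  c : ℕ

/-- The number of data points in slot `s` of level at least `t`. -/
def slotCount {ι : Type*} [Fintype ι] (d : ι → ℕ × WithBot ℤ) (s : ℕ) (t : ℤ) : ℕ :=
  (Finset.univ.filter fun i => (d i).1 = s ∧ (t : WithBot ℤ) ≤ (d i).2).card

/-- Merge `m` consecutive slots into one. -/
def coarsen (m : ℕ) (x : ℕ × WithBot ℤ) : ℕ × WithBot ℤ := (x.1 / m, x.2)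

/-- The contribution of the first `k` data points to `slotCount`. -/
def prefixCount {n : ℕ} (d : Fin n → ℕ × WithBot ℤ) (k s : ℕ) (t : ℤ) : ℕ :=
  (Finset.univ.filter fun i : Fin n =>
    (i : ℕ) < k ∧ (d i).1 = s ∧ (t : WithBot ℤ) ≤ (d i).2).card

/-- The capacity `min (c, min_b (c - q b + f b))` of a chain of nested reservations. -/
def room (c : ℕ) (Λ : Finset ℤ) (q f : ℤ → ℕ) : ℕ := Λ.fold min c fun b => c - q b + f b

namespace SlotParams

/-- The highest level in coarse slot `i`. -/
noncomputable def top (D : ℕ → ℤ → ℕ) (i : ℕ) : ℤ := sSup {t : ℤ | 1 ≤ D i t}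

/-- The level of rank `2 ^ l` among the elements of coarse slot `i` which exceed the top of coarse
slot `i'` by at most `B` levels. -/
noncomputable def cand (p : SlotParams) (D : ℕ → ℤ → ℕ) (i i' l : ℕ) : ℤ :=
  sSup {t : ℤ | 2 ^ l ≤ D i t - D i (top D i' + p.B + 1)}

/-- The levels considered in coarse slot `j`. -/
noncomputable def levels (p : SlotParams) (D : ℕ → ℤ → ℕ) (j : ℕ) : Finset ℤ :=
  (((Finset.range j ×ˢ Finset.range j) ×ˢ Finset.range p.N) ×ˢ
    Finset.Icc (-(4 * p.B : ℤ)) (4 * p.B)).image fun x => p.cand D x.1.1.1 x.1.1.2 x.1.2 + x.2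

/-- The smallest number, capped by `c`, of elements of level at least `b` in an earlier slot. -/
def pastMin (p : SlotParams) (C : ℕ → ℤ → ℕ) (s : ℕ) (b : ℤ) : ℕ :=
  (Finset.range s).fold min p.c fun s' => C s' b

/-- The number of places reserved in fine slot `s` for elements of level at least `b`. -/
def quota (p : SlotParams) (C : ℕ → ℤ → ℕ) (s : ℕ) (b : ℤ) : ℕ :=
  p.pastMin C s b * (p.N - 1) / p.N

/-- The element is among the first `P` of its coarse slot above some level under consideration. -/
def Explores (p : SlotParams) (D : ℕ → ℤ → ℕ) (Λ : Finset ℤ) (x : ℕ × WithBot ℤ) : Prop :=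
  ∃ t ∈ Λ, (t : WithBot ℤ) ≤ x.2 ∧ D (x.1 / p.m₁) t ≤ p.P

/-- The decision on a data point `x`, from the fine counts `C'` before and `C` after its arrival
and the coarse counts `D` after its arrival. -/
def Accepts (p : SlotParams) (C C' D : ℕ → ℤ → ℕ) (x : ℕ × WithBot ℤ) : Prop :=
  p.Explores D (p.levels D (x.1 / p.m₁)) x ∨
    room p.c (p.levels D (x.1 / p.m₁)) (p.quota C x.1) (C' x.1) <
      room p.c (p.levels D (x.1 / p.m₁)) (p.quota C x.1) (C x.1)

end SlotParams

/-! ### Capacity of nested reservations. -/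

section room

variable {c : ℕ} {Λ : Finset ℤ} {q f g : ℤ → ℕ}

lemma room_le_cap : room c Λ q f ≤ c := (Finset.fold_min_le _).2 (Or.inl le_rfl)

lemma room_le {b : ℤ} (hb : b ∈ Λ) : room c Λ q f ≤ c - q b + f b :=
  (Finset.fold_min_le _).2 (Or.inr ⟨b, hb, le_rfl⟩)

lemma le_room {a : ℕ} : a ≤ room c Λ q f ↔ a ≤ c ∧ ∀ b ∈ Λ, a ≤ c - q b + f b :=
  Finset.le_fold_min _

lemma room_le_iff {a : ℕ} : room c Λ q f ≤ a ↔ c ≤ a ∨ ∃ b ∈ Λ, c - q b + f b ≤ a :=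
  Finset.fold_min_le _

lemma room_mono (h : ∀ b ∈ Λ, f b ≤ g b) : room c Λ q f ≤ room c Λ q g :=
  le_room.2 ⟨room_le_cap, fun b hb => (room_le hb).trans (by have := h b hb; omega)⟩

lemma room_le_succ (h : ∀ b ∈ Λ, g b ≤ f b + 1) : room c Λ q g ≤ room c Λ q f + 1 := by
  have h1 : room c Λ q g - 1 ≤ room c Λ q f := by
    refine le_room.2 ⟨?_, fun b hb => ?_⟩
    · have := room_le_cap (c := c) (Λ := Λ) (q := q) (f := g); omega
    · have := room_le (c := c) (q := q) (f := g) hb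
      have := h b hb
      omega
  omega

end room

/-! ### Counts along the order of arrival. -/

section prefixCount

variable {n : ℕ} {d : Fin n → ℕ × WithBot ℤ}

lemma prefixCount_zero (s : ℕ) (t : ℤ) : prefixCount d 0 s t = 0 := by
  simp [prefixCount]

lemma prefixCount_of_le {k : ℕ} (hk : n ≤ k) : prefixCount d k = slotCount d := by
  funext s t
  unfold prefixCount slotCount
  congr 1
  ext i
  simp only [Finset.mem_filter, Finset.mem_univ, true_and, and_iff_right_iff_imp]
  intro _
  exact i.isLt.trans_le hk

lemma prefixCount_succ (i : Fin n) (s : ℕ) (t : ℤ) :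
    prefixCount d (i + 1) s t =
      prefixCount d i s t + if (d i).1 = s ∧ (t : WithBot ℤ) ≤ (d i).2 then 1 else 0 := by
  unfold prefixCount
  split_ifs with h
  · rw [← Finset.card_insert_of_notMem (a := i)]
    · congr 1
      ext j
      simp only [Finset.mem_filter, Finset.mem_univ, true_and, Finset.mem_insert]
      constructor
      · rintro ⟨h1, h2⟩
        by_cases hj : j = i
        · exact Or.inl hj
        · have : (j : ℕ) ≠ i := fun h => hj (Fin.ext h)
          exact Or.inr ⟨by omega, h2⟩
      · rintro (rfl | ⟨h1, h2⟩)
        · exact ⟨by omega, h⟩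
        · exact ⟨by omega, h2⟩
    · simp
  · rw [add_zero]
    congr 1
    ext j
    simp only [Finset.mem_filter, Finset.mem_univ, true_and]
    constructor
    · rintro ⟨h1, h2⟩
      have : (j : ℕ) ≠ i := by
        intro hj
        exact h (Fin.ext hj ▸ h2)
      exact ⟨by omega, h2⟩
    · rintro ⟨h1, h2⟩
      exact ⟨by omega, h2⟩

lemma prefixCount_mono {k k' : ℕ} (h : k ≤ k') (s : ℕ) (t : ℤ) :
    prefixCount d k s t ≤ prefixCount d k' s t := by
  apply Finset.card_le_card
  intro j
  simp only [Finset.mem_filter, Finset.mem_univ, true_and]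
  rintro ⟨h1, h2⟩
  exact ⟨by omega, h2⟩

/-- Slots arrive in increasing order, so every slot before the current one is already complete. -/
lemma prefixCount_eq_of_lt (hd : Monotone fun i => (d i).1) (i : Fin n) {s : ℕ}
    (hs : s < (d i).1) : prefixCount d (i + 1) s = slotCount d s := by
  funext t
  unfold prefixCount slotCount
  congr 1
  ext j
  simp only [Finset.mem_filter, Finset.mem_univ, true_and, and_iff_right_iff_imp]
  rintro ⟨h1, -⟩
  by_contra hj
  have : i ≤ j := Fin.le_def.2 (by omega)
  have := hd this
  simp only at this
  omega

lemma slotCount_castLE {k : ℕ} (hk : k ≤ n) :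
    slotCount (fun j : Fin k => d (Fin.castLE hk j)) = prefixCount d k := by
  funext s t
  unfold prefixCount slotCount
  rw [← Finset.card_map (Fin.castLEEmb hk)]
  congr 1
  ext j
  simp only [Finset.mem_map, Finset.mem_filter, Finset.mem_univ, true_and, Fin.castLEEmb_apply]
  constructor
  · rintro ⟨a, h, rfl⟩
    exact ⟨by simp, h⟩
  · rintro ⟨h1, h2⟩
    exact ⟨⟨j, h1⟩, h2, rfl⟩

end prefixCount

/-! ### Guarantees and costs of the two acceptance rules. -/

namespace SlotParams

variable (p : SlotParams)

lemma top_congr {D D' : ℕ → ℤ → ℕ} {i : ℕ} (h : D i = D' i) : top D i = top D' i := by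
  simp [top, h]

lemma levels_congr {D D' : ℕ → ℤ → ℕ} {j : ℕ} (h : ∀ i < j, D i = D' i) :
    p.levels D j = p.levels D' j := by
  unfold levels
  apply Finset.image_congr
  intro x hx
  simp only [Finset.coe_product, Set.mem_prod, Finset.mem_coe, Finset.mem_range] at hx
  simp only [cand, top_congr (h _ hx.1.1.2), h _ hx.1.1.1]

lemma quota_congr {C C' : ℕ → ℤ → ℕ} {s : ℕ} (h : ∀ i < s, C i = C' i) :
    p.quota C s = p.quota C' s := by
  funext b
  unfold quota pastMin
  congr 2
  apply Finset.fold_congr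
  intro i hi
  rw [h i (Finset.mem_range.1 hi)]

lemma pastMin_le (C : ℕ → ℤ → ℕ) (s : ℕ) (b : ℤ) : p.pastMin C s b ≤ p.c :=
  (Finset.fold_min_le _).2 (Or.inl le_rfl)

lemma quota_le_pastMin (C : ℕ → ℤ → ℕ) (s : ℕ) (b : ℤ) : p.quota C s b ≤ p.pastMin C s b := by
  unfold quota
  rcases Nat.eq_zero_or_pos p.N with h | h
  · simp [h]
  · refine Nat.div_le_of_le_mul ?_
    rw [mul_comm]
    exact Nat.mul_le_mul_right _ (Nat.sub_le _ _)

lemma quota_le (C : ℕ → ℤ → ℕ) (s : ℕ) (b : ℤ) : p.quota C s b ≤ p.c :=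
  (p.quota_le_pastMin C s b).trans (p.pastMin_le C s b)

lemma card_levels_le (D : ℕ → ℤ → ℕ) (j : ℕ) :
    (p.levels D j).card ≤ j * j * p.N * (8 * p.B + 1) := by
  refine Finset.card_image_le.trans (le_of_eq ?_)
  simp only [Finset.card_product, Finset.card_range, Int.card_Icc]
  congr 1
  omega

variable {n : ℕ} (d : Fin n → ℕ × WithBot ℤ)

/-- The counts of a whole stream by coarse slot. -/
def coarseCount : ℕ → ℤ → ℕ := slotCount fun i => coarsen p.m₁ (d i)

/-- Acceptance of data point `i` by the quota rule, in terms of the whole stream. -/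
def MainAccepts (i : Fin n) : Prop :=
  room p.c (p.levels (p.coarseCount d) ((d i).1 / p.m₁)) (p.quota (slotCount d) (d i).1)
      (prefixCount d i (d i).1) <
    room p.c (p.levels (p.coarseCount d) ((d i).1 / p.m₁)) (p.quota (slotCount d) (d i).1)
      (prefixCount d (i + 1) (d i).1)

/-- Acceptance of data point `i` by the exploration rule, in terms of the whole stream. -/
def ExploreAccepts (i : Fin n) : Prop :=
  ∃ t ∈ p.levels (p.coarseCount d) ((d i).1 / p.m₁), (t : WithBot ℤ) ≤ (d i).2 ∧
    prefixCount (fun i => coarsen p.m₁ (d i)) (i + 1) ((d i).1 / p.m₁) t ≤ p.P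

variable {d}

/-- Levels and quotas are computed from completed slots only, so the online decision can be analysed
with the counts of the whole stream. -/
lemma accepts_iff (hd : Monotone fun i => (d i).1) (i : Fin n) :
    p.Accepts (prefixCount d (i + 1)) (prefixCount d i)
        (prefixCount (fun i => coarsen p.m₁ (d i)) (i + 1)) (d i) ↔
      p.ExploreAccepts d i ∨ p.MainAccepts d i := by
  have hd' : Monotone fun i => ((fun i => coarsen p.m₁ (d i)) i).1 :=
    fun a b hab => Nat.div_le_div_right (hd hab)
  have h1 : p.levels (prefixCount (fun i => coarsen p.m₁ (d i)) (i + 1)) ((d i).1 / p.m₁) =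
      p.levels (p.coarseCount d) ((d i).1 / p.m₁) :=
    p.levels_congr fun s hs => prefixCount_eq_of_lt hd' i hs
  have h2 : p.quota (prefixCount d (i + 1)) (d i).1 = p.quota (slotCount d) (d i).1 :=
    p.quota_congr fun s hs => prefixCount_eq_of_lt hd i hs
  unfold Accepts Explores ExploreAccepts MainAccepts
  rw [h1, h2]

-- Each acceptance raises the room by at least one, and the room never exceeds `c`.
open Classical in
lemma card_mainAccepts_slot_le (s : ℕ) :
    (Finset.univ.filter fun i : Fin n => (d i).1 = s ∧ p.MainAccepts d i).card ≤ p.c := by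
  set Λ := p.levels (p.coarseCount d) (s / p.m₁)
  set q := p.quota (slotCount d) s
  have key : ∀ k ≤ n, (Finset.univ.filter fun i : Fin n =>
      (i : ℕ) < k ∧ (d i).1 = s ∧ p.MainAccepts d i).card ≤ room p.c Λ q (prefixCount d k s) := by
    intro k
    induction k with
    | zero => simp
    | succ k ih =>
      intro hk
      have ih := ih (by omega)
      let i : Fin n := ⟨k, hk⟩
      by_cases h : (d i).1 = s ∧ p.MainAccepts d i
      · have h2 : room p.c Λ q (prefixCount d k s) < room p.c Λ q (prefixCount d (k + 1) s) := by
          have := h.2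
          unfold MainAccepts at this
          rw [h.1] at this
          exact this
        refine le_trans ?_ (Nat.succ_le_of_lt (lt_of_le_of_lt ih h2))
        refine (Finset.card_le_card (t := insert i (Finset.univ.filter fun i : Fin n =>
          (i : ℕ) < k ∧ (d i).1 = s ∧ p.MainAccepts d i)) ?_).trans (Finset.card_insert_le _ _)
        intro j
        simp only [Finset.mem_filter, Finset.mem_univ, true_and, Finset.mem_insert]
        rintro ⟨h3, h4⟩
        by_cases hj : j = i
        · exact Or.inl hj
        · have : (j : ℕ) ≠ k := fun h => hj (Fin.ext h)
          exact Or.inr ⟨by omega, h4⟩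
      · refine le_trans (Finset.card_le_card ?_) (ih.trans (room_mono fun b _ =>
          prefixCount_mono (Nat.le_succ k) s b))
        intro j
        simp only [Finset.mem_filter, Finset.mem_univ, true_and]
        rintro ⟨h3, h4⟩
        have : (j : ℕ) ≠ k := by
          intro hj
          have : j = i := Fin.ext hj
          exact h (this ▸ h4)
        exact ⟨by omega, h4⟩
  refine le_trans (Finset.card_le_card ?_) ((key n le_rfl).trans room_le_cap)
  intro j
  simp

-- Consider the room restricted to reservations at level `b` or higher. It grows only at elements
-- above `b`, by at most one, and only if they are accepted. It starts at most at `c - q b` and ends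
-- at `c`, because every quota can be met.
open Classical in
lemma quota_le_card_mainAccepts (s : ℕ) {b : ℤ}
    (hb : b ∈ p.levels (p.coarseCount d) (s / p.m₁))
    (hs : ∀ b' ∈ p.levels (p.coarseCount d) (s / p.m₁),
      p.quota (slotCount d) s b' ≤ slotCount d s b') :
    p.quota (slotCount d) s b ≤ (Finset.univ.filter fun i : Fin n =>
      ((d i).1 = s ∧ (b : WithBot ℤ) ≤ (d i).2) ∧ p.MainAccepts d i).card := by
  set Λ := p.levels (p.coarseCount d) (s / p.m₁) with hΛ
  set q := p.quota (slotCount d) s with hq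
  have key : ∀ k ≤ n, room p.c (Λ.filter (b ≤ ·)) q (prefixCount d k s) ≤ p.c - q b +
      (Finset.univ.filter fun i : Fin n => (i : ℕ) < k ∧
        ((d i).1 = s ∧ (b : WithBot ℤ) ≤ (d i).2) ∧ p.MainAccepts d i).card := by
    intro k
    induction k with
    | zero =>
      intro _
      refine (room_le (b := b) (by simp [hb])).trans ?_
      simp [prefixCount_zero]
    | succ k ih =>
      intro hk
      have ih := ih (by omega)
      let i : Fin n := ⟨k, hk⟩
      have hsub : (Finset.univ.filter fun i : Fin n => (i : ℕ) < k ∧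
          ((d i).1 = s ∧ (b : WithBot ℤ) ≤ (d i).2) ∧ p.MainAccepts d i) ⊆
          (Finset.univ.filter fun i : Fin n => (i : ℕ) < k + 1 ∧
          ((d i).1 = s ∧ (b : WithBot ℤ) ≤ (d i).2) ∧ p.MainAccepts d i) := by
        intro j
        simp only [Finset.mem_filter, Finset.mem_univ, true_and]
        rintro ⟨h3, h4⟩
        exact ⟨by omega, h4⟩
      have hsucc : ∀ b', prefixCount d (k + 1) s b' = _ := fun b' => prefixCount_succ i s b'
      by_cases h : (d i).1 = s ∧ (b : WithBot ℤ) ≤ (d i).2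
      · by_cases hm : p.MainAccepts d i
        · have h1 : room p.c (Λ.filter (b ≤ ·)) q (prefixCount d (k + 1) s) ≤
              room p.c (Λ.filter (b ≤ ·)) q (prefixCount d k s) + 1 := by
            refine room_le_succ fun b' _ => ?_
            rw [hsucc]
            have : prefixCount d (i : ℕ) s b' = prefixCount d k s b' := rfl
            split_ifs <;> omega
          have h2 : i ∉ (Finset.univ.filter fun i : Fin n => (i : ℕ) < k ∧
              ((d i).1 = s ∧ (b : WithBot ℤ) ≤ (d i).2) ∧ p.MainAccepts d i) := by
            simp [i]
          have h3 := Finset.card_le_card (Finset.insert_subset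
            (a := i) (by
              simp only [Finset.mem_filter, Finset.mem_univ, true_and]
              exact ⟨Nat.lt_succ_self k, h, hm⟩) hsub)
          rw [Finset.card_insert_of_notMem h2] at h3
          omega
        · refine le_trans (le_trans ?_ ih) (Nat.add_le_add_left (Finset.card_le_card hsub) _)
          have hm' : room p.c Λ q (prefixCount d (k + 1) s) ≤
              room p.c Λ q (prefixCount d k s) := by
            unfold MainAccepts at hm
            rw [h.1] at hm
            exact not_lt.1 hm
          have hpart : room p.c Λ q (prefixCount d k s) ≤
              room p.c (Λ.filter (b ≤ ·)) q (prefixCount d k s) :=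
            le_room.2 ⟨room_le_cap, fun b' hb' => room_le (Finset.mem_filter.1 hb').1⟩
          refine le_trans ?_ hpart
          -- A refusal means that the cap or some tight reservation `b0` blocks the room. The
          -- element does not count towards a tight `b0`, so it lies below it; hence `b ≤ b0`, and
          -- `b0` blocks the restricted room too.
          rcases room_le_iff.1 hm' with h0 | ⟨b0, hb0, h0⟩
          · exact room_le_cap.trans h0
          · have h1 := room_le (c := p.c) (q := q) (f := prefixCount d k s) hb0
            have h2 : ¬ ((b0 : WithBot ℤ) ≤ (d i).2) := by
              intro hle
              have := hsucc b0
              rw [if_pos ⟨h.1, hle⟩] at this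
              have h' : prefixCount d (i : ℕ) s b0 = prefixCount d k s b0 := rfl
              omega
            have h3 : b ≤ b0 := by
              by_contra hlt
              exact h2 ((WithBot.coe_le_coe.2 (not_le.1 hlt).le).trans h.2)
            exact (room_le (Finset.mem_filter.2 ⟨hb0, h3⟩)).trans h0
      · refine le_trans (le_trans ?_ ih) (Nat.add_le_add_left (Finset.card_le_card hsub) _)
        refine room_mono fun b' hb' => ?_
        rw [hsucc, if_neg]
        · exact le_rfl
        · rintro ⟨h1, h2⟩
          exact h ⟨h1, (WithBot.coe_le_coe.2 (Finset.mem_filter.1 hb').2).trans h2⟩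
  have hn := key n le_rfl
  rw [prefixCount_of_le le_rfl] at hn
  have hc : p.c ≤ room p.c (Λ.filter (b ≤ ·)) q (slotCount d s) :=
    le_room.2 ⟨le_rfl, fun b' hb' => by
      have := hs b' (Finset.mem_filter.1 hb').1
      omega⟩
  have hqc : q b ≤ p.c := p.quota_le _ _ _
  have hcard : (Finset.univ.filter fun i : Fin n => (i : ℕ) < n ∧
      ((d i).1 = s ∧ (b : WithBot ℤ) ≤ (d i).2) ∧ p.MainAccepts d i) =
      (Finset.univ.filter fun i : Fin n =>
      ((d i).1 = s ∧ (b : WithBot ℤ) ≤ (d i).2) ∧ p.MainAccepts d i) := by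
    ext j; simp
  rw [hcard] at hn
  omega

open Classical in
lemma card_exploreAccepts_le {m₀ : ℕ} (hm : ∀ i, (d i).1 / p.m₁ < m₀) :
    (Finset.univ.filter fun i : Fin n => p.ExploreAccepts d i).card ≤
      m₀ * (m₀ * m₀ * p.N * (8 * p.B + 1)) * p.P := by
  let D := fun i => coarsen p.m₁ (d i)
  let Λ := p.levels (p.coarseCount d)
  have hsub : (Finset.univ.filter fun i : Fin n => p.ExploreAccepts d i) ⊆
      (Finset.range m₀).biUnion fun j => (Λ j).biUnion fun t =>
        Finset.univ.filter fun i : Fin n => ((D i).1 = j ∧ (t : WithBot ℤ) ≤ (D i).2) ∧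
          prefixCount D (i + 1) j t ≤ p.P := by
    intro i hi
    simp only [Finset.mem_filter, Finset.mem_univ, true_and] at hi
    obtain ⟨t, ht, h1, h2⟩ := hi
    simp only [Finset.mem_biUnion, Finset.mem_range, Finset.mem_filter, Finset.mem_univ, true_and]
    exact ⟨_, hm i, t, ht, ⟨rfl, h1⟩, h2⟩
  have hone : ∀ (j : ℕ) (t : ℤ), (Finset.univ.filter fun i : Fin n =>
      ((D i).1 = j ∧ (t : WithBot ℤ) ≤ (D i).2) ∧ prefixCount D (i + 1) j t ≤ p.P).card ≤ p.P := by
    intro j t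
    have : p.P = (Finset.Icc 1 p.P).card := by simp
    rw [this]
    refine Finset.card_le_card_of_injOn (fun i => prefixCount D (i + 1) j t) ?_ ?_
    · intro i hi
      simp only [Finset.coe_filter, Finset.mem_univ, true_and, Set.mem_ofPred_eq] at hi
      simp only [Finset.coe_Icc, Set.mem_Icc]
      refine ⟨?_, by simpa using hi.2⟩
      rw [prefixCount_succ, if_pos hi.1]
      omega
    · intro i hi i' hi' heq
      simp only [Finset.coe_filter, Finset.mem_univ, true_and, Set.mem_ofPred_eq] at hi hi'
      simp only at heq
      rcases lt_trichotomy i i' with h | h | h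
      · have h1 := prefixCount_mono (d := D) (Nat.succ_le_of_lt (Fin.lt_def.1 h)) j t
        rw [prefixCount_succ i', if_pos hi'.1] at heq
        simp only [Nat.succ_eq_add_one] at h1
        omega
      · exact h
      · have h1 := prefixCount_mono (d := D) (Nat.succ_le_of_lt (Fin.lt_def.1 h)) j t
        rw [prefixCount_succ i, if_pos hi.1] at heq
        simp only [Nat.succ_eq_add_one] at h1
        omega
  refine (Finset.card_le_card hsub).trans ?_
  refine (Finset.card_biUnion_le_card_mul _ _ (m₀ * m₀ * p.N * (8 * p.B + 1) * p.P) ?_).trans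
    (le_of_eq (by rw [Finset.card_range]; ring))
  intro j hj
  refine (Finset.card_biUnion_le_card_mul _ _ p.P fun t _ => hone j t).trans ?_
  refine Nat.mul_le_mul_right _ ((p.card_levels_le _ _).trans ?_)
  have := (Finset.mem_range.1 hj).le
  gcongr

-- If an element above `t` is refused, the running count has passed `P`; all elements counted up to
-- `P` were accepted.
open Classical in
lemma explore_dichotomy (j : ℕ) {t : ℤ} (ht : t ∈ p.levels (p.coarseCount d) j) :
    (∀ i : Fin n, (d i).1 / p.m₁ = j → (t : WithBot ℤ) ≤ (d i).2 → p.ExploreAccepts d i) ∨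
      p.P ≤ (Finset.univ.filter fun i : Fin n =>
        ((d i).1 / p.m₁ = j ∧ (t : WithBot ℤ) ≤ (d i).2) ∧ p.ExploreAccepts d i).card := by
  let D := fun i => coarsen p.m₁ (d i)
  let A := fun k => (Finset.univ.filter fun i : Fin n => (i : ℕ) < k ∧
    ((d i).1 / p.m₁ = j ∧ (t : WithBot ℤ) ≤ (d i).2) ∧ p.ExploreAccepts d i).card
  have hA : A n = (Finset.univ.filter fun i : Fin n =>
        ((d i).1 / p.m₁ = j ∧ (t : WithBot ℤ) ≤ (d i).2) ∧ p.ExploreAccepts d i).card := by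
    simp [A]
  by_contra hcon
  push Not at hcon
  obtain ⟨⟨i, hi1, hi2, hi3⟩, hP⟩ := hcon
  have hgt : p.P < prefixCount D (i + 1) j t := by
    by_contra hle
    exact hi3 ⟨t, by rw [hi1]; exact ht, hi2, by rw [hi1]; exact not_lt.1 hle⟩
  have hgt' : p.P < slotCount D j t := by
    rw [← prefixCount_of_le (d := D) le_rfl]
    exact hgt.trans_le (prefixCount_mono (Nat.succ_le_of_lt i.isLt) _ _)
  have key : ∀ k ≤ n, min p.P (prefixCount D k j t) ≤ (Finset.univ.filter fun i : Fin n =>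
      (i : ℕ) < k ∧ ((d i).1 / p.m₁ = j ∧ (t : WithBot ℤ) ≤ (d i).2) ∧
        p.ExploreAccepts d i).card := by
    intro k
    induction k with
    | zero => simp [prefixCount_zero]
    | succ k ih =>
      intro hk
      have ih := ih (by omega)
      let i : Fin n := ⟨k, hk⟩
      have hsub : (Finset.univ.filter fun i : Fin n => (i : ℕ) < k ∧
          ((d i).1 / p.m₁ = j ∧ (t : WithBot ℤ) ≤ (d i).2) ∧ p.ExploreAccepts d i) ⊆
          (Finset.univ.filter fun i : Fin n => (i : ℕ) < k + 1 ∧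
          ((d i).1 / p.m₁ = j ∧ (t : WithBot ℤ) ≤ (d i).2) ∧ p.ExploreAccepts d i) := by
        intro j
        simp only [Finset.mem_filter, Finset.mem_univ, true_and]
        rintro ⟨h3, h4⟩
        exact ⟨by omega, h4⟩
      have hsucc : prefixCount D (k + 1) j t = _ := prefixCount_succ i j t
      have hcast : prefixCount D (i : ℕ) j t = prefixCount D k j t := rfl
      by_cases h : (D i).1 = j ∧ (t : WithBot ℤ) ≤ (D i).2
      · by_cases hm : p.ExploreAccepts d i
        · have h2 : i ∉ (Finset.univ.filter fun i : Fin n => (i : ℕ) < k ∧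
              ((d i).1 / p.m₁ = j ∧ (t : WithBot ℤ) ≤ (d i).2) ∧ p.ExploreAccepts d i) := by
            simp [i]
          have h3 := Finset.card_le_card (Finset.insert_subset
            (a := i) (by
              simp only [Finset.mem_filter, Finset.mem_univ, true_and]
              exact ⟨Nat.lt_succ_self k, h, hm⟩) hsub)
          rw [Finset.card_insert_of_notMem h2] at h3
          rw [if_pos h] at hsucc
          omega
        · have h1 : p.P < prefixCount D (k + 1) j t := by
            by_contra hle
            refine hm ⟨t, ?_, h.2, ?_⟩
            · have := h.1; simp only [D, coarsen] at this; rw [this]; exact ht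
            · have := h.1; simp only [D, coarsen] at this; rw [this]; exact not_lt.1 hle
          rw [if_pos h] at hsucc
          have := Finset.card_le_card hsub
          omega
      · rw [if_neg h] at hsucc
        have := Finset.card_le_card hsub
        omega
  have hn := key n le_rfl
  rw [prefixCount_of_le le_rfl] at hn
  change min p.P (slotCount D j t) ≤ A n at hn
  rw [hA] at hn
  omega

end SlotParams

/-! ### Few slots fail their quotas. -/

namespace SlotParams

variable (p : SlotParams)

/-- A potential argument without any assumption on the counts `g`: each failure multiplies the
running minimum by at most `(N - 1) / N`, and a minimum of zero leaves no quota to fail. -/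
lemma card_fail_le {N c R : ℕ} (hR : c * (N - 1) ^ R < N ^ R) (g : ℕ → ℕ) (m : ℕ) :
    ((Finset.range m).filter fun s =>
      g s < (Finset.range s).fold min c g * (N - 1) / N).card ≤ R := by
  set M : ℕ → ℕ := fun s => (Finset.range s).fold min c g with hM
  have hsucc : ∀ s, M (s + 1) = min (g s) (M s) := by
    intro s
    simp only [hM, Finset.range_add_one]
    rw [Finset.fold_insert Finset.notMem_range_self]
  -- The first conjunct is the potential. Another failure after `R` of them would need `M ≥ 1`,
  -- contrary to `hR`.
  suffices h : M m * N ^ ((Finset.range m).filter fun s => g s < M s * (N - 1) / N).card ≤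
      c * (N - 1) ^ ((Finset.range m).filter fun s => g s < M s * (N - 1) / N).card ∧
      ((Finset.range m).filter fun s => g s < M s * (N - 1) / N).card ≤ R from h.2
  induction m with
  | zero => simp [hM]
  | succ k ih =>
    obtain ⟨h1, h2⟩ := ih
    rw [Finset.range_add_one, Finset.filter_insert]
    split_ifs with hk
    · rw [Finset.card_insert_of_notMem (by simp)]
      set q := ((Finset.range k).filter fun s => g s < M s * (N - 1) / N).card
      have hpos : 1 ≤ M k := by
        by_contra h0
        have : M k = 0 := by omega
        rw [this] at hk
        simp at hk
      refine ⟨?_, ?_⟩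
      · have h3 : M (k + 1) * N ≤ M k * (N - 1) := by
          rw [hsucc]
          calc min (g k) (M k) * N ≤ (M k * (N - 1) / N) * N :=
                Nat.mul_le_mul_right _ ((min_le_left _ _).trans hk.le)
            _ ≤ _ := Nat.div_mul_le_self _ _
        calc M (k + 1) * N ^ (q + 1) = M (k + 1) * N * N ^ q := by ring
          _ ≤ M k * (N - 1) * N ^ q := Nat.mul_le_mul_right _ h3
          _ = M k * N ^ q * (N - 1) := by ring
          _ ≤ c * (N - 1) ^ q * (N - 1) := Nat.mul_le_mul_right _ h1
          _ = _ := by ring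
      · by_contra hq
        have hq : q = R := by omega
        rw [hq] at h1
        have : N ^ R ≤ M k * N ^ R := Nat.le_mul_of_pos_left _ hpos
        omega
    · refine ⟨le_trans (Nat.mul_le_mul_right _ ?_) h1, h2⟩
      rw [hsucc]
      exact min_le_right _ _

lemma card_failing_le {C D : ℕ → ℤ → ℕ} {R m₀ : ℕ}
    (hR : p.c * (p.N - 1) ^ R < p.N ^ R) :
    ((Finset.range (m₀ * p.m₁)).filter fun s =>
      ∃ b ∈ p.levels D (s / p.m₁), C s b < p.quota C s b).card ≤
      m₀ * (m₀ * m₀ * p.N * (8 * p.B + 1) * R) := by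
  have hsub : ((Finset.range (m₀ * p.m₁)).filter fun s =>
      ∃ b ∈ p.levels D (s / p.m₁), C s b < p.quota C s b) ⊆
      (Finset.range m₀).biUnion fun j => (p.levels D j).biUnion fun b =>
        (Finset.range (m₀ * p.m₁)).filter fun s => C s b < p.quota C s b := by
    intro s hs
    simp only [Finset.mem_filter, Finset.mem_range, Finset.mem_biUnion] at hs ⊢
    obtain ⟨h1, b, hb, h2⟩ := hs
    exact ⟨s / p.m₁, Nat.div_lt_of_lt_mul (by rwa [mul_comm]), b, hb, h1, h2⟩
  refine (Finset.card_le_card hsub).trans ?_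
  refine (Finset.card_biUnion_le_card_mul _ _ (m₀ * m₀ * p.N * (8 * p.B + 1) * R) ?_).trans
    (by rw [Finset.card_range])
  intro j hj
  refine (Finset.card_biUnion_le_card_mul _ _ R fun b _ => ?_).trans ?_
  · exact card_fail_le hR (fun s => C s b) _
  · refine Nat.mul_le_mul_right _ ((p.card_levels_le _ _).trans ?_)
    have := (Finset.mem_range.1 hj).le
    gcongr

/-- The guarantees of the slotted algorithm on labelled elements, independent of the order of
arrival within slots. -/
structure Covers {n : ℕ} (d : Fin n → ℕ × WithBot ℤ) (A : Finset (Fin n)) : Prop where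
  explore : ∀ j, ∀ t ∈ p.levels (p.coarseCount d) j,
    (∀ e, (d e).1 / p.m₁ = j → (t : WithBot ℤ) ≤ (d e).2 → e ∈ A) ∨
      p.P ≤ (A.filter fun e => (d e).1 / p.m₁ = j ∧ (t : WithBot ℤ) ≤ (d e).2).card
  main : ∀ s, (∀ b ∈ p.levels (p.coarseCount d) (s / p.m₁),
      p.quota (slotCount d) s b ≤ slotCount d s b) →
    ∀ b ∈ p.levels (p.coarseCount d) (s / p.m₁), p.quota (slotCount d) s b ≤
      (A.filter fun e => (d e).1 = s ∧ (b : WithBot ℤ) ≤ (d e).2).card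

end SlotParams

/-! ### Discretization of times and values, and its measurability. -/

lemma slotCount_comp_perm {n : ℕ} (d : Fin n → ℕ × WithBot ℤ) (σ : Equiv.Perm (Fin n)) :
    slotCount (fun i => d (σ i)) = slotCount d := by
  funext s t
  unfold slotCount
  rw [← Finset.card_map σ.toEmbedding]
  congr 1
  ext e
  simp only [Finset.mem_map, Finset.mem_filter, Finset.mem_univ, true_and,
    Equiv.coe_toEmbedding]
  constructor
  · rintro ⟨a, h, rfl⟩
    exact h
  · intro h
    exact ⟨σ.symm e, by simpa using h, by simp⟩

/-- The level of a value: the largest `b` with `(1 + 1/N) ^ b ≤ v`, and `⊥` for `v = 0`. -/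
noncomputable def level (N : ℕ) (v : ℝ≥0) : WithBot ℤ :=
  if v = 0 then ⊥ else ((⌊Real.logb (1 + 1 / (N : ℝ)) v⌋ : ℤ) : WithBot ℤ)

lemma coe_le_level {N : ℕ} (hN : 0 < N) (b : ℤ) (v : ℝ≥0) :
    (b : WithBot ℤ) ≤ level N v ↔ (1 + 1 / (N : ℝ)) ^ b ≤ v := by
  have hN' : (0 : ℝ) < N := Nat.cast_pos.2 hN
  have hρ : (1 : ℝ) < 1 + 1 / (N : ℝ) := by
    have : 0 < 1 / (N : ℝ) := by positivity
    linarith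
  unfold level
  split_ifs with h
  · simp only [h, le_bot_iff, WithBot.coe_ne_bot, NNReal.coe_zero, false_iff, not_le]
    positivity
  · have hv : (0 : ℝ) < v := NNReal.coe_pos.2 (pos_iff_ne_zero.2 h)
    rw [WithBot.coe_le_coe, Int.le_floor, Real.le_logb_iff_rpow_le hρ hv, Real.rpow_intCast]

/-- The number of the slot containing time `t`, when `[0, 1]` is cut into `m` slots. -/
noncomputable def fineSlot (m : ℕ) (t : unitInterval) : ℕ := min ⌊(t : ℝ) * m⌋₊ (m - 1)

lemma fineSlot_lt {m : ℕ} (hm : 0 < m) (t : unitInterval) : fineSlot m t < m :=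
  lt_of_le_of_lt (min_le_right _ _) (by omega)

lemma fineSlot_mono (m : ℕ) : Monotone (fineSlot m) := fun _ _ hab =>
  min_le_min_right _ (Nat.floor_le_floor (mul_le_mul_of_nonneg_right hab (Nat.cast_nonneg _)))

lemma measurable_fineSlot (m : ℕ) : Measurable (fineSlot m) := by
  unfold fineSlot
  exact (Nat.measurable_floor.comp (measurable_subtype_coe.mul_const _)).min measurable_const

/-- What the slotted algorithm retains of an arriving element. -/
noncomputable def discretize (N m : ℕ) (x : unitInterval × ℝ≥0) : ℕ × WithBot ℤ :=
  (fineSlot m x.1, level N x.2)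

lemma measurable_level_eq (N : ℕ) (b : WithBot ℤ) : MeasurableSet {v : ℝ≥0 | level N v = b} := by
  have h : ∀ b : ℤ, MeasurableSet {v : ℝ≥0 | ⌊Real.logb (1 + 1 / (N : ℝ)) v⌋ = b} := by
    intro b
    have : Measurable fun v : ℝ≥0 => ⌊Real.logb (1 + 1 / (N : ℝ)) v⌋ := by
      unfold Real.logb
      exact Int.measurable_floor.comp
        ((Real.measurable_log.comp measurable_coe_nnreal_real).div_const _)
    exact this (measurableSet_singleton b)
  have h0 : MeasurableSet {v : ℝ≥0 | v = 0} := measurableSet_singleton 0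
  induction b with
  | bot =>
    have : {v : ℝ≥0 | level N v = ⊥} = {v : ℝ≥0 | v = 0} := by
      ext v
      simp only [Set.mem_ofPred_eq]
      unfold level
      split_ifs with hv <;> simp [hv]
    rw [this]
    exact h0
  | coe b =>
    have : {v : ℝ≥0 | level N v = b} = {v : ℝ≥0 | v = 0}ᶜ ∩
        {v : ℝ≥0 | ⌊Real.logb (1 + 1 / (N : ℝ)) v⌋ = b} := by
      ext v
      simp only [Set.mem_ofPred_eq, Set.mem_inter_iff, Set.mem_compl_iff]
      unfold level
      split_ifs with hv <;> simp [hv]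
    rw [this]
    exact h0.compl.inter (h b)

lemma measurableSet_discretize_eq (N m : ℕ) (y : ℕ × WithBot ℤ) :
    MeasurableSet {x | discretize N m x = y} := by
  have : {x | discretize N m x = y} =
      (fun x : unitInterval × ℝ≥0 => fineSlot m x.1) ⁻¹' {y.1} ∩
        Prod.snd ⁻¹' {v : ℝ≥0 | level N v = y.2} := by
    ext x
    simp [discretize, Prod.ext_iff]
  rw [this]
  exact ((measurable_fineSlot m).comp measurable_fst (measurableSet_singleton _)).inter
    (measurable_snd (measurable_level_eq N y.2))

/-- Discretized data take countably many values, so no condition on `F` is needed. -/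
lemma measurable_comp_discretize (N m k : ℕ) {β : Type*} [MeasurableSpace β]
    (F : (Fin k → ℕ × WithBot ℤ) → β) :
    Measurable fun x : Fin k → unitInterval × ℝ≥0 => F fun j => discretize N m (x j) := by
  intro s _
  have : (fun x : Fin k → unitInterval × ℝ≥0 => F fun j => discretize N m (x j)) ⁻¹' s =
      ⋃ y ∈ F ⁻¹' s, ⋂ j, {x | discretize N m (x j) = y j} := by
    ext x
    simp only [Set.mem_preimage, Set.mem_iUnion, Set.mem_iInter, Set.mem_ofPred_eq, exists_prop]
    constructor
    · intro h
      exact ⟨_, h, fun j => rfl⟩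
    · rintro ⟨y, hy, h⟩
      rw [funext h]
      exact hy
  rw [this]
  refine MeasurableSet.biUnion (Set.to_countable _) fun y _ => MeasurableSet.iInter fun j => ?_
  have hj : Measurable fun x : Fin k → unitInterval × ℝ≥0 => x j := measurable_pi_apply j
  exact hj (measurableSet_discretize_eq N m (y j))

/-! ### The slotted algorithm as an online algorithm. -/

open Classical in
/-- The slotted algorithm, with `m` fine slots. -/
noncomputable def SlotParams.alg (p : SlotParams) (m : ℕ) : OnlineAlg where
  Seed := Unit
  law := Measure.dirac ()
  select _ k x := decide (p.Accepts (slotCount fun j => discretize p.N m (x j))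
    (slotCount fun j : Fin k => discretize p.N m (x j.castSucc))
    (slotCount fun j => coarsen p.m₁ (discretize p.N m (x j)))
    (discretize p.N m (x (Fin.last k))))
  measurable_select k := (measurable_comp_discretize p.N m (k + 1) fun y =>
    decide (p.Accepts (slotCount y) (slotCount fun j : Fin k => y j.castSucc)
      (slotCount fun j => coarsen p.m₁ (y j)) (y (Fin.last k)))).comp measurable_snd

namespace ByzInstance

variable {n : ℕ} (P : ByzInstance n)

/-- The slot and the level of each element. -/
noncomputable def slotData (N m : ℕ) (u : Fin n → unitInterval) (e : Fin n) : ℕ × WithBot ℤ :=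
  discretize N m (P.time u e, P.value e)

lemma monotone_time_order (u : Fin n → unitInterval) :
    Monotone fun i => P.time u (P.order u i) :=
  Tuple.monotone_sort (P.time u)

end ByzInstance

namespace SlotParams

variable (p : SlotParams) (m : ℕ) {n : ℕ} (P : ByzInstance n) (u : Fin n → unitInterval)

lemma alg_select_iff (i : Fin n) (s : Unit) :
    (p.alg m).select s i (fun j => P.stream u (Fin.castLE i.isLt j)) = true ↔
      p.ExploreAccepts (fun i => P.slotData p.N m u (P.order u i)) i ∨
      p.MainAccepts (fun i => P.slotData p.N m u (P.order u i)) i := by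
  have hd : Monotone fun i => ((fun i => P.slotData p.N m u (P.order u i)) i).1 :=
    fun a b hab => fineSlot_mono m (P.monotone_time_order u hab)
  rw [← p.accepts_iff hd]
  simp only [alg, decide_eq_true_eq]
  rw [← slotCount_castLE (Nat.succ_le_of_lt i.isLt), ← slotCount_castLE i.isLt.le,
    ← slotCount_castLE (Nat.succ_le_of_lt i.isLt)]
  rfl

lemma mem_alg_selected (s : Unit) (e : Fin n) :
    e ∈ (p.alg m).selected P s u ↔
      p.ExploreAccepts (fun i => P.slotData p.N m u (P.order u i)) ((P.order u).symm e) ∨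
      p.MainAccepts (fun i => P.slotData p.N m u (P.order u i)) ((P.order u).symm e) := by
  unfold OnlineAlg.selected
  simp only [Finset.mem_map, Finset.mem_filter, Finset.mem_univ, true_and,
    Equiv.coe_toEmbedding]
  constructor
  · rintro ⟨i, hi, rfl⟩
    rw [Equiv.symm_apply_apply]
    exact (p.alg_select_iff m P u i s).1 hi
  · intro h
    exact ⟨_, (p.alg_select_iff m P u _ s).2 h, Equiv.apply_symm_apply _ _⟩

lemma coarseCount_comp_perm (d : Fin n → ℕ × WithBot ℤ) (σ : Equiv.Perm (Fin n)) :
    p.coarseCount (fun i => d (σ i)) = p.coarseCount d :=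
  slotCount_comp_perm (fun i => coarsen p.m₁ (d i)) σ

/-- Slot counts are invariant under relabelling, so the stream guarantees carry over from arrival
positions to elements. From here on the order of arrival within slots plays no role. -/
theorem covers_selected (s : Unit) :
    p.Covers (P.slotData p.N m u) ((p.alg m).selected P s u) := by
  classical
  set d := P.slotData p.N m u
  set σ := P.order u
  have hsel : ∀ i, (p.ExploreAccepts (fun i => d (σ i)) i ∨
      p.MainAccepts (fun i => d (σ i)) i) → σ i ∈ (p.alg m).selected P s u := by
    intro i hi
    rw [mem_alg_selected]
    change p.ExploreAccepts (fun i => d (σ i)) (σ.symm (σ i)) ∨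
      p.MainAccepts (fun i => d (σ i)) (σ.symm (σ i))
    rwa [Equiv.symm_apply_apply]
  constructor
  · intro j t ht
    rw [← p.coarseCount_comp_perm d σ] at ht
    rcases p.explore_dichotomy j ht with h | h
    · left
      intro e h1 h2
      have := hsel (σ.symm e) (Or.inl (h (σ.symm e) (by simpa using h1) (by simpa using h2)))
      simpa using this
    · right
      refine h.trans ?_
      rw [← Finset.card_map σ.toEmbedding]
      apply Finset.card_le_card
      intro e
      simp only [Finset.mem_map, Finset.mem_filter, Finset.mem_univ, true_and,
        Equiv.coe_toEmbedding]
      rintro ⟨i, ⟨h1, h2⟩, rfl⟩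
      exact ⟨hsel i (Or.inl h2), h1⟩
  · intro s' hs b hb
    rw [← p.coarseCount_comp_perm d σ] at hs hb
    rw [← slotCount_comp_perm d σ] at hs ⊢
    refine (p.quota_le_card_mainAccepts s' hb hs).trans ?_
    rw [← Finset.card_map σ.toEmbedding]
    apply Finset.card_le_card
    intro e
    simp only [Finset.mem_map, Finset.mem_filter, Finset.mem_univ, true_and,
      Equiv.coe_toEmbedding]
    rintro ⟨i, ⟨h1, h2⟩, rfl⟩
    exact ⟨hsel i (Or.inr h2), h1⟩

theorem card_selected_le {m₀ : ℕ} (hm : m = m₀ * p.m₁) (hpos : 0 < m) (s : Unit) :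
    ((p.alg m).selected P s u).card ≤
      m₀ * (m₀ * m₀ * p.N * (8 * p.B + 1)) * p.P + m * p.c := by
  classical
  set d := fun i => P.slotData p.N m u (P.order u i)
  have hlt : ∀ i, (d i).1 < m := fun i => fineSlot_lt hpos _
  unfold OnlineAlg.selected
  rw [Finset.card_map]
  have hsub : (Finset.univ.filter fun i : Fin n =>
      (p.alg m).select s i (fun j => P.stream u (Fin.castLE i.isLt j)) = true) ⊆
      (Finset.univ.filter fun i => p.ExploreAccepts d i) ∪
        (Finset.range m).biUnion fun s' =>
          Finset.univ.filter fun i => (d i).1 = s' ∧ p.MainAccepts d i := by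
    intro i hi
    simp only [Finset.mem_filter, Finset.mem_univ, true_and, Finset.mem_union,
      Finset.mem_biUnion, Finset.mem_range] at hi ⊢
    rcases (p.alg_select_iff m P u i s).1 hi with h | h
    · exact Or.inl h
    · exact Or.inr ⟨_, hlt i, rfl, h⟩
  refine (Finset.card_le_card hsub).trans ((Finset.card_union_le _ _).trans ?_)
  refine Nat.add_le_add (p.card_exploreAccepts_le fun i => ?_) ?_
  · exact Nat.div_lt_of_lt_mul (by rw [mul_comm, ← hm]; exact hlt i)
  · refine (Finset.card_biUnion_le_card_mul _ _ p.c fun s' _ =>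
      p.card_mainAccepts_slot_le s').trans (by rw [Finset.card_range])

end SlotParams

/-! ### Measurability of the collected value. -/

section measurability

variable {n : ℕ} (P : ByzInstance n)

lemma ByzInstance.measurable_time (e : Fin n) : Measurable fun u => P.time u e := by
  unfold ByzInstance.time
  split_ifs
  · exact measurable_pi_apply e
  · exact measurable_const

/-- The sorting permutation is the one that makes the times monotone and breaks ties by label. -/
lemma ByzInstance.measurableSet_order_eq (σ : Equiv.Perm (Fin n)) :
    MeasurableSet {u | P.order u = σ} := by
  have : {u | P.order u = σ} =
      (⋂ (i) (j) (_ : i ≤ j), {u | P.time u (σ i) ≤ P.time u (σ j)}) ∩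
      ⋂ (i) (j) (_ : i < j) (_ : ¬ σ i < σ j), {u | P.time u (σ i) = P.time u (σ j)}ᶜ := by
    ext u
    simp only [Set.mem_ofPred_eq, ByzInstance.order, Set.mem_inter_iff, Set.mem_iInter,
      Set.mem_compl_iff]
    rw [eq_comm, Tuple.eq_sort_iff]
    refine and_congr Iff.rfl (forall_congr' fun i => forall_congr' fun j => forall_congr' fun _ => ?_)
    rw [not_imp_not]
  rw [this]
  exact (MeasurableSet.iInter fun i => MeasurableSet.iInter fun j => MeasurableSet.iInter fun _ =>
      measurableSet_le (P.measurable_time _) (P.measurable_time _)).inter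
    (MeasurableSet.iInter fun i => MeasurableSet.iInter fun j => MeasurableSet.iInter fun _ =>
      MeasurableSet.iInter fun _ =>
      (measurableSet_eq_fun (P.measurable_time _) (P.measurable_time _)).compl)

/-- Split by the finitely many orders of arrival; for a fixed order the observed data are measurable
in the draws. -/
lemma OnlineAlg.measurable_selected_sum (A : OnlineAlg) (s : A.Seed) :
    Measurable fun u => ((∑ e ∈ A.selected P s u, P.value e : ℝ≥0) : ℝ) := by
  refine measurable_coe_nnreal_real.comp ?_
  have hσ : ∀ σ : Equiv.Perm (Fin n), Measurable fun u : Fin n → unitInterval =>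
      ∑ i : Fin n, if A.select s i (fun j => (P.time u (σ (Fin.castLE i.isLt j)),
        P.value (σ (Fin.castLE i.isLt j)))) = true then P.value (σ i) else 0 := by
    intro σ
    refine Finset.measurable_sum _ fun i _ => Measurable.ite ?_ measurable_const measurable_const
    have : Measurable fun u : Fin n → unitInterval =>
        A.select s i (fun j => (P.time u (σ (Fin.castLE i.isLt j)),
          P.value (σ (Fin.castLE i.isLt j)))) :=
      (A.measurable_select i).comp (measurable_const.prodMk (measurable_pi_lambda _ fun j =>
        (P.measurable_time _).prodMk measurable_const))
    exact this (measurableSet_singleton true)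
  have heq : (fun u => ∑ e ∈ A.selected P s u, P.value e) = fun u =>
      ∑ σ : Equiv.Perm (Fin n), if P.order u = σ then
        (∑ i : Fin n, if A.select s i (fun j => (P.time u (σ (Fin.castLE i.isLt j)),
          P.value (σ (Fin.castLE i.isLt j)))) = true then P.value (σ i) else 0) else 0 := by
    funext u
    rw [Finset.sum_ite_eq, if_pos (Finset.mem_univ _)]
    unfold OnlineAlg.selected
    rw [Finset.sum_map, Finset.sum_filter]
    rfl
  rw [heq]
  exact Finset.measurable_sum _ fun σ _ =>
    Measurable.ite (P.measurableSet_order_eq σ) (hσ σ) measurable_const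

lemma OnlineAlg.expectedValue_of_law_eq_dirac (A : OnlineAlg) [Subsingleton A.Seed] {s : A.Seed}
    (h : A.law = Measure.dirac s) :
    A.expectedValue P = ∫ u, ((∑ e ∈ A.selected P s u, P.value e : ℝ≥0) : ℝ) := by
  unfold OnlineAlg.expectedValue
  have hz : (fun z : A.Seed × (Fin n → unitInterval) =>
      ((∑ e ∈ A.selected P z.1 z.2, P.value e : ℝ≥0) : ℝ)) =
      (fun u => ((∑ e ∈ A.selected P s u, P.value e : ℝ≥0) : ℝ)) ∘ Prod.snd := by
    funext z
    simp only [Function.comp, Subsingleton.elim z.1 s]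
  rw [hz, h, Measure.dirac_prod, integral_map measurable_prodMk_left.aemeasurable]
  · rfl
  · exact ((OnlineAlg.measurable_selected_sum P A s).comp measurable_snd).aestronglyMeasurable

lemma SlotParams.expectedValue_alg (p : SlotParams) (m : ℕ) :
    (p.alg m).expectedValue P =
      ∫ u, ((∑ e ∈ (p.alg m).selected P () u, P.value e : ℝ≥0) : ℝ) := by
  have : Subsingleton (p.alg m).Seed := inferInstanceAs (Subsingleton Unit)
  exact OnlineAlg.expectedValue_of_law_eq_dirac P (p.alg m) rfl

end measurability

/-! ### Uniform draws induce independent uniform fine slots. -/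

lemma volume_le_fineSlot {m : ℕ} {s : ℕ} (hs : s ≤ m) (hm : 0 < m) :
    (volume {t : unitInterval | s ≤ fineSlot m t}).toReal = 1 - s / m := by
  have hm' : (0 : ℝ) < m := Nat.cast_pos.2 hm
  rcases hs.eq_or_lt with rfl | hs
  · have : {t : unitInterval | s ≤ fineSlot s t} = ∅ := by
      ext t
      simpa using fineSlot_lt hm t
    rw [this]
    simp [hm'.ne']
  · have hle : (s : ℝ) / m ≤ 1 := (div_le_one hm').2 (by exact_mod_cast hs.le)
    have : {t : unitInterval | s ≤ fineSlot m t} =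
        Set.Ici (⟨s / m, by positivity, hle⟩ : unitInterval) := by
      ext t
      simp only [fineSlot, Set.mem_ofPred_eq, le_min_iff, Set.mem_Ici, ← Subtype.coe_le_coe]
      rw [Nat.le_floor_iff (mul_nonneg t.2.1 hm'.le), div_le_iff₀ hm']
      exact and_iff_left (by omega)
    rw [this, unitInterval.volume_Ici, ENNReal.toReal_ofReal]
    simpa using hle

lemma volume_fineSlot_eq {m : ℕ} {s : ℕ} (hs : s < m) :
    (volume {t : unitInterval | fineSlot m t = s}).toReal = 1 / m := by
  have hm : 0 < m := by omega
  have hm' : (0 : ℝ) < m := Nat.cast_pos.2 hm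
  have : {t : unitInterval | fineSlot m t = s} =
      {t : unitInterval | s ≤ fineSlot m t} \ {t : unitInterval | s + 1 ≤ fineSlot m t} := by
    ext t
    simp only [Set.mem_ofPred_eq, Set.mem_sdiff]
    omega
  have h2 : MeasurableSet {t : unitInterval | s + 1 ≤ fineSlot m t} :=
    measurableSet_le measurable_const (measurable_fineSlot m)
  have h3 := measureReal_sdiff (μ := (volume : Measure unitInterval))
    (s₁ := {t : unitInterval | s ≤ fineSlot m t})
    (s₂ := {t : unitInterval | s + 1 ≤ fineSlot m t})
    (fun t ht => by simp only [Set.mem_ofPred_eq] at ht ⊢; omega) h2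
  simp only [Measure.real] at h3
  rw [this, h3, volume_le_fineSlot hs.le hm, volume_le_fineSlot hs hm]
  push_cast
  field_simp
  ring

/-- The slots of all draws. -/
noncomputable def slotsOf {n m : ℕ} (hm : 0 < m) (u : Fin n → unitInterval) (e : Fin n) : Fin m :=
  ⟨fineSlot m (u e), fineSlot_lt hm _⟩

lemma measurable_slotsOf {n m : ℕ} (hm : 0 < m) :
    Measurable (slotsOf hm : (Fin n → unitInterval) → _) := by
  refine measurable_pi_lambda _ fun e => ?_
  refine measurable_to_countable' fun s => ?_
  have : (fun u : Fin n → unitInterval => slotsOf hm u e) ⁻¹' {s} =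
      (fun u : Fin n → unitInterval => fineSlot m (u e)) ⁻¹' {(s : ℕ)} := by
    ext u
    simp [slotsOf, Fin.ext_iff]
  rw [this]
  exact ((measurable_fineSlot m).comp (measurable_pi_apply e)) (measurableSet_singleton _)

lemma integral_slotsOf {n m : ℕ} (hm : 0 < m) (f : (Fin n → Fin m) → ℝ) :
    ∫ u, f (slotsOf hm u) = 𝔼 ω, f ω := by
  have hmap := integral_map (μ := (volume : Measure (Fin n → unitInterval)))
    (measurable_slotsOf hm).aemeasurable (f := f) (measurable_of_finite f).aestronglyMeasurable
  rw [← hmap]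
  have : IsProbabilityMeasure
      (Measure.map (slotsOf hm) (volume : Measure (Fin n → unitInterval))) :=
    Measure.isProbabilityMeasure_map (measurable_slotsOf hm).aemeasurable
  rw [integral_fintype .of_finite, Finset.expect_eq_sum_div_card, Finset.sum_div]
  refine Finset.sum_congr rfl fun ω _ => ?_
  have h1 : (Measure.map (slotsOf hm) (volume : Measure (Fin n → unitInterval))).real {ω} =
      (1 / m) ^ n := by
    rw [Measure.real, Measure.map_apply (measurable_slotsOf hm) (measurableSet_singleton _)]
    have h2 : (slotsOf hm : (Fin n → unitInterval) → _) ⁻¹' {ω} =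
        Set.pi Set.univ fun e => {t | fineSlot m t = ω e} := by
      ext u
      simp [slotsOf, funext_iff, Fin.ext_iff]
    rw [h2, volume_pi_pi, ENNReal.toReal_prod]
    simp [volume_fineSlot_eq (ω _).isLt]
  rw [h1]
  simp
  ring

/-! ### Finite expectations over slot assignments. -/

section expect

variable {n m : ℕ}

/-- Exchanging the slot of `e` with the fresh slot is an involution. This identity is the only form
in which independence is used below. -/
lemma expect_resample (e : Fin n) (f : (Fin n → Fin m) → ℝ) :
    𝔼 ω, 𝔼 s, f (Function.update ω e s) = 𝔼 ω, f ω := by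
  rcases Nat.eq_zero_or_pos m with rfl | hm
  · have : IsEmpty (Fin n → Fin 0) := ⟨fun ω => (ω e).elim0⟩
    simp
  have : NeZero m := ⟨hm.ne'⟩
  have hinv : Function.Involutive fun x : (Fin n → Fin m) × Fin m =>
      (Function.update x.1 e x.2, x.1 e) := by
    rintro ⟨ω, s⟩
    simp
  calc 𝔼 ω, 𝔼 s, f (Function.update ω e s)
      = 𝔼 x : (Fin n → Fin m) × Fin m, f (Function.update x.1 e x.2) := by
        rw [← Finset.univ_product_univ, Finset.expect_product]
    _ = 𝔼 x : (Fin n → Fin m) × Fin m, f x.1 :=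
        Fintype.expect_equiv (hinv.toPerm) _ _ fun x => rfl
    _ = 𝔼 ω, f ω := by
        rw [← Finset.univ_product_univ, Finset.expect_product]
        simp

lemma expect_le_of_resample (e : Fin n) {f g : (Fin n → Fin m) → ℝ}
    (h : ∀ ω, 𝔼 s, f (Function.update ω e s) ≤ g ω) : 𝔼 ω, f ω ≤ 𝔼 ω, g ω := by
  rw [← expect_resample e f]
  exact Finset.expect_le_expect fun ω _ => h ω

lemma le_expect_of_resample (e : Fin n) {f g : (Fin n → Fin m) → ℝ}
    (h : ∀ ω, g ω ≤ 𝔼 s, f (Function.update ω e s)) : 𝔼 ω, g ω ≤ 𝔼 ω, f ω := by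
  rw [← expect_resample e f]
  exact Finset.expect_le_expect fun ω _ => h ω

/-- A coordinate whose coarse slot must hit a set that does not depend on it. -/
lemma expect_coarse_mem_le {m₀ m₁ : ℕ} (hm : m = m₀ * m₁) (hpos : 0 < m) (e : Fin n)
    (A : (Fin n → Fin m) → Finset ℕ) (hA : ∀ ω s, A (Function.update ω e s) = A ω) {k : ℕ}
    (hk : ∀ ω, (A ω).card ≤ k) :
    𝔼 ω : Fin n → Fin m, (if (ω e : ℕ) / m₁ ∈ A ω then 1 else 0 : ℝ) ≤ k / m₀ := by
  have hm0 : 0 < m₀ := Nat.pos_of_ne_zero (by rintro rfl; simp at hm; omega)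
  have hm1 : 0 < m₁ := Nat.pos_of_ne_zero (by rintro rfl; simp at hm; omega)
  have : NeZero m := ⟨hpos.ne'⟩
  have h1 : 𝔼 ω : Fin n → Fin m, (if (ω e : ℕ) / m₁ ∈ A ω then 1 else 0 : ℝ) ≤
      𝔼 ω : Fin n → Fin m, (k / m₀ : ℝ) := by
    refine expect_le_of_resample e fun ω => ?_
    simp only [Function.update_self, hA]
    rw [Finset.expect_eq_sum_div_card, Finset.sum_boole, Finset.card_univ, Fintype.card_fin]
    have hcard : (Finset.univ.filter fun s : Fin m => (s : ℕ) / m₁ ∈ A ω).card ≤ k * m₁ := by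
      refine le_trans ?_ (Nat.mul_le_mul_right _ (hk ω))
      have hsub : (Finset.univ.filter fun s : Fin m => (s : ℕ) / m₁ ∈ A ω) ⊆
          (A ω).biUnion fun j => Finset.univ.filter fun s : Fin m => (s : ℕ) / m₁ = j := by
        intro s hs
        simpa using hs
      refine (Finset.card_le_card hsub).trans (Finset.card_biUnion_le_card_mul _ _ _ fun j _ => ?_)
      have : m₁ = (Finset.Ico (j * m₁) (j * m₁ + m₁)).card := by simp
      conv_rhs => rw [this]
      refine Finset.card_le_card_of_injOn (fun s => (s : ℕ)) ?_ fun a _ b _ h => Fin.ext h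
      intro s hs
      simp only [Finset.coe_filter, Finset.mem_univ, true_and, Set.mem_ofPred_eq] at hs
      simp only [Finset.coe_Ico, Set.mem_Ico]
      have h1 := Nat.div_add_mod (s : ℕ) m₁
      have h2 := Nat.mod_lt (s : ℕ) hm1
      rw [hs, mul_comm] at h1
      constructor <;> omega
    have hm0' : (0 : ℝ) < m₀ := Nat.cast_pos.2 hm0
    have hm1' : (0 : ℝ) < m₁ := Nat.cast_pos.2 hm1
    have hcard' : ((Finset.univ.filter fun s : Fin m => (s : ℕ) / m₁ ∈ A ω).card : ℝ) ≤ k * m₁ := by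
      exact_mod_cast hcard
    have hmr : (m : ℝ) = m₀ * m₁ := by rw [hm]; push_cast; rfl
    rw [hmr, div_le_div_iff₀ (by positivity) hm0']
    calc _ ≤ (k * m₁ : ℝ) * m₀ := mul_le_mul_of_nonneg_right hcard' hm0'.le
      _ = _ := by ring
  refine h1.trans (le_of_eq ?_)
  rw [Fintype.expect_const]

/-- The count is a sum of independent indicators of probability `1 / m`, so the variances add up. -/
lemma expect_sq_deviation_le (hpos : 0 < m) (A : Finset (Fin n)) (s : Fin m) :
    𝔼 ω : Fin n → Fin m, (((A.filter fun e => ω e = s).card : ℝ) - A.card / m) ^ 2 ≤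
      A.card / m := by
  have : NeZero m := ⟨hpos.ne'⟩
  have hm' : (0 : ℝ) < m := Nat.cast_pos.2 hpos
  let Y : Fin n → (Fin n → Fin m) → ℝ := fun e ω => (if ω e = s then 1 else 0) - 1 / m
  have hY0 : ∀ e ω, 𝔼 t, Y e (Function.update ω e t) = 0 := by
    intro e ω
    simp only [Y, Function.update_self]
    rw [Finset.expect_sub_distrib, Fintype.expect_const, Finset.expect_eq_sum_div_card]
    simp
  have hsq : ∀ ω, (((A.filter fun e => ω e = s).card : ℝ) - A.card / m) ^ 2 =
      ∑ e ∈ A, ∑ e' ∈ A, Y e ω * Y e' ω := by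
    intro ω
    rw [← Finset.sum_mul_sum, ← pow_two]
    congr 1
    simp only [Y, Finset.sum_sub_distrib, Finset.sum_boole, Finset.sum_const, nsmul_eq_mul]
    ring
  simp only [hsq]
  rw [Finset.expect_sum_comm]
  have hterm : ∀ e ∈ A, 𝔼 ω, ∑ e' ∈ A, Y e ω * Y e' ω ≤ 1 / m := by
    intro e he
    rw [Finset.expect_sum_comm, Finset.sum_eq_single_of_mem e he]
    · have : 𝔼 ω, Y e ω * Y e ω ≤ 𝔼 ω : Fin n → Fin m, (1 / m : ℝ) := by
        refine expect_le_of_resample e fun ω => ?_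
        simp only [Y, Function.update_self]
        rw [Finset.expect_eq_sum_div_card, Finset.card_univ, Fintype.card_fin]
        have h1 : ∀ x : Fin m, ((if x = s then 1 else 0 : ℝ) - 1 / m) *
            ((if x = s then 1 else 0) - 1 / m) =
            (if x = s then (1 - 2 / m : ℝ) else 0) + (1 / m : ℝ) ^ 2 := by
          intro x
          split_ifs <;> ring
        simp only [h1]
        rw [Finset.sum_add_distrib, Finset.sum_ite_eq', if_pos (Finset.mem_univ _),
          Finset.sum_const, Finset.card_univ, Fintype.card_fin, nsmul_eq_mul]
        gcongr
        have : (0 : ℝ) < 1 / m := by positivity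
        have h2 : (m : ℝ) * (1 / m) ^ 2 = 1 / m := by field_simp
        rw [h2]
        have : (2 : ℝ) / m = 1 / m + 1 / m := by ring
        linarith
      refine this.trans (le_of_eq ?_)
      rw [Fintype.expect_const]
    -- Cross terms vanish: resampling `e'` fixes the factor of `e` and averages the other one to
    -- zero.
    · intro e' _ hne
      rw [← expect_resample e']
      have : ∀ ω : Fin n → Fin m, 𝔼 t, Y e (Function.update ω e' t) *
          Y e' (Function.update ω e' t) = 0 := by
        intro ω
        have h1 : ∀ t, Y e (Function.update ω e' t) = Y e ω := by
          intro t
          simp only [Y, Function.update_of_ne hne.symm]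
        simp only [h1]
        rw [← Finset.mul_expect, hY0, mul_zero]
      simp [this]
  refine (Finset.sum_le_sum hterm).trans (le_of_eq ?_)
  rw [Finset.sum_const, nsmul_eq_mul]
  ring

/-- Chebyshev's inequality for the number of elements of `A` in a given slot. -/
lemma expect_sparse_le (hpos : 0 < m) {N : ℕ} (hN : 0 < N) (A : Finset (Fin n)) (hA : 0 < A.card)
    (s : Fin m) :
    𝔼 ω : Fin n → Fin m, (if ((A.filter fun e => ω e = s).card : ℝ) <
      (1 - 1 / (N : ℝ)) * (A.card / m) then 1 else 0 : ℝ) ≤ N ^ 2 * m / A.card := by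
  have hm' : (0 : ℝ) < m := Nat.cast_pos.2 hpos
  have hN' : (0 : ℝ) < N := Nat.cast_pos.2 hN
  have hA' : (0 : ℝ) < A.card := Nat.cast_pos.2 hA
  have h1 : 𝔼 ω : Fin n → Fin m, (if ((A.filter fun e => ω e = s).card : ℝ) <
      (1 - 1 / (N : ℝ)) * (A.card / m) then 1 else 0 : ℝ) ≤
      𝔼 ω : Fin n → Fin m, (N * m / A.card : ℝ) ^ 2 *
        (((A.filter fun e => ω e = s).card : ℝ) - A.card / m) ^ 2 := by
    refine Finset.expect_le_expect fun ω _ => ?_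
    split_ifs with h
    · set X : ℝ := ((A.filter fun e => ω e = s).card : ℝ)
      have h2 : 1 ≤ (N * m / A.card : ℝ) * (A.card / m - X) := by
        have h3 : (A.card : ℝ) / m / N ≤ A.card / m - X := by
          have : (1 - 1 / (N : ℝ)) * (A.card / m) = A.card / m - A.card / m / N := by ring
          linarith
        calc (1 : ℝ) = (N * m / A.card : ℝ) * (A.card / m / N) := by field_simp
          _ ≤ _ := by gcongr
      have h4 : (N * m / A.card : ℝ) ^ 2 * (X - A.card / m) ^ 2 =
          ((N * m / A.card : ℝ) * (A.card / m - X)) ^ 2 := by ring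
      rw [h4]
      nlinarith
    · positivity
  refine h1.trans ?_
  rw [← Finset.mul_expect]
  calc _ ≤ (N * m / A.card : ℝ) ^ 2 * (A.card / m) := by
        gcongr
        exact expect_sq_deviation_le hpos A s
    _ = _ := by field_simp

end expect

/-- The selection depends on exact times, but a lower bound in terms of slots alone reduces the
integral to a finite average. -/
lemma OnlineAlg.expect_le_integral {n m : ℕ} (hm : 0 < m) (A : OnlineAlg) (P : ByzInstance n)
    (s : A.Seed) (f : (Fin n → Fin m) → ℝ)
    (hf : ∀ u, f (slotsOf hm u) ≤ ((∑ e ∈ A.selected P s u, P.value e : ℝ≥0) : ℝ)) :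
    𝔼 ω, f ω ≤ ∫ u, ((∑ e ∈ A.selected P s u, P.value e : ℝ≥0) : ℝ) := by
  rw [← integral_slotsOf hm]
  refine integral_mono ?_ ?_ hf
  · exact ((integrable_map_measure (measurable_of_finite f).aestronglyMeasurable
      (measurable_slotsOf hm).aemeasurable).1 (by
        have : IsProbabilityMeasure
          (Measure.map (slotsOf hm) (volume : Measure (Fin n → unitInterval))) :=
          Measure.isProbabilityMeasure_map (measurable_slotsOf hm).aemeasurable
        exact .of_finite))
  · refine Integrable.of_bound (OnlineAlg.measurable_selected_sum P A s).aestronglyMeasurable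
      ((∑ e, P.value e : ℝ≥0) : ℝ) (Filter.Eventually.of_forall fun u => ?_)
    rw [Real.norm_of_nonneg (NNReal.coe_nonneg _), NNReal.coe_le_coe]
    exact Finset.sum_le_sum_of_subset (Finset.subset_univ _)

/-! ### Levels and the layer-cake decomposition of values. -/

/-- The ratio of consecutive levels. -/
noncomputable def levelBase (N : ℕ) : ℝ := 1 + 1 / (N : ℝ)

section levelBase

variable {N : ℕ}

lemma one_lt_levelBase (hN : 0 < N) : 1 < levelBase N := by
  have : (0 : ℝ) < 1 / N := by positivity
  unfold levelBase
  linarith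

lemma levelBase_zpow_pos (hN : 0 < N) (b : ℤ) : 0 < levelBase N ^ b :=
  zpow_pos (one_pos.trans (one_lt_levelBase hN)) b

lemma levelBase_zpow_mono (hN : 0 < N) {a b : ℤ} (h : a ≤ b) : levelBase N ^ a ≤ levelBase N ^ b :=
  zpow_le_zpow_right₀ (one_lt_levelBase hN).le h

lemma le_level_iff (hN : 0 < N) {b : ℤ} {v : ℝ≥0} :
    (b : WithBot ℤ) ≤ level N v ↔ levelBase N ^ b ≤ v := coe_le_level hN b v

end levelBase

section layerCake

variable {N : ℕ}

lemma sum_zpow_telescope (r : ℝ) {a b : ℤ} (h : a ≤ b) :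
    ∑ t ∈ Finset.Ioc a b, (r ^ t - r ^ (t - 1)) = r ^ b - r ^ a := by
  induction b, h using Int.leInduction with
  | base => simp
  | succ b hab ih =>
    have : Finset.Ioc a (b + 1) = insert (b + 1) (Finset.Ioc a b) := by
      ext t
      simp only [Finset.mem_Ioc, Finset.mem_insert]
      omega
    rw [this, Finset.sum_insert (by simp), ih]
    simp

/-- The truncated value of a level, decomposed into the increments between consecutive levels. -/
noncomputable def layers (N : ℕ) (a b : ℤ) (x : WithBot ℤ) : ℝ :=
  ∑ t ∈ Finset.Ioc a b, if (t : WithBot ℤ) ≤ x then levelBase N ^ t - levelBase N ^ (t - 1) else 0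

lemma layers_eq (N : ℕ) {a b : ℤ} (h : a ≤ b) (x : WithBot ℤ) :
    layers N a b x = 0 ∧ (∀ t : ℤ, (t : WithBot ℤ) ≤ x → t ≤ a) ∨
      ∃ c : ℤ, a ≤ c ∧ c ≤ b ∧ (c : WithBot ℤ) ≤ x ∧ (c = b ∨ ¬ ((c + 1 : ℤ) : WithBot ℤ) ≤ x) ∧
        layers N a b x = levelBase N ^ c - levelBase N ^ a := by
  unfold layers
  rw [← Finset.sum_filter]
  induction x with
  | bot =>
    left
    simp
  | coe y =>
    simp only [WithBot.coe_le_coe]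
    by_cases hy : a ≤ y
    · right
      refine ⟨min y b, le_min hy h, min_le_right _ _, min_le_left _ _, ?_, ?_⟩
      · omega
      · rw [← sum_zpow_telescope _ (le_min hy h)]
        congr 1
        ext t
        simp only [Finset.mem_filter, Finset.mem_Ioc, le_min_iff]
        tauto
    · left
      refine ⟨?_, fun t ht => by omega⟩
      rw [Finset.filter_false_of_mem, Finset.sum_empty]
      intro t ht
      have := (Finset.mem_Ioc.1 ht).1
      omega

lemma layers_le (hN : 0 < N) {a b : ℤ} (h : a ≤ b) (v : ℝ≥0) :
    layers N a b (level N v) ≤ min (v : ℝ) (levelBase N ^ b) := by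
  have hpos := levelBase_zpow_pos hN
  rcases layers_eq N h (level N v) with ⟨h0, -⟩ | ⟨c, h1, h2, h3, -, h5⟩
  · rw [h0]
    exact le_min (NNReal.coe_nonneg v) (hpos b).le
  · rw [h5]
    have := hpos a
    refine le_min ?_ ?_
    · have := (le_level_iff hN).1 h3
      linarith
    · have := levelBase_zpow_mono hN h2
      linarith

/-- Rounding down to a level costs a factor `levelBase N`; ignoring the layers up to `a` costs the
additive term. -/
lemma le_layers (hN : 0 < N) {a b : ℤ} (h : a ≤ b) (v : ℝ≥0) :
    min (v : ℝ) (levelBase N ^ b) ≤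
      levelBase N * layers N a b (level N v) + levelBase N ^ (a + 1) := by
  have hpos := levelBase_zpow_pos hN
  have h1 := one_lt_levelBase hN
  have hsucc : ∀ c : ℤ, levelBase N ^ (c + 1) = levelBase N * levelBase N ^ c := fun c => by
    rw [zpow_add_one₀ (by linarith), mul_comm]
  rcases layers_eq N h (level N v) with ⟨h0, h2⟩ | ⟨c, -, -, -, h4, h5⟩
  · rw [h0, mul_zero, zero_add]
    refine (min_le_left _ _).trans ?_
    by_contra hlt
    have := h2 (a + 1) ((le_level_iff hN).2 (not_le.1 hlt).le)
    omega
  · rw [h5, hsucc]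
    have : levelBase N * (levelBase N ^ c - levelBase N ^ a) + levelBase N * levelBase N ^ a =
        levelBase N ^ (c + 1) := by rw [hsucc]; ring
    rw [this]
    rcases h4 with rfl | h4
    · exact (min_le_right _ _).trans (levelBase_zpow_mono hN (by omega))
    · refine (min_le_left _ _).trans ?_
      rw [le_level_iff hN] at h4
      exact (not_le.1 h4).le

end layerCake

/-! ### Which levels come under consideration. -/

namespace SlotParams

section levels

variable (p : SlotParams) {n : ℕ} {d : Fin n → ℕ × WithBot ℤ}

lemma exists_level_bound (d : Fin n → ℕ × WithBot ℤ) :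
    ∃ T : ℤ, ∀ e, (d e).2 < (T : WithBot ℤ) := by
  obtain ⟨M, hM⟩ := (Set.finite_range fun e => (d e).2).bddAbove
  have hle : ∃ T : ℤ, M < (T : WithBot ℤ) := by
    induction M with
    | bot => exact ⟨0, WithBot.bot_lt_coe 0⟩
    | coe x => exact ⟨x + 1, WithBot.coe_lt_coe.2 (by omega)⟩
  obtain ⟨T, hT⟩ := hle
  exact ⟨T, fun e => (hM ⟨e, rfl⟩).trans_lt hT⟩

lemma coarseCount_eq (i : ℕ) (t : ℤ) : p.coarseCount d i t = (Finset.univ.filter fun e : Fin n =>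
    (d e).1 / p.m₁ = i ∧ (t : WithBot ℤ) ≤ (d e).2).card := rfl

lemma coarseCount_antitone (i : ℕ) : Antitone (p.coarseCount d i) := by
  intro t t' h
  simp only [coarseCount_eq]
  apply Finset.card_le_card
  intro e
  simp only [Finset.mem_filter, Finset.mem_univ, true_and]
  exact fun he => ⟨he.1, (WithBot.coe_le_coe.2 h).trans he.2⟩

lemma one_le_coarseCount {i : ℕ} {t : ℤ} : 1 ≤ p.coarseCount d i t ↔
    ∃ e, (d e).1 / p.m₁ = i ∧ (t : WithBot ℤ) ≤ (d e).2 := by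
  rw [coarseCount_eq, Nat.one_le_iff_ne_zero, ← Nat.pos_iff_ne_zero, Finset.card_pos]
  simp [Finset.Nonempty]

lemma bddAbove_coarseCount (i : ℕ) : BddAbove {t : ℤ | 1 ≤ p.coarseCount d i t} := by
  obtain ⟨T, hT⟩ := exists_level_bound d
  refine ⟨T, fun t ht => ?_⟩
  obtain ⟨e, -, he⟩ := p.one_le_coarseCount.1 ht
  exact (WithBot.coe_lt_coe.1 (he.trans_lt (hT e))).le

lemma le_top {i : ℕ} {t : ℤ} {e : Fin n} (he : (d e).1 / p.m₁ = i)
    (ht : (t : WithBot ℤ) ≤ (d e).2) : t ≤ top (p.coarseCount d) i :=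
  le_csSup (p.bddAbove_coarseCount i) (p.one_le_coarseCount.2 ⟨e, he, ht⟩)

lemma exists_top_le {i : ℕ} {t : ℤ} {e : Fin n} (he : (d e).1 / p.m₁ = i)
    (ht : (t : WithBot ℤ) ≤ (d e).2) :
    ∃ e', (d e').1 / p.m₁ = i ∧ (top (p.coarseCount d) i : WithBot ℤ) ≤ (d e').2 :=
  p.one_le_coarseCount.1 (Int.csSup_mem (s := {t : ℤ | 1 ≤ p.coarseCount d i t})
    ⟨t, p.one_le_coarseCount.2 ⟨e, he, ht⟩⟩ (p.bddAbove_coarseCount i))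

/-- The witness `t` makes the set nonempty and finiteness of the data bounds it above, so the
supremum is attained and is no default value. -/
lemma cand_spec {i i' l : ℕ} {t : ℤ} (ht : 2 ^ l ≤ p.coarseCount d i t -
      p.coarseCount d i (top (p.coarseCount d) i' + p.B + 1)) :
    t ≤ p.cand (p.coarseCount d) i i' l ∧
      2 ^ l ≤ p.coarseCount d i (p.cand (p.coarseCount d) i i' l) -
        p.coarseCount d i (top (p.coarseCount d) i' + p.B + 1) := by
  have hb : BddAbove {t : ℤ | 2 ^ l ≤ p.coarseCount d i t -
      p.coarseCount d i (top (p.coarseCount d) i' + p.B + 1)} := by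
    refine (p.bddAbove_coarseCount (d := d) i).mono fun t ht => ?_
    have h1 : 1 ≤ 2 ^ l := Nat.one_le_two_pow
    simp only [Set.mem_ofPred_eq] at ht ⊢
    omega
  exact ⟨le_csSup hb ht, Int.csSup_mem ⟨t, ht⟩ hb⟩

lemma coarseCount_sub (i : ℕ) {t t' : ℤ} (h : t ≤ t') :
    p.coarseCount d i t - p.coarseCount d i t' = (Finset.univ.filter fun e : Fin n =>
      (d e).1 / p.m₁ = i ∧ (t : WithBot ℤ) ≤ (d e).2 ∧ ¬ (t' : WithBot ℤ) ≤ (d e).2).card := by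
  simp only [coarseCount_eq]
  rw [← Finset.card_sdiff_of_subset]
  · congr 1
    ext e
    simp only [Finset.mem_sdiff, Finset.mem_filter, Finset.mem_univ, true_and]
    tauto
  · intro e
    simp only [Finset.mem_filter, Finset.mem_univ, true_and]
    exact fun he => ⟨he.1, (WithBot.coe_le_coe.2 h).trans he.2⟩

lemma mem_levels {D : ℕ → ℤ → ℕ} {i i' j l : ℕ} {t : ℤ} (hi : i < j) (hi' : i' < j) (hl : l < p.N)
    (h1 : p.cand D i i' l - 4 * p.B ≤ t) (h2 : t ≤ p.cand D i i' l + 4 * p.B) :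
    t ∈ p.levels D j := by
  unfold levels
  refine Finset.mem_image.2 ⟨(((i, i'), l), t - p.cand D i i' l), ?_, by simp⟩
  simp only [Finset.mem_product, Finset.mem_range, Finset.mem_Icc]
  exact ⟨⟨⟨hi, hi'⟩, hl⟩, by omega, by omega⟩

/-- The candidate with `i' = i` and `l = 0` is a level between `β - B` and `β + 2B`; its extension
by `4B` covers everything within `2B` of `β`. -/
lemma mem_levels_of_top {i j : ℕ} (hij : i < j) (hN : 0 < p.N) {β : ℤ} {g : Fin n}
    (hg : (d g).1 / p.m₁ = i) (hg1 : ((β - p.B : ℤ) : WithBot ℤ) ≤ (d g).2)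
    (htop : ∀ e, (d e).1 / p.m₁ = i → (d e).2 ≤ ((β + 2 * p.B : ℤ) : WithBot ℤ)) {t : ℤ}
    (h1 : β - 2 * p.B ≤ t) (h2 : t ≤ β + 2 * p.B) : t ∈ p.levels (p.coarseCount d) j := by
  have hle := p.le_top hg hg1
  obtain ⟨e, he1, he2⟩ := p.exists_top_le hg hg1
  have hD : p.coarseCount d i (top (p.coarseCount d) i + p.B + 1) = 0 := by
    by_contra h0
    obtain ⟨e', h3, h4⟩ := p.one_le_coarseCount.1 (Nat.one_le_iff_ne_zero.2 h0)
    have := p.le_top h3 h4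
    omega
  have hspec := p.cand_spec (d := d) (i := i) (i' := i) (l := 0) (t := β - p.B) (by
    rw [hD, pow_zero, Nat.sub_zero]
    exact p.one_le_coarseCount.2 ⟨g, hg, hg1⟩)
  obtain ⟨h3, h4⟩ := hspec
  rw [hD, pow_zero, Nat.sub_zero] at h4
  obtain ⟨e', h5, h6⟩ := p.one_le_coarseCount.1 h4
  have h7 := WithBot.coe_le_coe.1 (h6.trans (htop e' h5))
  exact p.mem_levels hij hij hN (by omega) (by omega)

end levels

/-! ### Collecting `V` by exploration, and the halving argument. -/

section wins

variable (p : SlotParams) {n : ℕ} {d : Fin n → ℕ × WithBot ℤ} {v : Fin n → ℝ≥0}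
  {A : Finset (Fin n)} {V : ℝ}

lemma le_sum_of_card (hN : 0 < p.N) (hd : ∀ e, (d e).2 = level p.N (v e)) {k : ℕ} {t : ℤ}
    {q : Fin n → Prop} [DecidablePred q]
    (hk : k ≤ (A.filter fun e => q e ∧ (t : WithBot ℤ) ≤ (d e).2).card)
    (hV : V ≤ k * levelBase p.N ^ t) : V ≤ ∑ e ∈ A, (v e : ℝ) := by
  have hpos := levelBase_zpow_pos hN t
  calc V ≤ k * levelBase p.N ^ t := hV
    _ ≤ (A.filter fun e => q e ∧ (t : WithBot ℤ) ≤ (d e).2).card * levelBase p.N ^ t := by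
        gcongr
    _ = ∑ e ∈ A.filter fun e => q e ∧ (t : WithBot ℤ) ≤ (d e).2, levelBase p.N ^ t := by
        rw [Finset.sum_const, nsmul_eq_mul]
    _ ≤ ∑ e ∈ A.filter fun e => q e ∧ (t : WithBot ℤ) ≤ (d e).2, (v e : ℝ) := by
        refine Finset.sum_le_sum fun e he => ?_
        have := (Finset.mem_filter.1 he).2.2
        rw [hd, le_level_iff hN] at this
        exact this
    _ ≤ ∑ e ∈ A, (v e : ℝ) :=
        Finset.sum_le_sum_of_subset_of_nonneg (Finset.filter_subset _ _)
          fun _ _ _ => NNReal.coe_nonneg _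

lemma le_sum_of_mem {e : Fin n} (he : e ∈ A) (hV : V ≤ v e) : V ≤ ∑ e ∈ A, (v e : ℝ) :=
  hV.trans (Finset.single_le_sum (f := fun e => (v e : ℝ)) (fun _ _ => NNReal.coe_nonneg _) he)

/-- Every element of coarse slot `j` above an explored level is selected, unless the selected
elements are worth `V` already. -/
lemma mem_or_le_sum (hN : 0 < p.N) (hd : ∀ e, (d e).2 = level p.N (v e)) (hA : p.Covers d A)
    {j : ℕ} {t : ℤ} (ht : t ∈ p.levels (p.coarseCount d) j) (hV : V ≤ p.P * levelBase p.N ^ t) :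
    (∀ e, (d e).1 / p.m₁ = j → (t : WithBot ℤ) ≤ (d e).2 → e ∈ A) ∨ V ≤ ∑ e ∈ A, (v e : ℝ) :=
  (hA.explore j t ht).imp_right fun h => p.le_sum_of_card hN hd h hV

/-- If coarse slots that contain an element worth `V` keep arriving after slot `i`, which contains
an element of the right magnitude, then the explored levels halve in number until the selected
elements are worth `V`. -/
lemma le_sum_of_chain (hN : 0 < p.N) (hd : ∀ e, (d e).2 = level p.N (v e)) (hA : p.Covers d A)
    (hn : n < 2 ^ p.N) (hP : 1 ≤ p.P) (hB : 1 ≤ p.B) {β : ℤ} (hβ : levelBase p.N ^ β ≤ V)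
    (hVP : V ≤ p.P * levelBase p.N ^ β) (hVβ : V ≤ levelBase p.N ^ (β + 1)) {g : Fin n}
    (hg1 : ((β - p.B : ℤ) : WithBot ℤ) ≤ (d g).2) (hg2 : (d g).2 ≤ ((β + p.B : ℤ) : WithBot ℤ)) :
    ∀ (q j : ℕ), (d g).1 / p.m₁ < j → (∃ r, (d r).1 / p.m₁ = j ∧ V ≤ v r) →
      (Finset.univ.filter fun e : Fin n => (d e).1 / p.m₁ = (d g).1 / p.m₁ ∧
        ((β - p.B : ℤ) : WithBot ℤ) ≤ (d e).2 ∧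
        ¬ ((top (p.coarseCount d) j + p.B + 1 : ℤ) : WithBot ℤ) ≤ (d e).2).card < 2 ^ q →
      ∀ J : Finset ℕ, (∀ j' ∈ J, j < j' ∧ ∃ r, (d r).1 / p.m₁ = j' ∧ V ≤ v r) → q ≤ J.card →
      V ≤ ∑ e ∈ A, (v e : ℝ) := by
  set i := (d g).1 / p.m₁ with hi
  set D := p.coarseCount d with hD
  have hlev : ∀ {r}, V ≤ v r → (β : WithBot ℤ) ≤ (d r).2 := by
    intro r hr
    rw [hd, le_level_iff hN]
    exact hβ.trans hr
  have hgmem : ∀ j, (∃ r, (d r).1 / p.m₁ = j ∧ V ≤ v r) → β ≤ top D j ∧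
      g ∈ (Finset.univ.filter fun e : Fin n => (d e).1 / p.m₁ = i ∧
        ((β - p.B : ℤ) : WithBot ℤ) ≤ (d e).2 ∧
        ¬ ((top D j + p.B + 1 : ℤ) : WithBot ℤ) ≤ (d e).2) := by
    rintro j ⟨r, hr1, hr2⟩
    have hle : β ≤ top D j := p.le_top hr1 (hlev hr2)
    refine ⟨hle, ?_⟩
    simp only [Finset.mem_filter, Finset.mem_univ, true_and]
    refine ⟨hi.symm, hg1, fun h => ?_⟩
    have := WithBot.coe_le_coe.1 (h.trans hg2)
    omega
  intro q
  induction q with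
  | zero =>
    intro j hij hr hcard
    have := Finset.card_pos.2 ⟨g, (hgmem j hr).2⟩
    omega
  | succ q ih =>
    intro j hij hr hcard J hJ hq
    obtain ⟨htop, hg⟩ := hgmem j hr
    have htop' : β ≤ top (p.coarseCount d) j := htop
    have hJne : J.Nonempty := Finset.card_pos.1 (by omega)
    set j₁ := J.min' hJne with hj₁
    obtain ⟨hjj, r, hr1, hr2⟩ := hJ _ (J.min'_mem hJne)
    set X := (Finset.univ.filter fun e : Fin n => (d e).1 / p.m₁ = i ∧
        ((β - p.B : ℤ) : WithBot ℤ) ≤ (d e).2 ∧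
        ¬ ((top D j + p.B + 1 : ℤ) : WithBot ℤ) ≤ (d e).2) with hX
    have hXpos : 0 < X.card := Finset.card_pos.2 ⟨g, hg⟩
    have hXn : X.card ≤ n := (Finset.card_le_univ X).trans (by simp)
    -- For this rank, more than half of `X` lies at the candidate level or above.
    set l := Nat.log 2 X.card
    have hl1 : 2 ^ l ≤ X.card := Nat.pow_log_le_self 2 hXpos.ne'
    have hl2 : X.card < 2 ^ (l + 1) := Nat.lt_pow_succ_log_self (by norm_num) _
    have hlN : l < p.N := by
      by_contra h
      have := Nat.pow_le_pow_right (n := 2) (by norm_num) (not_lt.1 h)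
      omega
    obtain ⟨hθ1, hθ2⟩ := p.cand_spec (d := d) (i := i) (i' := j) (l := l) (t := β - p.B) (by
      rw [p.coarseCount_sub i (by omega)]
      exact hl1)
    set θ := p.cand (p.coarseCount d) i j l with hθ
    have hlev1 : ∀ t : ℤ, θ - 4 * p.B ≤ t → t ≤ θ + 4 * p.B → t ∈ p.levels D j₁ :=
      fun t h1 h2 => p.mem_levels (hij.trans hjj) hjj hlN h1 h2
    -- Here `θ ≥ β - B`, so `β` itself is explored in `j₁`, where `r` is worth `V`.
    by_cases hsmall : θ ≤ β + 2 * p.B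
    · rcases p.mem_or_le_sum hN hd hA (hlev1 β (by omega) (by omega)) hVP with h | h
      · exact le_sum_of_mem (h r hr1 (hlev hr2)) hr2
      · exact h
    have hbig : ∀ e, ((θ - p.B : ℤ) : WithBot ℤ) ≤ (d e).2 → V ≤ v e := by
      intro e he
      rw [hd, le_level_iff hN] at he
      exact hVβ.trans ((levelBase_zpow_mono hN (by omega)).trans he)
    by_cases hex : ∃ e, (d e).1 / p.m₁ = j₁ ∧ ((θ - p.B : ℤ) : WithBot ℤ) ≤ (d e).2
    · obtain ⟨e, he1, he2⟩ := hex
      have hP' : V ≤ p.P * levelBase p.N ^ (θ - p.B) := by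
        have h1 : V ≤ levelBase p.N ^ (θ - p.B) := hVβ.trans (levelBase_zpow_mono hN (by omega))
        have h2 : (1 : ℝ) ≤ p.P := by exact_mod_cast hP
        nlinarith [levelBase_zpow_pos hN (θ - p.B)]
      rcases p.mem_or_le_sum hN hd hA (hlev1 (θ - p.B) (by omega) (by omega)) hP' with h | h
      · exact le_sum_of_mem (h e he1 he2) (hbig e he2)
      · exact h
    -- Otherwise everything in slot `i` at level `θ` or above exceeds the top of `j₁` by more than
    -- `B`. These at least `2 ^ l` elements drop out of the set.
    · have htop1 : top D j₁ < θ - p.B := by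
        obtain ⟨e, he1, he2⟩ := p.exists_top_le hr1 (hlev hr2)
        by_contra hle
        exact hex ⟨e, he1, (WithBot.coe_le_coe.2 (not_lt.1 hle)).trans he2⟩
      refine ih j₁ (hij.trans hjj) ⟨r, hr1, hr2⟩ ?_ (J.erase j₁) ?_ ?_
      · set Y := (Finset.univ.filter fun e : Fin n => (d e).1 / p.m₁ = i ∧
          ((β - p.B : ℤ) : WithBot ℤ) ≤ (d e).2 ∧
          ¬ ((top D j₁ + p.B + 1 : ℤ) : WithBot ℤ) ≤ (d e).2)
        set Z := (Finset.univ.filter fun e : Fin n => (d e).1 / p.m₁ = i ∧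
          (θ : WithBot ℤ) ≤ (d e).2 ∧ ¬ ((top D j + p.B + 1 : ℤ) : WithBot ℤ) ≤ (d e).2) with hZ
        have hθtop : θ ≤ top D j + p.B + 1 := by
          by_contra hlt
          have := p.coarseCount_antitone (d := d) i (not_le.1 hlt).le
          have h1 : 1 ≤ 2 ^ l := Nat.one_le_two_pow
          simp only [hD] at this
          omega
        have hZcard : 2 ^ l ≤ Z.card := by
          rw [p.coarseCount_sub i hθtop] at hθ2
          exact hθ2
        have hdisj : Disjoint Y Z := by
          rw [Finset.disjoint_left]
          intro e he hez
          simp only [Y, Z, Finset.mem_filter, Finset.mem_univ, true_and] at he hez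
          exact he.2.2 ((WithBot.coe_le_coe.2 (by omega)).trans hez.2.1)
        have hsub : Y ∪ Z ⊆ X := by
          intro e he
          simp only [X, Y, Z, Finset.mem_union, Finset.mem_filter, Finset.mem_univ, true_and]
            at he ⊢
          rcases he with he | he
          · exact ⟨he.1, he.2.1, fun h => he.2.2 ((WithBot.coe_le_coe.2 (by omega)).trans h)⟩
          · exact ⟨he.1, (WithBot.coe_le_coe.2 hθ1).trans he.2.1, he.2.2⟩
        have h1 := Finset.card_le_card hsub
        rw [Finset.card_union_of_disjoint hdisj] at h1
        rw [pow_succ] at hcard hl2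
        by_cases hlq : q ≤ l
        · have := Nat.pow_le_pow_right (n := 2) (by norm_num) hlq
          omega
        · have : 2 ^ (l + 1) ≤ 2 ^ q := Nat.pow_le_pow_right (by norm_num) (by omega)
          rw [pow_succ] at this
          omega
      · intro j' hj'
        have h1 := Finset.mem_erase.1 hj'
        exact ⟨lt_of_le_of_ne (J.min'_le _ h1.2) (Ne.symm h1.1), (hJ _ h1.2).2⟩
      · rw [Finset.card_erase_of_mem (J.min'_mem hJne)]
        omega

end wins

end SlotParams

/-! ### The quota rule on evenly spread elements. -/

namespace SlotParams

section quota

variable (p : SlotParams) {n : ℕ} {d : Fin n → ℕ × WithBot ℤ} {A S : Finset (Fin n)}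

lemma le_card_good_slots {m₀ F : ℕ} (hm₁ : 0 < p.m₁) (hN : 0 < p.N) {q : ℕ → Prop}
    [DecidablePred q]
    (hF : p.N * ((F + 1) * p.m₁) ≤ m₀ * p.m₁)
    (hq : p.N * ((Finset.range (m₀ * p.m₁)).filter fun s => ¬ q s).card ≤ m₀ * p.m₁) :
    (1 - 2 / (p.N : ℝ)) * ((m₀ * p.m₁ : ℕ) : ℝ) ≤
      ((Finset.range (m₀ * p.m₁)).filter fun s => F < s / p.m₁ ∧ q s).card := by
  set m := m₀ * p.m₁
  have hsub : Finset.range m ⊆ ((Finset.range m).filter fun s => F < s / p.m₁ ∧ q s) ∪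
      (Finset.range ((F + 1) * p.m₁) ∪ (Finset.range m).filter fun s => ¬ q s) := by
    intro s hs
    simp only [Finset.mem_union, Finset.mem_filter, hs, true_and, Finset.mem_range]
    by_cases h1 : F < s / p.m₁
    · by_cases h2 : q s
      · exact Or.inl ⟨h1, h2⟩
      · exact Or.inr (Or.inr h2)
    · right; left
      exact (Nat.div_lt_iff_lt_mul hm₁).1 (by omega)
  have h1 := (Finset.card_le_card hsub).trans ((Finset.card_union_le _ _).trans
    (Nat.add_le_add_left (Finset.card_union_le _ _) _))
  rw [Finset.card_range, Finset.card_range] at h1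
  set a := ((Finset.range m).filter fun s => F < s / p.m₁ ∧ q s).card
  set b := ((Finset.range m).filter fun s => ¬ q s).card
  have h2 : p.N * m ≤ p.N * a + 2 * m := by nlinarith
  have h3 : (p.N : ℝ) * m ≤ p.N * a + 2 * m := by exact_mod_cast h2
  have hN' : (0 : ℝ) < p.N := by exact_mod_cast hN
  have : (1 - 2 / (p.N : ℝ)) * m = (p.N * m - 2 * m) / p.N := by field_simp
  rw [this, div_le_iff₀ hN']
  linarith

/-- By `hconc` each fine slot has at least `k` elements above `b`, and elements outside `S` only
raise the counts, so the running minimum stays at least `k`. The constant 6 collects 2 for slots up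
to `F` and failing slots, 2 for the two factors `1 - 1/N`, and 2 for rounding down twice. -/
lemma count_of_concentration {m₀ F : ℕ} (hm₁ : 0 < p.m₁) (hm₀ : 0 < m₀) (hN : 4 ≤ p.N)
    (hA : p.Covers d A) {b : ℤ} (hb : ∀ j, F < j → b ∈ p.levels (p.coarseCount d) j)
    (hF : p.N * ((F + 1) * p.m₁) ≤ m₀ * p.m₁)
    (hfail : p.N * ((Finset.range (m₀ * p.m₁)).filter fun s =>
      ∃ b ∈ p.levels (p.coarseCount d) (s / p.m₁), slotCount d s b < p.quota (slotCount d) s b).card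
        ≤ m₀ * p.m₁)
    (hconc : ∀ s < m₀ * p.m₁, (S.filter fun e => (b : WithBot ℤ) ≤ (d e).2).card * (p.N - 1) ≤
      p.N * (m₀ * p.m₁) * (S.filter fun e => (d e).1 = s ∧ (b : WithBot ℤ) ≤ (d e).2).card)
    (hc : (S.filter fun e => (b : WithBot ℤ) ≤ (d e).2).card * (p.N - 1) /
      (p.N * (m₀ * p.m₁)) ≤ p.c)
    (hQ : m₀ * p.m₁ * p.N ≤ (S.filter fun e => (b : WithBot ℤ) ≤ (d e).2).card) :
    (1 - 6 / (p.N : ℝ)) * (S.filter fun e => (b : WithBot ℤ) ≤ (d e).2).card ≤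
      ((A.filter fun e => (b : WithBot ℤ) ≤ (d e).2).card : ℝ) := by
  classical
  set m := m₀ * p.m₁
  have hmpos : 0 < m := Nat.mul_pos hm₀ hm₁
  set a := (S.filter fun e => (b : WithBot ℤ) ≤ (d e).2).card
  set k := a * (p.N - 1) / (p.N * m)
  set k' := k * (p.N - 1) / p.N
  set q : ℕ → Prop := fun s => ∀ b ∈ p.levels (p.coarseCount d) (s / p.m₁),
    p.quota (slotCount d) s b ≤ slotCount d s b
  set G := (Finset.range m).filter fun s => F < s / p.m₁ ∧ q s
  have hG1 : (1 - 2 / (p.N : ℝ)) * (m : ℝ) ≤ G.card := by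
    refine p.le_card_good_slots hm₁ (by omega) hF ?_
    simpa only [q, not_forall, not_le, exists_prop] using hfail
  have hG2 : G.card ≤ m := (Finset.card_filter_le _ _).trans (by rw [Finset.card_range])
  have hslot : ∀ s ∈ G, k' ≤ (A.filter fun e => (d e).1 = s ∧ (b : WithBot ℤ) ≤ (d e).2).card := by
    intro s hs
    obtain ⟨hs1, hs2, hs3⟩ := Finset.mem_filter.1 hs
    rw [Finset.mem_range] at hs1
    refine le_trans ?_ (hA.main s hs3 b (hb _ hs2))
    unfold quota
    refine Nat.div_le_div_right (Nat.mul_le_mul_right _ ?_)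
    refine (Finset.le_fold_min _).2 ⟨hc, fun s' hs' => ?_⟩
    have hs'm : s' < m := (Finset.mem_range.1 hs').trans hs1
    refine (Nat.div_le_of_le_mul (hconc s' hs'm)).trans ?_
    apply Finset.card_le_card
    intro e
    simp only [Finset.mem_filter, Finset.mem_univ, true_and]
    exact fun h => h.2
  have hsum : G.card * k' ≤ (A.filter fun e => (b : WithBot ℤ) ≤ (d e).2).card := by
    have h1 : (A.filter fun e => (b : WithBot ℤ) ≤ (d e).2).card ≥
        (G.biUnion fun s => A.filter fun e => (d e).1 = s ∧ (b : WithBot ℤ) ≤ (d e).2).card := by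
      apply Finset.card_le_card
      intro e
      simp only [Finset.mem_biUnion, Finset.mem_filter]
      rintro ⟨s, -, h1, -, h2⟩
      exact ⟨h1, h2⟩
    rw [Finset.card_biUnion] at h1
    · refine le_trans ?_ h1
      rw [← smul_eq_mul]
      exact Finset.card_nsmul_le_sum _ _ _ hslot
    · intro s _ s' _ hne
      rw [Function.onFun, Finset.disjoint_left]
      intro e he he'
      exact hne ((Finset.mem_filter.1 he).2.1.symm.trans (Finset.mem_filter.1 he').2.1)
  have hsum' : (G.card : ℝ) * k' ≤ ((A.filter fun e => (b : WithBot ℤ) ≤ (d e).2).card : ℝ) := by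
    exact_mod_cast hsum
  refine le_trans ?_ hsum'
  have hN0 : (0 : ℝ) < p.N := by exact_mod_cast (by omega : 0 < p.N)
  have hN4 : (4 : ℝ) ≤ p.N := by exact_mod_cast hN
  have hm' : (0 : ℝ) < m := by exact_mod_cast hmpos
  have hsubN : ((p.N - 1 : ℕ) : ℝ) = p.N - 1 := by
    rw [Nat.cast_sub (by omega)]; simp
  have hdiv : ∀ x y : ℕ, 0 < y → (x : ℝ) / y - 1 ≤ ((x / y : ℕ) : ℝ) := by
    intro x y hy
    have h1 := Nat.div_add_mod x y
    have h2 := Nat.mod_lt x hy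
    have h3 : x ≤ y * (x / y) + y := by omega
    have h4 : (x : ℝ) ≤ y * ((x / y : ℕ) : ℝ) + y := by exact_mod_cast h3
    have hy' : (0 : ℝ) < y := by exact_mod_cast hy
    rw [sub_le_iff_le_add, div_le_iff₀ hy']
    linarith
  have hk : (a : ℝ) * (p.N - 1) / (p.N * m) - 1 ≤ k := by
    have := hdiv (a * (p.N - 1)) (p.N * m) (Nat.mul_pos (by omega) hmpos)
    push_cast at this
    rwa [hsubN] at this
  have hk' : (k : ℝ) * (p.N - 1) / p.N - 1 ≤ k' := by
    have := hdiv (k * (p.N - 1)) p.N (by omega)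
    push_cast at this
    rwa [hsubN] at this
  set x : ℝ := 1 / p.N with hx
  have hx0 : 0 < x := by positivity
  have hx4 : x ≤ 1 / 4 := by rw [hx]; gcongr
  have hNx : (p.N : ℝ) * x = 1 := by rw [hx]; field_simp
  have e1 : (a : ℝ) * (p.N - 1) / (p.N * m) = a / m * (1 - x) := by rw [hx]; field_simp
  have e2 : (k : ℝ) * (p.N - 1) / p.N = k * (1 - x) := by rw [hx]; field_simp
  have e3 : 6 / (p.N : ℝ) = 6 * x := by rw [hx]; ring
  have e4 : 2 / (p.N : ℝ) = 2 * x := by rw [hx]; ring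
  rw [e1] at hk
  rw [e2] at hk'
  rw [e3]
  rw [e4] at hG1
  have haQ : (m : ℝ) ≤ a * x := by
    have : (m : ℝ) * p.N ≤ a := by exact_mod_cast hQ
    calc (m : ℝ) = m * p.N * x := by rw [mul_assoc, hNx, mul_one]
      _ ≤ a * x := by gcongr
  have ha0 : (0 : ℝ) ≤ a := Nat.cast_nonneg _
  have hy : (a : ℝ) / m * (1 - 2 * x) - 2 ≤ k' := by
    have h1 : ((a : ℝ) / m * (1 - x) - 1) * (1 - x) ≤ k * (1 - x) := by
      gcongr; linarith
    have h2 : (a : ℝ) / m * (1 - 2 * x) ≤ a / m * (1 - x) * (1 - x) := by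
      have : 0 ≤ (a : ℝ) / m := by positivity
      nlinarith [sq_nonneg x]
    nlinarith
  have hmy : (a : ℝ) * (1 - 4 * x) ≤ m * ((a : ℝ) / m * (1 - 2 * x) - 2) := by
    have : m * ((a : ℝ) / m * (1 - 2 * x) - 2) = a * (1 - 2 * x) - 2 * m := by field_simp
    rw [this]
    linarith
  have hpos : 0 ≤ (a : ℝ) * (1 - 4 * x) := mul_nonneg ha0 (by linarith)
  calc (1 - 6 * x) * a ≤ (1 - 2 * x) * (a * (1 - 4 * x)) := by nlinarith [sq_nonneg x]
    _ ≤ (1 - 2 * x) * (m * ((a : ℝ) / m * (1 - 2 * x) - 2)) := by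
        gcongr; linarith
    _ ≤ (1 - 2 * x) * (m * k') := by
        gcongr; linarith
    _ = (1 - 2 * x) * m * k' := by ring
    _ ≤ G.card * k' := by gcongr

end quota

lemma sum_layers {N n : ℕ} {d : Fin n → ℕ × WithBot ℤ} (A : Finset (Fin n)) (a b : ℤ) :
    ∑ e ∈ A, layers N a b (d e).2 = ∑ t ∈ Finset.Ioc a b,
      (levelBase N ^ t - levelBase N ^ (t - 1)) *
        ((A.filter fun e => (t : WithBot ℤ) ≤ (d e).2).card : ℝ) := by
  unfold layers
  rw [Finset.sum_comm]
  refine Finset.sum_congr rfl fun t _ => ?_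
  rw [← Finset.sum_filter, Finset.sum_const, nsmul_eq_mul, mul_comm]

/-- Sum the count bounds over the layers. The constant 9 consists of 6 from the counts, 1 from `Q`,
1 from rounding to levels and 1 from values below the lowest layer. -/
lemma sum_min_le_of_counts {N n : ℕ} (hN : 0 < N) {d : Fin n → ℕ × WithBot ℤ} {v : Fin n → ℝ≥0}
    (hd : ∀ e, (d e).2 = level N (v e)) {A S : Finset (Fin n)} {V Q : ℝ}
    {a b : ℤ} (hab : a ≤ b)
    (hcount : ∀ t ∈ Finset.Ioc a b,
      (1 - 6 / (N : ℝ)) * (S.filter fun e => (t : WithBot ℤ) ≤ (d e).2).card - Q ≤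
        ((A.filter fun e => (t : WithBot ℤ) ≤ (d e).2).card : ℝ))
    (hS : ∑ e ∈ S, (v e : ℝ) ≤ V) (ha : n * levelBase N ^ (a + 1) ≤ V / N)
    (hQ0 : 0 ≤ Q) (hQ : Q * levelBase N ^ b ≤ V / N) :
    ∑ e ∈ S, min (v e : ℝ) (levelBase N ^ b) - 9 * (V / N) ≤
      ∑ e ∈ A, min (v e : ℝ) (levelBase N ^ b) := by
  have hpos := levelBase_zpow_pos hN
  have hN' : (0 : ℝ) < N := by exact_mod_cast hN
  set L := ∑ e ∈ S, layers N a b (d e).2 with hL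
  set M := ∑ e ∈ S, min (v e : ℝ) (levelBase N ^ b)
  have hLM : L ≤ M := Finset.sum_le_sum fun e _ => by rw [hd]; exact layers_le hN hab _
  have hMV : M ≤ V := (Finset.sum_le_sum fun e _ => min_le_left _ _).trans hS
  have hML : M ≤ levelBase N * L + V / N := by
    calc M ≤ ∑ e ∈ S, (levelBase N * layers N a b (d e).2 + levelBase N ^ (a + 1)) :=
          Finset.sum_le_sum fun e _ => by rw [hd]; exact le_layers hN hab _
      _ = levelBase N * L + S.card * levelBase N ^ (a + 1) := by
          rw [Finset.sum_add_distrib, ← Finset.mul_sum, Finset.sum_const, nsmul_eq_mul]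
      _ ≤ levelBase N * L + n * levelBase N ^ (a + 1) := by
          have h1 : S.card ≤ n := (Finset.card_le_univ S).trans (by simp)
          have h2 : (S.card : ℝ) ≤ n := by exact_mod_cast h1
          have := (hpos (a + 1)).le
          gcongr
      _ ≤ _ := by linarith
  have hbase : levelBase N * L = L + L / N := by unfold levelBase; ring
  have hLV : L / N ≤ V / N := by gcongr; linarith
  have hAL : (1 - 6 / (N : ℝ)) * L - Q * levelBase N ^ b ≤
      ∑ e ∈ A, layers N a b (d e).2 := by
    rw [hL, sum_layers, sum_layers]
    have hΔ : ∀ t : ℤ, 0 ≤ levelBase N ^ t - levelBase N ^ (t - 1) := fun t =>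
      sub_nonneg.2 (levelBase_zpow_mono hN (by omega))
    have h1 : (1 - 6 / (N : ℝ)) * ∑ t ∈ Finset.Ioc a b,
        (levelBase N ^ t - levelBase N ^ (t - 1)) *
          ((S.filter fun e => (t : WithBot ℤ) ≤ (d e).2).card : ℝ) -
        Q * (levelBase N ^ b - levelBase N ^ a) ≤ ∑ t ∈ Finset.Ioc a b,
      (levelBase N ^ t - levelBase N ^ (t - 1)) *
        ((A.filter fun e => (t : WithBot ℤ) ≤ (d e).2).card : ℝ) := by
      rw [← sum_zpow_telescope _ hab, Finset.mul_sum, Finset.mul_sum, ← Finset.sum_sub_distrib]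
      refine Finset.sum_le_sum fun t ht => ?_
      have := mul_le_mul_of_nonneg_left (hcount t ht) (hΔ t)
      linarith
    have h2 : 0 ≤ Q * levelBase N ^ a := mul_nonneg hQ0 (hpos a).le
    linarith
  have hA : ∑ e ∈ A, layers N a b (d e).2 ≤ ∑ e ∈ A, min (v e : ℝ) (levelBase N ^ b) :=
    Finset.sum_le_sum fun e _ => by rw [hd]; exact layers_le hN hab _
  have h6 : (1 - 6 / (N : ℝ)) * L = L - 6 * (L / N) := by ring
  linarith

end SlotParams

/-! ### First slots outside an exceptional set, and last elements of a set. -/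

/-- The first coarse slot outside `J` in which an element of `T` arrives. -/
def firstSlots {n : ℕ} (c : Fin n → ℕ) (T : Finset (Fin n)) (J : Finset ℕ) : Finset ℕ :=
  (T.image c \ J).filter fun j => ∀ e ∈ T, c e ∉ J → j ≤ c e

section firstSlots

variable {n : ℕ} {c : Fin n → ℕ} {T : Finset (Fin n)} {J : Finset ℕ}

lemma mem_firstSlots {j : ℕ} : j ∈ firstSlots c T J ↔
    (∃ e ∈ T, c e = j) ∧ j ∉ J ∧ ∀ e ∈ T, c e ∉ J → j ≤ c e := by
  simp [firstSlots, and_assoc]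

lemma card_firstSlots_le : (firstSlots c T J).card ≤ 1 := by
  refine Finset.card_le_one.2 fun a ha b hb => ?_
  obtain ⟨⟨e, he, rfl⟩, h1, h2⟩ := mem_firstSlots.1 ha
  obtain ⟨⟨e', he', rfl⟩, h3, h4⟩ := mem_firstSlots.1 hb
  exact le_antisymm (h2 e' he' h3) (h4 e he h1)

lemma exists_mem_firstSlots {e : Fin n} (he : e ∈ T) (hJ : c e ∉ J) :
    ∃ F, F ∈ firstSlots c T J := by
  obtain ⟨x, hx, hmin⟩ := Finset.exists_min_image (T.filter fun e => c e ∉ J) c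
    ⟨e, Finset.mem_filter.2 ⟨he, hJ⟩⟩
  exact ⟨c x, mem_firstSlots.2 ⟨⟨x, (Finset.mem_filter.1 hx).1, rfl⟩, (Finset.mem_filter.1 hx).2,
    fun e he hJ => hmin e (Finset.mem_filter.2 ⟨he, hJ⟩)⟩⟩

/-- Applied to sets that omit an element `e`: the first slot is then independent of the arrival of
`e`. -/
lemma firstSlots_congr {c' : Fin n → ℕ} (h : ∀ e ∈ T, c e = c' e) :
    firstSlots c T J = firstSlots c' T J := by
  ext j
  rw [mem_firstSlots, mem_firstSlots]
  constructor
  · rintro ⟨⟨e, he, h1⟩, h2, h3⟩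
    exact ⟨⟨e, he, by rw [← h e he, h1]⟩, h2, fun e he => by rw [← h e he]; exact h3 e he⟩
  · rintro ⟨⟨e, he, h1⟩, h2, h3⟩
    exact ⟨⟨e, he, by rw [h e he, h1]⟩, h2, fun e he => by rw [h e he]; exact h3 e he⟩

end firstSlots

lemma exists_last_elements (J : Finset ℕ) (k : ℕ) : ∃ J' ⊆ J, J'.card ≤ k ∧
    ∀ j ∈ J, j ∉ J' → J'.card = k ∧ ∀ j' ∈ J', j < j' := by
  induction k with
  | zero => exact ⟨∅, by simp, by simp, by simp⟩
  | succ k ih =>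
    obtain ⟨J', h1, h2, h3⟩ := ih
    by_cases hne : (J \ J').Nonempty
    · set x := (J \ J').max' hne
      have hx := (J \ J').max'_mem hne
      obtain ⟨hxJ, hxJ'⟩ := Finset.mem_sdiff.1 hx
      have hcard := (h3 x hxJ hxJ').1
      refine ⟨insert x J', Finset.insert_subset hxJ h1, ?_, fun j hj hj' => ⟨?_, fun j' hj'' => ?_⟩⟩
      · rw [Finset.card_insert_of_notMem hxJ']; omega
      · rw [Finset.card_insert_of_notMem hxJ']; omega
      · rw [Finset.mem_insert, not_or] at hj'
        rcases Finset.mem_insert.1 hj'' with rfl | h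
        · exact lt_of_le_of_ne ((J \ J').le_max' j (Finset.mem_sdiff.2 ⟨hj, hj'.2⟩)) hj'.1
        · exact (h3 j hj hj'.2).2 j' h
    · refine ⟨J', h1, by omega, fun j hj hj' => ?_⟩
      exact absurd ⟨j, Finset.mem_sdiff.2 ⟨hj, hj'⟩⟩ hne

/-! ### Deterministic analysis of one outcome. -/

namespace SlotParams

/-- An outcome of the slotted algorithm on an instance with green elements `G`, largest green
element `g`, and benchmark `V` of level `β`. The coarse slots with a red element worth `V` are those
in `J`, and `J'` consists of the last `N + 1` of them. -/
structure Outcome (p : SlotParams) {n : ℕ} (d : Fin n → ℕ × WithBot ℤ) (v : Fin n → ℝ≥0)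
    (A G : Finset (Fin n)) (g : Fin n) (V : ℝ) (β : ℤ) (J J' : Finset ℕ) : Prop where
  N_ge : 100 ≤ p.N
  B_pos : 1 ≤ p.B
  n_lt : n < 2 ^ p.N
  level_eq : ∀ e, (d e).2 = level p.N (v e)
  covers : p.Covers d A
  le_V : levelBase p.N ^ β ≤ V
  V_lt : V < levelBase p.N ^ (β + 1)
  V_le_P : V ≤ p.P * levelBase p.N ^ β
  g_mem : g ∈ G
  le_g : ∀ e ∈ G, v e ≤ v g
  green_le : ∀ e ∈ G, e ≠ g → (v e : ℝ) ≤ V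
  red_mem : ∀ e ∉ G, V ≤ v e → (d e).1 / p.m₁ ∈ J
  mem_J : ∀ j ∈ J, ∃ e, (d e).1 / p.m₁ = j ∧ V ≤ v e
  J'_sub : J' ⊆ J
  J'_card : J'.card ≤ p.N + 1
  J'_last : ∀ j ∈ J, j ∉ J' → J'.card = p.N + 1 ∧ ∀ j' ∈ J', j < j'

namespace Outcome

variable {p : SlotParams} {n : ℕ} {d : Fin n → ℕ × WithBot ℤ} {v : Fin n → ℝ≥0}
  {A G : Finset (Fin n)} {g : Fin n} {V : ℝ} {β : ℤ} {J J' : Finset ℕ}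

lemma N_pos (h : p.Outcome d v A G g V β J J') : 0 < p.N := by
  have := h.N_ge
  omega

lemma V_pos (h : p.Outcome d v A G g V β J J') : 0 < V :=
  (levelBase_zpow_pos h.N_pos β).trans_le h.le_V

lemma P_pos (h : p.Outcome d v A G g V β J J') : 1 ≤ p.P := by
  by_contra h0
  have h1 : p.P = 0 := by omega
  have h2 := h.V_le_P
  rw [h1, Nat.cast_zero, zero_mul] at h2
  exact absurd h.V_pos (not_lt.2 h2)

lemma level_le_of_lt (h : p.Outcome d v A G g V β J J') {e : Fin n} {t : ℤ}
    (he : (v e : ℝ) < levelBase p.N ^ (t + 1)) : (d e).2 ≤ (t : WithBot ℤ) := by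
  rw [h.level_eq]
  by_contra hlt
  rw [not_le] at hlt
  have h1 : ((t + 1 : ℤ) : WithBot ℤ) ≤ level p.N (v e) := by
    generalize level p.N (v e) = x at hlt
    induction x with
    | bot => simp at hlt
    | coe x =>
      rw [WithBot.coe_lt_coe] at hlt
      rw [WithBot.coe_le_coe]
      omega
  rw [le_level_iff h.N_pos] at h1
  exact absurd he (not_lt.2 h1)

/-- All `N + 1` slots of `J'` come after `F`: one starts the chain and `N` halvings follow, which
exhausts fewer than `2 ^ N` elements. -/
lemma le_sum_of_mem_J (h : p.Outcome d v A G g V β J J') {F : ℕ} (hF : F ∈ J) (hF' : F ∉ J')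
    {e : Fin n} (he : (d e).1 / p.m₁ = F) (he1 : ((β - p.B : ℤ) : WithBot ℤ) ≤ (d e).2)
    (he2 : (d e).2 ≤ ((β + p.B : ℤ) : WithBot ℤ)) : V ≤ ∑ e ∈ A, (v e : ℝ) := by
  obtain ⟨hcard, hlt⟩ := h.J'_last F hF hF'
  have hne : J'.Nonempty := Finset.card_pos.1 (by omega)
  set j := J'.min' hne
  have hj := J'.min'_mem hne
  refine p.le_sum_of_chain h.N_pos h.level_eq h.covers h.n_lt h.P_pos h.B_pos h.le_V h.V_le_P
    h.V_lt.le he1 he2 p.N j (by rw [he]; exact hlt j hj) (h.mem_J j (h.J'_sub hj)) ?_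
    (J'.erase j) ?_ ?_
  · exact (Finset.card_le_univ _).trans_lt (by simpa using h.n_lt)
  · intro j' hj'
    obtain ⟨h1, h2⟩ := Finset.mem_erase.1 hj'
    exact ⟨lt_of_le_of_ne (J'.min'_le _ h2) (Ne.symm h1), h.mem_J j' (h.J'_sub h2)⟩
  · rw [Finset.card_erase_of_mem hj]
    omega

/-- Outside `J` no red element is worth `V`, so only `g` could push the top of `F` far above `β`. -/
lemma mem_levels (h : p.Outcome d v A G g V β J J') {F : ℕ} (hF : F ∉ J)
    {e : Fin n} (he : (d e).1 / p.m₁ = F) (he1 : ((β - p.B : ℤ) : WithBot ℤ) ≤ (d e).2)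
    (hg : (d g).1 / p.m₁ = F → (d g).2 ≤ ((β + p.B : ℤ) : WithBot ℤ)) {j : ℕ} (hj : F < j) {t : ℤ}
    (h1 : β - 2 * p.B ≤ t) (h2 : t ≤ β + 2 * p.B) : t ∈ p.levels (p.coarseCount d) j := by
  refine p.mem_levels_of_top hj h.N_pos he he1 (fun e' he' => ?_) h1 h2
  by_cases hG : e' ∈ G
  · by_cases heg : e' = g
    · subst heg
      exact (hg he').trans (WithBot.coe_le_coe.2 (by omega))
    · refine (h.level_le_of_lt (t := β) ((h.green_le e' hG heg).trans_lt h.V_lt)).trans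
        (WithBot.coe_le_coe.2 (by omega))
  · have : (v e' : ℝ) < V := by
      by_contra hle
      exact hF (he' ▸ h.red_mem e' hG (not_lt.1 hle))
    exact (h.level_le_of_lt (t := β) (this.trans h.V_lt)).trans (WithBot.coe_le_coe.2 (by omega))

/-- If the largest green element dwarfs the benchmark, then it is selected in the last coarse slot
unless the selected elements are worth the benchmark. -/
lemma of_huge (h : p.Outcome d v A G g V β J J')
    {W : ℝ} (hW : W ≤ levelBase p.N ^ (β + p.B))
    (hg : ((β + p.B : ℤ) : WithBot ℤ) ≤ (d g).2) {F : ℕ}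
    (hF : F ∈ firstSlots (fun e => (d e).1 / p.m₁)
      ((G.erase g).filter fun e => ((β - p.B : ℤ) : WithBot ℤ) ≤ (d e).2) J') :
    (F ∈ J → V ≤ ∑ e ∈ A, (v e : ℝ)) ∧
      (F ∉ J → F < (d g).1 / p.m₁ → W ≤ ∑ e ∈ A, (v e : ℝ)) := by
  obtain ⟨⟨e, he, he1⟩, hF', -⟩ := mem_firstSlots.1 hF
  obtain ⟨he2, he3⟩ := Finset.mem_filter.1 he
  obtain ⟨he4, he5⟩ := Finset.mem_erase.1 he2
  have hle : (d e).2 ≤ ((β + p.B : ℤ) : WithBot ℤ) :=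
    (h.level_le_of_lt (t := β) ((h.green_le e he5 he4).trans_lt h.V_lt)).trans
      (WithBot.coe_le_coe.2 (by omega))
  refine ⟨fun hJ => h.le_sum_of_mem_J hJ hF' he1 he3 hle, fun hJ hFg => ?_⟩
  have hlev := h.mem_levels hJ he1 he3 (fun h => absurd h hFg.ne') hFg (t := β + p.B)
    (by omega) (by omega)
  have hP : (1 : ℝ) ≤ p.P := by exact_mod_cast h.P_pos
  have hpos := levelBase_zpow_pos h.N_pos (β + p.B)
  rcases p.mem_or_le_sum (V := W) h.N_pos h.level_eq h.covers hlev (by nlinarith) with h1 | h1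
  · refine le_sum_of_mem (h1 g rfl hg) (hW.trans ?_)
    rwa [h.level_eq, le_level_iff h.N_pos] at hg
  · exact h1

/-- If the slot of the largest green element is not exceptional and the small elements are spread
evenly, then the selected elements are worth the benchmark up to elements that share a slot. -/
lemma of_moderate (h : p.Outcome d v A G g V β J J') {S : Finset (Fin n)} (hSG : S ⊆ G.erase g)
    (hSV : ∑ e ∈ S, (v e : ℝ) = V) {K : ℕ} (hSK : S.card ≤ K)
    {m₀ Q : ℕ} {a κ : ℤ} (hm₁ : 0 < p.m₁) (hm₀ : p.N * (p.N + 2) ≤ m₀)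
    (hκ : κ ≤ β) (haκ : a < κ) (haβ : a = β - p.B - 1)
    (hVκ : V ≤ p.P * levelBase p.N ^ κ)
    (hna : n * levelBase p.N ^ (a + 1) ≤ V / p.N)
    (hQκ : Q * levelBase p.N ^ κ ≤ V / p.N) (hQ : m₀ * p.m₁ * p.N ≤ Q)
    (hfail : p.N * ((Finset.range (m₀ * p.m₁)).filter fun s =>
      ∃ b ∈ p.levels (p.coarseCount d) (s / p.m₁), slotCount d s b < p.quota (slotCount d) s b).card
        ≤ m₀ * p.m₁)
    (hK : K * (p.N - 1) / (p.N * (m₀ * p.m₁)) ≤ p.c)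
    (hg : (d g).2 ≤ ((β + p.B : ℤ) : WithBot ℤ))
    (hgJ : (d g).1 / p.m₁ ∉ J')
    (hconc : ∀ t ∈ Finset.Ioc a κ, Q ≤ (S.filter fun e => (t : WithBot ℤ) ≤ (d e).2).card →
      ∀ s < m₀ * p.m₁, (S.filter fun e => (t : WithBot ℤ) ≤ (d e).2).card * (p.N - 1) ≤
        p.N * (m₀ * p.m₁) *
          (S.filter fun e => (d e).1 = s ∧ (t : WithBot ℤ) ≤ (d e).2).card) :
    V - 9 * (V / p.N) -
      ∑ e ∈ S, (v e : ℝ) * (if (d e).1 / p.m₁ ∈ J' then 1 else 0) -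
      ∑ e ∈ S, (v e : ℝ) * (if (d e).1 / p.m₁ ∈ firstSlots (fun e => (d e).1 / p.m₁)
        ((G.filter fun e => ((β - p.B : ℤ) : WithBot ℤ) ≤ (d e).2).erase e) J' then 1 else 0) ≤
      ∑ e ∈ A, (v e : ℝ) := by
  classical
  have hN := h.N_pos
  have hN100 := h.N_ge
  have hV := h.V_pos
  have hN' : (0 : ℝ) < p.N := by exact_mod_cast hN
  set c : Fin n → ℕ := fun e => (d e).1 / p.m₁
  set T := G.filter fun e => ((β - p.B : ℤ) : WithBot ℤ) ≤ (d e).2 with hT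
  set w := levelBase p.N ^ κ
  have hw : 0 < w := levelBase_zpow_pos hN κ
  -- Values split into the part up to `w`, left to the quotas, and the excess `φ`, left to
  -- exploration.
  set φ : Fin n → ℝ := fun e => max ((v e : ℝ) - w) 0
  have hφ0 : ∀ e, 0 ≤ φ e := fun e => le_max_right _ _
  have hφv : ∀ e, φ e ≤ v e := fun e => max_le (by linarith) (NNReal.coe_nonneg _)
  have hφ : ∀ e, (v e : ℝ) = min (v e : ℝ) w + φ e := by
    intro e
    simp only [φ]
    rcases le_total (v e : ℝ) w with h1 | h1
    · rw [min_eq_left h1, max_eq_right (by linarith)]; ring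
    · rw [min_eq_right h1, max_eq_left (by linarith)]; ring
  have hφκ : ∀ e, 0 < φ e → (κ : WithBot ℤ) ≤ (d e).2 := by
    intro e he
    rw [h.level_eq, le_level_iff hN]
    by_contra hlt
    have : φ e = 0 := max_eq_right (by linarith [not_le.1 hlt])
    linarith
  have hR1 : 0 ≤ ∑ e ∈ S, (v e : ℝ) * (if c e ∈ J' then 1 else 0) :=
    Finset.sum_nonneg fun e _ => mul_nonneg (NNReal.coe_nonneg _) (by split_ifs <;> norm_num)
  have hR2 : 0 ≤ ∑ e ∈ S, (v e : ℝ) * (if c e ∈ firstSlots c (T.erase e) J' then 1 else 0) :=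
    Finset.sum_nonneg fun e _ => mul_nonneg (NNReal.coe_nonneg _) (by split_ifs <;> norm_num)
  have hVN : 0 ≤ V / p.N := by positivity
  by_cases hwin : V ≤ ∑ e ∈ A, (v e : ℝ)
  · linarith
  have hmemT : ∀ e ∈ G, ∀ t : ℤ, β - p.B ≤ t → (t : WithBot ℤ) ≤ (d e).2 → e ∈ T :=
    fun e he t ht hle => Finset.mem_filter.2 ⟨he, (WithBot.coe_le_coe.2 ht).trans hle⟩
  have hSne : ∃ e ∈ S, ((β - p.B : ℤ) : WithBot ℤ) ≤ (d e).2 := by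
    by_contra hcon
    push Not at hcon
    have h1 : ∑ e ∈ S, (v e : ℝ) ≤ n * levelBase p.N ^ (a + 1) := by
      have h2 : ∀ e ∈ S, (v e : ℝ) ≤ levelBase p.N ^ (a + 1) := by
        intro e he
        have := hcon e he
        rw [h.level_eq, ← not_le, le_level_iff hN] at this
        have h3 : a + 1 = β - p.B := by omega
        rw [h3]
        exact (not_le.1 this).le
      refine (Finset.sum_le_card_nsmul _ _ _ h2).trans ?_
      rw [nsmul_eq_mul]
      have h3 : S.card ≤ n := (Finset.card_le_univ S).trans (by simp)
      have h4 := (levelBase_zpow_pos hN (a + 1)).le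
      gcongr
    have h5 : V / p.N < V := by
      rw [div_lt_iff₀ hN']
      have : (100 : ℝ) ≤ p.N := by exact_mod_cast hN100
      nlinarith
    linarith
  have hgT : g ∈ T := by
    obtain ⟨e, he, hle⟩ := hSne
    refine Finset.mem_filter.2 ⟨h.g_mem, ?_⟩
    rw [h.level_eq, le_level_iff hN] at hle ⊢
    exact hle.trans (NNReal.coe_le_coe.2 (h.le_g e (Finset.mem_of_mem_erase (hSG he))))
  obtain ⟨F, hF⟩ := exists_mem_firstSlots (c := c) (J := J') hgT hgJ
  obtain ⟨⟨f, hfT, hfF⟩, hFJ', hFmin⟩ := mem_firstSlots.1 hF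
  obtain ⟨hfG, hf1⟩ := Finset.mem_filter.1 hfT
  have hf2 : (d f).2 ≤ ((β + p.B : ℤ) : WithBot ℤ) := by
    by_contra hlt
    refine hlt (le_trans ?_ hg)
    rw [h.level_eq, h.level_eq]
    generalize hx : level p.N (v f) = x
    induction x with
    | bot => exact bot_le
    | coe x =>
      have h1 := hx.ge
      rw [le_level_iff hN] at h1 ⊢
      exact h1.trans (NNReal.coe_le_coe.2 (h.le_g f hfG))
  have hFJ : F ∉ J := fun hJ => hwin (h.le_sum_of_mem_J hJ hFJ' hfF hf1 hf2)
  have hlev : ∀ {j : ℕ}, F < j → ∀ {t : ℤ}, β - 2 * p.B ≤ t → t ≤ β + 2 * p.B →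
      t ∈ p.levels (p.coarseCount d) j := fun hj _ h1 h2 =>
    h.mem_levels hFJ hfF hf1 (fun _ => hg) hj h1 h2
  have hbig : ∀ e, F < c e → 0 < φ e → e ∈ A := fun e he hφe =>
    ((p.mem_or_le_sum hN h.level_eq h.covers (hlev he (by omega) (by omega)) hVκ).resolve_right
      hwin) e rfl (hφκ e hφe)
  have hsmall : ∑ e ∈ S, min (v e : ℝ) w - 9 * (V / p.N) ≤ ∑ e ∈ A, min (v e : ℝ) w := by
    refine sum_min_le_of_counts (Q := Q) hN h.level_eq haκ.le (fun t ht => ?_) hSV.le hna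
      (Nat.cast_nonneg _) hQκ
    obtain ⟨ht1, ht2⟩ := Finset.mem_Ioc.1 ht
    by_cases hQt : Q ≤ (S.filter fun e => (t : WithBot ℤ) ≤ (d e).2).card
    · have hm₀pos : 0 < m₀ := lt_of_lt_of_le (Nat.mul_pos hN (by omega)) hm₀
      -- Even spreading puts an element of `T` into every coarse slot. Since `J'` has at most `N +
      -- 1` members, `F` is then at most `N + 1`, and few fine slots precede the end of `F`.
      have hcoarse : ∀ j < m₀, ∃ e ∈ T, c e = j := by
        intro j hj
        have hjm : j * p.m₁ < m₀ * p.m₁ := Nat.mul_lt_mul_of_pos_right hj hm₁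
        have h1 := hconc t ht hQt (j * p.m₁) hjm
        have h2 : 0 < Q := lt_of_lt_of_le (Nat.mul_pos (Nat.mul_pos hm₀pos hm₁) hN) hQ
        have h3 : 0 < (S.filter fun e => (t : WithBot ℤ) ≤ (d e).2).card * (p.N - 1) :=
          Nat.mul_pos (by omega) (by omega)
        have h4 : 0 < (S.filter fun e =>
            (d e).1 = j * p.m₁ ∧ (t : WithBot ℤ) ≤ (d e).2).card := by
          by_contra h0
          have h0 := Nat.eq_zero_of_not_pos h0
          rw [h0, mul_zero] at h1
          omega
        obtain ⟨e, he⟩ := Finset.card_pos.1 h4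
        obtain ⟨he1, he2, he3⟩ := Finset.mem_filter.1 he
        refine ⟨e, hmemT e (Finset.mem_of_mem_erase (hSG he1)) t (by omega) he3, ?_⟩
        simp only [c, he2]
        exact Nat.mul_div_cancel _ hm₁
      have hFN : F ≤ p.N + 1 := by
        have : ∃ j ∈ Finset.range (p.N + 2), j ∉ J' := by
          by_contra hcon
          push Not at hcon
          have := Finset.card_le_card (show Finset.range (p.N + 2) ⊆ J' from hcon)
          rw [Finset.card_range] at this
          have := h.J'_card
          omega
        obtain ⟨j, hj1, hj2⟩ := this
        rw [Finset.mem_range] at hj1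
        obtain ⟨e, he, hej⟩ := hcoarse j (by nlinarith)
        have := hFmin e he (by rw [hej]; exact hj2)
        omega
      have hF' : p.N * ((F + 1) * p.m₁) ≤ m₀ * p.m₁ := by
        calc p.N * ((F + 1) * p.m₁) = p.N * (F + 1) * p.m₁ := by ring
          _ ≤ p.N * (p.N + 2) * p.m₁ :=
            Nat.mul_le_mul_right _ (Nat.mul_le_mul_left _ (by omega))
          _ ≤ m₀ * p.m₁ := by gcongr
      have hcK : (S.filter fun e => (t : WithBot ℤ) ≤ (d e).2).card * (p.N - 1) /
          (p.N * (m₀ * p.m₁)) ≤ p.c :=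
        (Nat.div_le_div_right (Nat.mul_le_mul_right _
          ((Finset.card_filter_le _ _).trans hSK))).trans hK
      have := p.count_of_concentration hm₁ hm₀pos (by omega) h.covers
        (fun j hj => hlev hj (t := t) (by omega) (by omega)) hF' hfail (hconc t ht hQt)
        hcK (hQ.trans hQt)
      have hQ0 : (0 : ℝ) ≤ Q := Nat.cast_nonneg _
      linarith
    · have h1 : ((S.filter fun e => (t : WithBot ℤ) ≤ (d e).2).card : ℝ) ≤ Q := by
        exact_mod_cast (not_le.1 hQt).le
      have h2 : (1 - 6 / (p.N : ℝ)) * (S.filter fun e => (t : WithBot ℤ) ≤ (d e).2).card ≤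
          (S.filter fun e => (t : WithBot ℤ) ≤ (d e).2).card := by
        refine mul_le_of_le_one_left (Nat.cast_nonneg _) ?_
        have : 0 ≤ 6 / (p.N : ℝ) := by positivity
        linarith
      have h3 : (0 : ℝ) ≤ (A.filter fun e => (t : WithBot ℤ) ≤ (d e).2).card := Nat.cast_nonneg _
      linarith
  have hφA : ∑ e ∈ (insert g S).filter (fun e => F < c e), φ e ≤ ∑ e ∈ A, φ e := by
    rw [← Finset.sum_filter_of_ne (p := fun e => 0 < φ e)
      fun e _ hne => lt_of_le_of_ne (hφ0 e) (Ne.symm hne)]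
    refine Finset.sum_le_sum_of_subset_of_nonneg (fun e he => ?_) fun e _ _ => hφ0 e
    obtain ⟨he1, he2⟩ := Finset.mem_filter.1 he
    exact hbig e (Finset.mem_filter.1 he1).2 he2
  have hgS : g ∉ S := fun hgS => (Finset.mem_erase.1 (hSG hgS)).1 rfl
  have hφS : ∑ e ∈ S, φ e ≤ ∑ e ∈ (insert g S).filter (fun e => F < c e), φ e +
      ∑ e ∈ S, (v e : ℝ) * (if c e ∈ J' then 1 else 0) +
      ∑ e ∈ S, (v e : ℝ) * (if c e ∈ firstSlots c (T.erase e) J' then 1 else 0) := by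
    -- The elements whose excess is neither collected nor charged to an error term. Such an element
    -- is alone among `T` in slot `F`, so there is at most one.
    set U := S.filter fun e => 0 < φ e ∧ ¬ F < c e ∧ c e ∉ J' ∧
      c e ∉ firstSlots c (T.erase e) J' with hU
    have hUmem : ∀ e ∈ U, e ∈ S ∧ c e = F ∧ ∀ e' ∈ T, c e' = F → e' = e := by
      intro e he
      obtain ⟨heS, h1, h2, h3, h4⟩ := Finset.mem_filter.1 he
      have heG := Finset.mem_of_mem_erase (hSG heS)
      have heT := hmemT e heG κ (by omega) (hφκ e h1)
      have hcF : c e = F := le_antisymm (not_lt.1 h2) (hFmin e heT h3)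
      refine ⟨heS, hcF, fun e' he' hc' => ?_⟩
      by_contra hne
      exact h4 (mem_firstSlots.2 ⟨⟨e', Finset.mem_erase.2 ⟨hne, he'⟩, by rw [hc', hcF]⟩, h3,
        fun x hx hxJ => by rw [hcF]; exact hFmin x (Finset.mem_of_mem_erase hx) hxJ⟩)
    -- If an element of `S` is alone in `F`, then `g` comes later, and its collected excess makes up
    -- for the loss.
    have hUsum : ∑ e ∈ U, φ e ≤ if F < c g then φ g else 0 := by
      rcases U.eq_empty_or_nonempty with h0 | ⟨e, he⟩
      · rw [h0, Finset.sum_empty]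
        split_ifs
        · exact hφ0 g
        · exact le_rfl
      · obtain ⟨heS, hcF, huniq⟩ := hUmem e he
        have hU1 : U = {e} := by
          refine Finset.eq_singleton_iff_unique_mem.2 ⟨he, fun e' he' => ?_⟩
          obtain ⟨heS', hcF', -⟩ := hUmem e' he'
          obtain ⟨-, h1, -⟩ := Finset.mem_filter.1 he'
          exact huniq e' (hmemT e' (Finset.mem_of_mem_erase (hSG heS')) κ (by omega)
            (hφκ e' h1)) hcF'
        have hge : g ≠ e := fun hge => hgS (hge ▸ heS)
        have hFg : F < c g :=
          lt_of_le_of_ne (hFmin g hgT hgJ) fun heq => hge (huniq g hgT heq.symm)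
        rw [hU1, Finset.sum_singleton, if_pos hFg]
        refine max_le_max (sub_le_sub_right (NNReal.coe_le_coe.2 (h.le_g e
          (Finset.mem_of_mem_erase (hSG heS)))) _) le_rfl
    have hsplit : ∑ e ∈ (insert g S).filter (fun e => F < c e), φ e =
        (if F < c g then φ g else 0) + ∑ e ∈ S, if F < c e then φ e else 0 := by
      rw [Finset.sum_filter, Finset.sum_insert hgS]
    have hterm : ∑ e ∈ S, φ e ≤ ∑ e ∈ S, ((if F < c e then φ e else 0) +
        (v e : ℝ) * (if c e ∈ J' then 1 else 0) +
        (v e : ℝ) * (if c e ∈ firstSlots c (T.erase e) J' then 1 else 0) +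
        if e ∈ U then φ e else 0) := by
      refine Finset.sum_le_sum fun e he => ?_
      have h1 := hφ0 e
      have h2 := hφv e
      have h3 : (0 : ℝ) ≤ v e := NNReal.coe_nonneg _
      by_cases hφe : 0 < φ e
      · by_cases ha : F < c e
        · simp only [ha, if_true]
          split_ifs <;> linarith
        · by_cases hb : c e ∈ J'
          · simp only [hb, if_true]
            split_ifs <;> linarith
          · by_cases hc : c e ∈ firstSlots c (T.erase e) J'
            · simp only [hc, if_true]
              split_ifs <;> linarith
            · have : e ∈ U := Finset.mem_filter.2 ⟨he, hφe, ha, hb, hc⟩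
              simp only [this, if_true]
              split_ifs; linarith
      · have h4 : φ e = 0 := le_antisymm (not_lt.1 hφe) h1
        rw [h4]
        split_ifs <;> linarith
    simp only [Finset.sum_add_distrib] at hterm
    rw [Finset.sum_ite_mem] at hterm
    have hSU : S ∩ U = U := Finset.inter_eq_right.2 (Finset.filter_subset _ _)
    rw [hSU] at hterm
    linarith
  have hA1 : ∑ e ∈ A, (v e : ℝ) = ∑ e ∈ A, min (v e : ℝ) w + ∑ e ∈ A, φ e := by
    rw [← Finset.sum_add_distrib]
    exact Finset.sum_congr rfl fun e _ => hφ e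
  have hS1 : ∑ e ∈ S, (v e : ℝ) = ∑ e ∈ S, min (v e : ℝ) w + ∑ e ∈ S, φ e := by
    rw [← Finset.sum_add_distrib]
    exact Finset.sum_congr rfl fun e _ => hφ e
  linarith

end Outcome

end SlotParams

/-! ### The benchmark, and instances with assigned slots. -/

namespace ByzInstance

variable {n : ℕ} (P : ByzInstance n)

lemma exists_sum_eq_benchmark (K : ℕ) (g : Fin n) :
    ∃ S ⊆ P.green.erase g, S.card ≤ K ∧ ∑ e ∈ S, (P.value e : ℝ) = P.benchmark K g := by
  obtain ⟨S, hS, h⟩ := Finset.exists_mem_eq_sup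
    ((P.green.erase g).powerset.filter fun S => S.card ≤ K) ⟨∅, by simp⟩
    fun S => ∑ e ∈ S, P.value e
  obtain ⟨h1, h2⟩ := Finset.mem_filter.1 hS
  refine ⟨S, Finset.mem_powerset.1 h1, h2, ?_⟩
  unfold benchmark
  rw [h]
  push_cast
  rfl

lemma value_le_benchmark {K : ℕ} (hK : 1 ≤ K) {e g : Fin n} (he : e ∈ P.green) (heg : e ≠ g) :
    P.value e ≤ P.benchmark K g := by
  unfold benchmark
  refine le_trans ?_ (Finset.le_sup (f := fun S => ∑ e ∈ S, P.value e) (b := {e}) ?_)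
  · simp
  · simp [he, heg, hK]

/-- The discretized instance when the green elements arrive in the slots `ω`. -/
noncomputable def assignedData (N : ℕ) {m : ℕ} (ω : Fin n → Fin m) (e : Fin n) :
    ℕ × WithBot ℤ :=
  (if e ∈ P.green then (ω e : ℕ) else fineSlot m (P.redTime e), level N (P.value e))

lemma slotData_eq_assignedData (N : ℕ) {m : ℕ} (hm : 0 < m) (u : Fin n → unitInterval) :
    P.slotData N m u = P.assignedData N (slotsOf hm u) := by
  funext e
  unfold slotData discretize assignedData time
  congr 1
  split_ifs <;> rfl

lemma assignedData_of_green {N m : ℕ} {ω : Fin n → Fin m} {e : Fin n} (he : e ∈ P.green) :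
    (P.assignedData N ω e).1 = ω e := if_pos he

/-- The coarse slots of the red elements of value at least `V`. -/
noncomputable def redSlots (m m₁ : ℕ) (V : ℝ) : Finset ℕ :=
  (Finset.univ.filter fun e => e ∉ P.green ∧ V ≤ P.value e).image fun e =>
    fineSlot m (P.redTime e) / m₁

end ByzInstance

/-! ### Choice of parameters. -/

section powers

variable {N : ℕ}

lemma two_le_levelBase_pow (hN : 0 < N) : 2 ≤ levelBase N ^ N := by
  have hN' : (0 : ℝ) < N := Nat.cast_pos.2 hN
  have := one_add_mul_le_pow (a := 1 / (N : ℝ)) (by have : 0 ≤ 1 / (N : ℝ) := by positivity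
                                                    linarith) N
  rw [mul_one_div_cancel hN'.ne'] at this
  unfold levelBase
  linarith

lemma levelBase_le_two (hN : 0 < N) : levelBase N ≤ 2 := by
  have : (1 : ℝ) ≤ N := by exact_mod_cast hN
  have : 1 / (N : ℝ) ≤ 1 := by rw [div_le_one (by linarith)]; exact this
  unfold levelBase
  linarith

/-- Moving by `B = N ^ 3` levels changes a value by at least `2 ^ (N ^ 2)`, which exceeds all
polynomial factors and `n`. -/
lemma mul_pow_le_levelBase_zpow {n : ℕ} (hN : 100 ≤ N) (hn : n < 2 ^ N) :
    (n * N ^ 42 : ℝ) ≤ levelBase N ^ ((N ^ 3 : ℕ) : ℤ) := by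
  have h1 : n * N ^ 42 ≤ 2 ^ (N ^ 2) := by
    calc n * N ^ 42 ≤ 2 ^ N * (2 ^ N) ^ 42 :=
          Nat.mul_le_mul hn.le (Nat.pow_le_pow_left Nat.lt_two_pow_self.le _)
      _ = 2 ^ (N * 43) := by rw [← pow_succ', ← pow_mul]
      _ ≤ 2 ^ (N ^ 2) := Nat.pow_le_pow_right (by norm_num) (by nlinarith)
  calc (n * N ^ 42 : ℝ) ≤ 2 ^ (N ^ 2) := by exact_mod_cast h1
    _ ≤ (levelBase N ^ N) ^ (N ^ 2) := by
        gcongr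
        exact two_le_levelBase_pow (by omega)
    _ = levelBase N ^ ((N ^ 3 : ℕ) : ℤ) := by
        rw [zpow_natCast, ← pow_mul]
        congr 1
        ring

/-- By Bernoulli, `N` failures halve the running minimum, so `N ^ 2` of them exhaust a minimum below
`2 ^ N`. -/
lemma mul_pred_pow_lt {c : ℕ} (hN : 2 ≤ N) (hc : c < 2 ^ N) :
    c * (N - 1) ^ (N ^ 2) < N ^ (N ^ 2) := by
  obtain ⟨M, rfl⟩ : ∃ M, N = M + 1 := ⟨N - 1, by omega⟩
  have h1 : ∀ k, M ^ (k + 1) + (k + 1) * M ^ k ≤ (M + 1) ^ (k + 1) := by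
    intro k
    induction k with
    | zero => simp
    | succ k ih =>
      calc M ^ (k + 1 + 1) + (k + 1 + 1) * M ^ (k + 1)
          ≤ (M ^ (k + 1) + (k + 1) * M ^ k) * (M + 1) := by
            rw [pow_succ M (k + 1), pow_succ M k]
            nlinarith [Nat.zero_le ((k + 1) * M ^ k)]
        _ ≤ (M + 1) ^ (k + 1) * (M + 1) := Nat.mul_le_mul_right _ ih
        _ = _ := (pow_succ _ _).symm
  have h2 : 2 * M ^ (M + 1) ≤ (M + 1) ^ (M + 1) := by
    refine le_trans ?_ (h1 M)
    rw [pow_succ]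
    nlinarith [Nat.zero_le (M ^ M)]
  have hM : 0 < M := by omega
  rw [Nat.add_sub_cancel, sq, pow_mul, pow_mul]
  calc c * (M ^ (M + 1)) ^ (M + 1) < 2 ^ (M + 1) * (M ^ (M + 1)) ^ (M + 1) :=
        Nat.mul_lt_mul_of_pos_right hc (by positivity)
    _ = (2 * M ^ (M + 1)) ^ (M + 1) := (mul_pow _ _ _).symm
    _ ≤ _ := Nat.pow_le_pow_left h2 _

end powers

/-- The parameters used for uniform matroids of rank `K`, in terms of the precision `N`. There are
`N ^ 3` coarse slots. -/
def SlotParams.ofScale (N K : ℕ) : SlotParams where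
  N := N
  m₁ := N ^ 14
  B := N ^ 3
  P := N ^ 43
  c := K * (N - 1) / (N * (N ^ 3 * N ^ 14))

namespace SlotParams

variable {N K : ℕ}

lemma eight_mul_le (hN : 100 ≤ N) : 8 * N ^ 3 + 1 ≤ N ^ 4 := by
  have : 1 ≤ N ^ 3 := Nat.one_le_pow _ _ (by omega)
  calc 8 * N ^ 3 + 1 ≤ N * N ^ 3 := by nlinarith
    _ = N ^ 4 := by ring

/-- Exploration costs at most `N ^ 57`, a fraction `1 / N` of `K`; the quotas use at most the
remaining `K (1 - 1/N)`. -/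
lemma card_selected_ofScale_le (hN : 100 ≤ N) (hK : N ^ 58 ≤ K) {n : ℕ} (P : ByzInstance n)
    (s : Unit) (u : Fin n → unitInterval) :
    (((ofScale N K).alg (N ^ 3 * N ^ 14)).selected P s u).card ≤ K := by
  have hN0 : 0 < N := by omega
  refine ((ofScale N K).card_selected_le (N ^ 3 * N ^ 14) P u (m₀ := N ^ 3) rfl
    (by positivity) s).trans ?_
  have h1 : N ^ 3 * (N ^ 3 * N ^ 3 * N * (8 * N ^ 3 + 1)) * N ^ 43 ≤ N ^ 57 := by
    calc N ^ 3 * (N ^ 3 * N ^ 3 * N * (8 * N ^ 3 + 1)) * N ^ 43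
        ≤ N ^ 3 * (N ^ 3 * N ^ 3 * N * N ^ 4) * N ^ 43 := by
          gcongr
          exact eight_mul_le hN
      _ = N ^ 57 := by ring
  have h2 : (N * (N ^ 3 * N ^ 14)) * (K * (N - 1) / (N * (N ^ 3 * N ^ 14))) ≤ K * (N - 1) :=
    Nat.mul_div_le _ _
  have h3 : K * (N - 1) + K = K * N := by
    obtain ⟨M, rfl⟩ : ∃ M, N = M + 1 := ⟨N - 1, by omega⟩
    simp only [Nat.add_sub_cancel]
    ring
  refine Nat.le_of_mul_le_mul_left ?_ hN0
  change N * (N ^ 3 * (N ^ 3 * N ^ 3 * N * (8 * N ^ 3 + 1)) * N ^ 43 +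
    N ^ 3 * N ^ 14 * (K * (N - 1) / (N * (N ^ 3 * N ^ 14)))) ≤ N * K
  calc _ = N * (N ^ 3 * (N ^ 3 * N ^ 3 * N * (8 * N ^ 3 + 1)) * N ^ 43) +
        (N * (N ^ 3 * N ^ 14)) * (K * (N - 1) / (N * (N ^ 3 * N ^ 14))) := by ring
    _ ≤ N * N ^ 57 + K * (N - 1) := Nat.add_le_add (Nat.mul_le_mul_left _ h1) h2
    _ = N ^ 58 + K * (N - 1) := by ring
    _ ≤ K + K * (N - 1) := Nat.add_le_add_right hK _
    _ = N * K := by rw [add_comm, h3, mul_comm]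

variable {n : ℕ} {P : ByzInstance n} {g : Fin n} {V : ℝ} {β : ℤ} {J' : Finset ℕ}

/-- The slotted algorithm leads to an `Outcome` for all draws. -/
def Outcomes (N K : ℕ) {n : ℕ} (P : ByzInstance n) (g : Fin n) (V : ℝ) (β : ℤ) (J' : Finset ℕ) :
    Prop :=
  ∀ u, (ofScale N K).Outcome (P.slotData N (N ^ 3 * N ^ 14) u) P.value
    (((ofScale N K).alg (N ^ 3 * N ^ 14)).selected P () u) P.green g V β
    (P.redSlots (N ^ 3 * N ^ 14) (N ^ 14) V) J'

lemma exists_outcomes (hN : 100 ≤ N) (hn : n < 2 ^ N) (hK : 1 ≤ K) (hg : P.IsGreenMax g)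
    (hV : 0 < (P.benchmark K g : ℝ)) :
    ∃ β J', Outcomes N K P g (P.benchmark K g) β J' := by
  have hN0 : 0 < N := by omega
  obtain ⟨β, hβ1, hβ2⟩ := exists_mem_Ico_zpow hV (one_lt_levelBase hN0)
  obtain ⟨J', h1, h2, h3⟩ := exists_last_elements
    (P.redSlots (N ^ 3 * N ^ 14) (N ^ 14) (P.benchmark K g)) (N + 1)
  refine ⟨β, J', fun u => ⟨hN, Nat.one_le_pow _ _ hN0, hn, fun e => rfl,
    (ofScale N K).covers_selected _ P u (), hβ1, hβ2, ?_, hg.1, hg.2,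
    fun e he heg => NNReal.coe_le_coe.2 (P.value_le_benchmark hK he heg), fun e he hle => ?_,
    fun j hj => ?_, h1, h2, h3⟩⟩
  · have hpos := levelBase_zpow_pos hN0 β
    rw [zpow_add_one₀ (by have := one_lt_levelBase hN0; linarith)] at hβ2
    have h4 : (2 : ℝ) ≤ (N ^ 43 : ℕ) := by
      have : N ^ 1 ≤ N ^ 43 := Nat.pow_le_pow_right hN0 (by norm_num)
      rw [pow_one] at this
      exact_mod_cast (by omega : 2 ≤ N ^ 43)
    have h5 := levelBase_le_two hN0
    change _ ≤ ((N ^ 43 : ℕ) : ℝ) * levelBase N ^ β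
    nlinarith
  · refine Finset.mem_image.2 ⟨e, Finset.mem_filter.2 ⟨Finset.mem_univ _, he, hle⟩, ?_⟩
    simp [ByzInstance.slotData, discretize, ByzInstance.time, he, ofScale]
  · obtain ⟨e, he, rfl⟩ := Finset.mem_image.1 hj
    obtain ⟨-, he1, he2⟩ := Finset.mem_filter.1 he
    refine ⟨e, ?_, he2⟩
    simp [ByzInstance.slotData, discretize, ByzInstance.time, he1, ofScale]

/-! ### Expected value of the algorithm. -/

section expect

variable {m m₀ m₁ : ℕ}

lemma assignedData_update_of_ne (P : ByzInstance n) (N : ℕ) (ω : Fin n → Fin m) {e e' : Fin n}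
    (he : e' ≠ e) (s : Fin m) :
    P.assignedData N (Function.update ω e s) e' = P.assignedData N ω e' := by
  simp [ByzInstance.assignedData, Function.update_of_ne he]

lemma expect_assigned_mem_le (hm : m = m₀ * m₁) (hpos : 0 < m) {e : Fin n} (he : e ∈ P.green)
    (A : (Fin n → Fin m) → Finset ℕ) (hA : ∀ ω s, A (Function.update ω e s) = A ω) {k : ℕ}
    (hk : ∀ ω, (A ω).card ≤ k) :
    𝔼 ω : Fin n → Fin m, (if (P.assignedData N ω e).1 / m₁ ∈ A ω then 1 else 0 : ℝ) ≤ k / m₀ := by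
  simp only [P.assignedData_of_green he]
  exact expect_coarse_mem_le hm hpos e A hA hk

lemma expect_sum_assigned_mem_le (hm : m = m₀ * m₁) (hpos : 0 < m) {S : Finset (Fin n)}
    (hS : S ⊆ P.green) (A : Fin n → (Fin n → Fin m) → Finset ℕ)
    (hA : ∀ e ω s, A e (Function.update ω e s) = A e ω) {k : ℕ} (hk : ∀ e ω, (A e ω).card ≤ k) :
    𝔼 ω : Fin n → Fin m, ∑ e ∈ S, (P.value e : ℝ) *
      (if (P.assignedData N ω e).1 / m₁ ∈ A e ω then 1 else 0) ≤
      (∑ e ∈ S, (P.value e : ℝ)) * (k / m₀) := by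
  rw [Finset.expect_sum_comm, Finset.sum_mul]
  refine Finset.sum_le_sum fun e he => ?_
  rw [← Finset.mul_expect]
  exact mul_le_mul_of_nonneg_left (expect_assigned_mem_le hm hpos (hS he) (A e) (hA e) (hk e))
    (NNReal.coe_nonneg _)

/-- A union bound over levels and fine slots. Chebyshev is effective because only levels with at
least `Q` elements count. -/
lemma expect_sparse_levels_le (hpos : 0 < m) (hN : 0 < N) (S : Finset (Fin n)) (a b : ℤ) {Q : ℕ}
    (hQ : 0 < Q) :
    𝔼 ω : Fin n → Fin m, ∑ t ∈ Finset.Ioc a b, ∑ s : Fin m,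
      (if Q ≤ (S.filter fun e => (t : WithBot ℤ) ≤ level N (P.value e)).card then
        (if (((S.filter fun e => (t : WithBot ℤ) ≤ level N (P.value e)).filter
            fun e => ω e = s).card : ℝ) < (1 - 1 / (N : ℝ)) *
          ((S.filter fun e => (t : WithBot ℤ) ≤ level N (P.value e)).card / m) then 1 else 0)
        else 0 : ℝ) ≤ (b - a).toNat * (m * (N ^ 2 * m / Q)) := by
  have hQ' : (0 : ℝ) < Q := Nat.cast_pos.2 hQ
  rw [Finset.expect_sum_comm]
  refine (Finset.sum_le_card_nsmul _ _ (m * (N ^ 2 * m / Q) : ℝ) fun t _ => ?_).trans (by simp)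
  rw [Finset.expect_sum_comm]
  refine (Finset.sum_le_card_nsmul _ _ (N ^ 2 * m / Q : ℝ) fun s _ => ?_).trans (by simp)
  split_ifs with h
  · refine (expect_sparse_le hpos hN _ (by omega) s).trans ?_
    gcongr
  · simp
    positivity

end expect

lemma one_le_mul_expect_last {m₀ m₁ m : ℕ} (hm : m = m₀ * m₁) (hpos : 0 < m) :
    1 ≤ m₀ * 𝔼 s : Fin m, (if (s : ℕ) / m₁ = m₀ - 1 then 1 else 0 : ℝ) := by
  have hm0 : 0 < m₀ := Nat.pos_of_ne_zero (by rintro rfl; simp at hm; omega)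
  have hm1 : 0 < m₁ := Nat.pos_of_ne_zero (by rintro rfl; simp at hm; omega)
  have hlt : ∀ i < m₁, (m₀ - 1) * m₁ + i < m := by
    intro i hi
    obtain ⟨k, rfl⟩ : ∃ k, m₀ = k + 1 := ⟨m₀ - 1, by omega⟩
    rw [hm, Nat.add_sub_cancel, Nat.succ_mul]
    omega
  have hcard : m₁ ≤ (Finset.univ.filter fun s : Fin m => (s : ℕ) / m₁ = m₀ - 1).card := by
    calc m₁ = (Finset.univ : Finset (Fin m₁)).card := by simp
      _ ≤ _ := by
        refine Finset.card_le_card_of_injOn (fun i => ⟨(m₀ - 1) * m₁ + i, hlt i i.isLt⟩)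
          (fun i _ => ?_) fun i _ j _ hij => ?_
        · refine Finset.mem_coe.2 (Finset.mem_filter.2 ⟨Finset.mem_univ _, ?_⟩)
          simp only
          rw [mul_comm, Nat.mul_add_div hm1, Nat.div_eq_of_lt i.isLt, add_zero]
        · simpa [Fin.ext_iff] using hij
  rw [Finset.expect_eq_sum_div_card, Finset.sum_boole, Finset.card_univ, Fintype.card_fin,
    ← mul_div_assoc, le_div_iff₀ (by exact_mod_cast hpos), one_mul]
  rw [hm]
  push_cast
  refine mul_le_mul_of_nonneg_left ?_ (Nat.cast_nonneg _)
  rw [← hm]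
  exact_mod_cast hcard

/-- The expected value of the algorithm if the largest green element is of moderate size. -/
lemma le_integral_of_moderate {p : SlotParams} {m₀ m : ℕ} {J : Finset ℕ} (hm : m = m₀ * p.m₁)
    (hmpos : 0 < m)
    (h : ∀ u, p.Outcome (P.slotData p.N m u) P.value ((p.alg m).selected P () u) P.green g V β J J')
    {S : Finset (Fin n)} (hSG : S ⊆ P.green.erase g) (hSV : ∑ e ∈ S, (P.value e : ℝ) = V)
    (hSK : S.card ≤ K) {Q : ℕ} {a κ : ℤ} (hm₁ : 0 < p.m₁) (hm₀ : p.N * (p.N + 2) ≤ m₀)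
    (hκβ : κ ≤ β) (haκ : a < κ) (haβ : a = β - p.B - 1)
    (hVκ : V ≤ p.P * levelBase p.N ^ κ)
    (hna : n * levelBase p.N ^ (a + 1) ≤ V / p.N)
    (hQκ : Q * levelBase p.N ^ κ ≤ V / p.N) (hQm : m₀ * p.m₁ * p.N ≤ Q)
    (hfail : ∀ C D : ℕ → ℤ → ℕ, p.N * ((Finset.range (m₀ * p.m₁)).filter fun s =>
      ∃ b ∈ p.levels D (s / p.m₁), C s b < p.quota C s b).card ≤ m₀ * p.m₁)
    (hcK : K * (p.N - 1) / (p.N * (m₀ * p.m₁)) ≤ p.c)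
    (hg : level p.N (P.value g) ≤ ((β + p.B : ℤ) : WithBot ℤ)) :
    V - 9 * (V / p.N) - V * ((p.N + 1 : ℕ) / m₀) - V * ((1 : ℕ) / m₀) -
      V * ((p.N + 1 : ℕ) / m₀) - V * ((κ - a).toNat * (m * (p.N ^ 2 * m / Q))) ≤
      ∫ u, ((∑ e ∈ (p.alg m).selected P () u, P.value e : ℝ≥0) : ℝ) := by
  set N := p.N with hNdef
  -- Facts that do not depend on the draws are read off at an arbitrary draw.
  have hN : 100 ≤ N := (h fun _ => 0).N_ge
  have hN0 : 0 < N := by omega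
  have hN' : (0 : ℝ) < N := Nat.cast_pos.2 hN0
  have hV : 0 < V := (h fun _ => 0).V_pos
  have hgG := (h fun _ => 0).g_mem
  have hJcard := (h fun _ => 0).J'_card
  have hm₀pos : 0 < m₀ := lt_of_lt_of_le (Nat.mul_pos hN0 (by omega)) hm₀
  have hQpos : 0 < Q := lt_of_lt_of_le (Nat.mul_pos (Nat.mul_pos hm₀pos hm₁) hN0) hQm
  set X : (Fin n → Fin m) → ℝ := fun ω => ∑ e ∈ S, (P.value e : ℝ) *
    (if (P.assignedData N ω e).1 / p.m₁ ∈ J' then 1 else 0) with hX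
  set T := P.green.filter fun e => ((β - p.B : ℤ) : WithBot ℤ) ≤ level N (P.value e)
  set Y : (Fin n → Fin m) → ℝ := fun ω => ∑ e ∈ S, (P.value e : ℝ) *
    (if (P.assignedData N ω e).1 / p.m₁ ∈ firstSlots
      (fun e => (P.assignedData N ω e).1 / p.m₁) (T.erase e) J' then 1 else 0) with hY
  set Z : (Fin n → Fin m) → ℝ := fun ω =>
    if (P.assignedData N ω g).1 / p.m₁ ∈ J' then 1 else 0 with hZ
  set W : (Fin n → Fin m) → ℝ := fun ω => ∑ t ∈ Finset.Ioc a κ, ∑ s : Fin m,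
      (if Q ≤ (S.filter fun e => (t : WithBot ℤ) ≤ level N (P.value e)).card then
        (if (((S.filter fun e => (t : WithBot ℤ) ≤ level N (P.value e)).filter
            fun e => ω e = s).card : ℝ) < (1 - 1 / (N : ℝ)) *
          ((S.filter fun e => (t : WithBot ℤ) ≤ level N (P.value e)).card / m) then 1 else 0)
        else 0) with hW
  have hX0 : ∀ ω, 0 ≤ X ω := fun ω =>
    Finset.sum_nonneg fun e _ => mul_nonneg (NNReal.coe_nonneg _) (by split_ifs <;> norm_num)
  have hY0 : ∀ ω, 0 ≤ Y ω := fun ω =>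
    Finset.sum_nonneg fun e _ => mul_nonneg (NNReal.coe_nonneg _) (by split_ifs <;> norm_num)
  have hZ0 : ∀ ω, 0 ≤ Z ω := fun ω => by simp only [hZ]; split_ifs <;> norm_num
  have hW0 : ∀ ω, 0 ≤ W ω := fun ω =>
    Finset.sum_nonneg fun t _ => Finset.sum_nonneg fun s _ => by split_ifs <;> norm_num
  have hVN : 0 ≤ V / N := by positivity
  have hf : ∀ u, V - 9 * (V / N) - X (slotsOf hmpos u) - Y (slotsOf hmpos u) -
      V * Z (slotsOf hmpos u) - V * W (slotsOf hmpos u) ≤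
      ((∑ e ∈ (p.alg m).selected P () u, P.value e : ℝ≥0) : ℝ) := by
    intro u
    have ho := h u
    rw [P.slotData_eq_assignedData N hmpos u] at ho
    set ω := slotsOf hmpos u
    have hXω := hX0 ω
    have hYω := hY0 ω
    have hZω := hZ0 ω
    have hWω := hW0 ω
    have hVZ := mul_nonneg hV.le hZω
    have hVW := mul_nonneg hV.le hWω
    have hsum : (0 : ℝ) ≤ ((∑ e ∈ (p.alg m).selected P () u, P.value e : ℝ≥0) : ℝ) :=
      NNReal.coe_nonneg _
    by_cases hgJ : (P.assignedData N ω g).1 / p.m₁ ∈ J'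
    · have : Z ω = 1 := if_pos hgJ
      rw [this] at hVZ ⊢
      linarith
    -- Some level may be sparse in some slot; the subtracted `V * W ω` then makes the bound trivial.
    by_cases hWω1 : 1 ≤ W ω
    · nlinarith
    have hconc : ∀ t ∈ Finset.Ioc a κ,
        Q ≤ (S.filter fun e => (t : WithBot ℤ) ≤ level N (P.value e)).card →
        ∀ s < m, (S.filter fun e => (t : WithBot ℤ) ≤ level N (P.value e)).card * (N - 1) ≤
          N * m * (S.filter fun e => (P.assignedData N ω e).1 = s ∧
            (t : WithBot ℤ) ≤ level N (P.value e)).card := by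
      intro t ht hQt s hs
      have hcard : (S.filter fun e => (P.assignedData N ω e).1 = s ∧
          (t : WithBot ℤ) ≤ level N (P.value e)) =
          (S.filter fun e => (t : WithBot ℤ) ≤ level N (P.value e)).filter
            fun e => ω e = ⟨s, hs⟩ := by
        rw [Finset.filter_filter]
        refine Finset.filter_congr fun e he => ?_
        rw [P.assignedData_of_green (Finset.mem_of_mem_erase (hSG he)), Fin.ext_iff, and_comm]
      rw [hcard]
      by_contra hcon
      rw [not_le] at hcon
      refine hWω1 ?_
      simp only [hW]
      refine le_trans ?_ (Finset.single_le_sum (fun t _ => Finset.sum_nonneg fun s _ => by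
        split_ifs <;> norm_num) ht)
      refine le_trans ?_ (Finset.single_le_sum (fun s _ => by
        split_ifs <;> norm_num) (Finset.mem_univ (⟨s, hs⟩ : Fin m)))
      rw [if_pos hQt, if_pos]
      have hm' : (0 : ℝ) < m := Nat.cast_pos.2 hmpos
      have hsubN : ((N - 1 : ℕ) : ℝ) = N - 1 := by
        rw [Nat.cast_sub (by omega)]
        simp
      have hcon' := (Nat.cast_lt (α := ℝ)).2 hcon
      push_cast at hcon'
      rw [hsubN] at hcon'
      have heq : ∀ x : ℝ, (1 - 1 / (N : ℝ)) * (x / m) = x * (N - 1) / (N * m) := by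
        intro x
        field_simp
      rw [heq, lt_div_iff₀ (by positivity)]
      linarith
    have := ho.of_moderate hSG hSV hSK (m₀ := m₀) (Q := Q) (a := a) (κ := κ)
      hm₁ hm₀ hκβ haκ haβ hVκ hna hQκ hQm (hfail _ _) hcK
      hg hgJ (by rw [← hm]; exact hconc)
    change V - 9 * (V / N) - X ω - Y ω ≤ _ at this
    push_cast
    linarith
  have hint := OnlineAlg.expect_le_integral hmpos (p.alg m) P ()
    (fun ω => V - 9 * (V / N) - X ω - Y ω - V * Z ω - V * W ω) hf
  refine le_trans ?_ hint
  have : NeZero m := ⟨hmpos.ne'⟩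
  simp only [Finset.expect_sub_distrib, ← Finset.mul_expect, Fintype.expect_const]
  have hSG' : S ⊆ P.green := hSG.trans (Finset.erase_subset _ _)
  have hEX : 𝔼 ω, X ω ≤ V * ((N + 1 : ℕ) / m₀) := by
    rw [← hSV]
    exact expect_sum_assigned_mem_le hm hmpos hSG' (fun _ _ => J') (fun _ _ _ => rfl)
      fun _ _ => hJcard
  have hEY : 𝔼 ω, Y ω ≤ V * ((1 : ℕ) / m₀) := by
    rw [← hSV]
    -- Erasing `e` makes the first slot independent of the slot of `e`, which therefore hits it with
    -- probability at most `1 / m₀`.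
    refine expect_sum_assigned_mem_le hm hmpos hSG' (fun e ω => firstSlots
      (fun e => (P.assignedData N ω e).1 / p.m₁) (T.erase e) J') (fun e ω s => ?_)
      fun _ _ => card_firstSlots_le
    refine firstSlots_congr fun e' he' => ?_
    rw [assignedData_update_of_ne P N ω (Finset.ne_of_mem_erase he')]
  have hEZ : 𝔼 ω, Z ω ≤ (N + 1 : ℕ) / m₀ :=
    expect_assigned_mem_le hm hmpos hgG (fun _ => J') (fun _ _ => rfl) fun _ => hJcard
  have hEW : 𝔼 ω, W ω ≤ (κ - a).toNat * (m * (N ^ 2 * m / Q)) :=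
    expect_sparse_levels_le hmpos hN0 S a κ hQpos
  have h3 := mul_le_mul_of_nonneg_left hEZ hV.le
  have h4 := mul_le_mul_of_nonneg_left hEW hV.le
  linarith

/-- The expected value of the algorithm if the largest green element is huge. -/
lemma le_integral_of_huge {p : SlotParams} {m₀ m : ℕ} {J : Finset ℕ} (hm : m = m₀ * p.m₁)
    (hmpos : 0 < m)
    (h : ∀ u, p.Outcome (P.slotData p.N m u) P.value ((p.alg m).selected P () u) P.green g V β J J')
    (hW : m₀ * V ≤ levelBase p.N ^ (β + p.B)) {e₂ : Fin n} (he₂S : e₂ ∈ P.green.erase g)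
    (he₂ : ((β - p.B : ℤ) : WithBot ℤ) ≤ level p.N (P.value e₂))
    (hg : ((β + p.B : ℤ) : WithBot ℤ) ≤ level p.N (P.value g)) :
    V - V * ((p.N + 2 : ℕ) / m₀) ≤
      ∫ u, ((∑ e ∈ (p.alg m).selected P () u, P.value e : ℝ≥0) : ℝ) := by
  set N := p.N with hNdef
  have hV : 0 < V := (h fun _ => 0).V_pos
  have hgG := (h fun _ => 0).g_mem
  have hJcard := (h fun _ => 0).J'_card
  have he₂G : e₂ ∈ P.green := Finset.mem_of_mem_erase he₂S
  have he₂g : e₂ ≠ g := Finset.ne_of_mem_erase he₂S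
  set T := (P.green.erase g).filter fun e =>
    ((β - p.B : ℤ) : WithBot ℤ) ≤ level N (P.value e)
  have he₂T : e₂ ∈ T := Finset.mem_filter.2 ⟨he₂S, he₂⟩
  set c : (Fin n → Fin m) → Fin n → ℕ := fun ω e => (P.assignedData N ω e).1 / p.m₁ with hc
  -- If `e₂` avoids `J'`, a first slot exists; if it also avoids the last coarse slot, so does that
  -- first slot, and `g` can still come after it.
  set E := insert (m₀ - 1) J'
  set f : (Fin n → Fin m) → ℝ := fun ω => if c ω e₂ ∈ E then 0 else
    if firstSlots (c ω) T J' ⊆ J then V else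
      (m₀ : ℝ) * V * (if (ω g : ℕ) / p.m₁ = m₀ - 1 then 1 else 0) with hfdef
  have hf : ∀ u, f (slotsOf hmpos u) ≤
      ((∑ e ∈ (p.alg m).selected P () u, P.value e : ℝ≥0) : ℝ) := by
    intro u
    have ho := h u
    rw [P.slotData_eq_assignedData N hmpos u] at ho
    set ω := slotsOf hmpos u
    have hsum : (0 : ℝ) ≤ ((∑ e ∈ (p.alg m).selected P () u, P.value e : ℝ≥0) : ℝ) :=
      NNReal.coe_nonneg _
    simp only [hfdef]
    split_ifs with h1 h2 h3
    · exact hsum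
    · rw [Finset.mem_insert, not_or] at h1
      obtain ⟨F, hF⟩ := exists_mem_firstSlots he₂T h1.2
      have := (ho.of_huge hW hg hF).1 (h2 hF)
      push_cast
      exact this
    · rw [Finset.mem_insert, not_or] at h1
      obtain ⟨F, hF, hFJ⟩ := Finset.not_subset.1 h2
      have hFe := (mem_firstSlots.1 hF).2.2 e₂ he₂T h1.2
      have hlt' : c ω e₂ < m₀ := by
        simp only [hc, P.assignedData_of_green he₂G]
        refine Nat.div_lt_of_lt_mul ?_
        rw [mul_comm, ← hm]
        exact (ω e₂).isLt
      have := (ho.of_huge hW hg hF).2 hFJ (by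
        rw [P.assignedData_of_green hgG, h3]
        omega)
      push_cast
      rwa [mul_one]
    · rw [mul_zero]
      exact hsum
  have hint := OnlineAlg.expect_le_integral hmpos (p.alg m) P () f hf
  refine le_trans ?_ hint
  have : NeZero m := ⟨hmpos.ne'⟩
  have hresample : 𝔼 ω : Fin n → Fin m, (V - V * if c ω e₂ ∈ E then 1 else 0) ≤ 𝔼 ω, f ω := by
    -- The first slot of `T` does not involve `g`, so resampling `g` changes only whether `g` comes
    -- in the last coarse slot.
    refine le_expect_of_resample g fun ω => ?_
    have h1 : ∀ s, c (Function.update ω g s) e₂ = c ω e₂ := fun s => by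
      simp only [hc, assignedData_update_of_ne P N ω he₂g]
    have h2 : ∀ s, firstSlots (c (Function.update ω g s)) T J' = firstSlots (c ω) T J' := by
      intro s
      refine firstSlots_congr fun e he => ?_
      have : e ≠ g := Finset.ne_of_mem_erase (Finset.mem_filter.1 he).1
      simp only [hc, assignedData_update_of_ne P N ω this]
    simp only [hfdef, h1, h2, Function.update_self]
    split_ifs with h3 h4
    · simp
    · simp
    · rw [← Finset.mul_expect]
      have := mul_le_mul_of_nonneg_left (one_le_mul_expect_last hm hmpos) hV.le
      linarith
  refine le_trans ?_ hresample
  simp only [Finset.expect_sub_distrib, ← Finset.mul_expect, Fintype.expect_const]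
  have hE : 𝔼 ω : Fin n → Fin m, (if c ω e₂ ∈ E then 1 else 0 : ℝ) ≤ (N + 2 : ℕ) / m₀ :=
    expect_assigned_mem_le hm hmpos he₂G (fun _ => E) (fun _ _ => rfl)
      fun _ => (Finset.card_insert_le _ _).trans (by omega)
  have := mul_le_mul_of_nonneg_left hE hV.le
  linarith

lemma card_failing_ofScale_le (hN : 100 ≤ N) (hK : K < 2 ^ N) (C D : ℕ → ℤ → ℕ) :
    (ofScale N K).N * ((Finset.range (N ^ 3 * (ofScale N K).m₁)).filter fun s =>
      ∃ b ∈ (ofScale N K).levels D (s / (ofScale N K).m₁), C s b < (ofScale N K).quota C s b).card ≤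
      N ^ 3 * (ofScale N K).m₁ := by
  have hN0 : 0 < N := by omega
  have hc : (ofScale N K).c ≤ K := by
    change K * (N - 1) / (N * (N ^ 3 * N ^ 14)) ≤ K
    refine Nat.div_le_of_le_mul ?_
    rw [mul_comm K]
    refine Nat.mul_le_mul_right _ ?_
    calc N - 1 ≤ N * 1 := by omega
      _ ≤ _ := Nat.mul_le_mul_left _ (Nat.mul_pos (Nat.pow_pos hN0) (Nat.pow_pos hN0))
  refine (Nat.mul_le_mul_left _ ((ofScale N K).card_failing_le (C := C) (D := D) (m₀ := N ^ 3)
    (R := N ^ 2) (mul_pred_pow_lt (by change 2 ≤ N; omega) (hc.trans_lt hK)))).trans ?_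
  -- With `8 * N ^ 3 + 1 ≤ N ^ 4` both sides become `N ^ 17`, which dictates `m₁ = N ^ 14`.
  change N * (N ^ 3 * (N ^ 3 * N ^ 3 * N * (8 * N ^ 3 + 1) * N ^ 2)) ≤ N ^ 3 * N ^ 14
  calc _ ≤ N * (N ^ 3 * (N ^ 3 * N ^ 3 * N * N ^ 4 * N ^ 2)) := by
        gcongr
        exact eight_mul_le hN
    _ = _ := by ring

/-- The expected value of the algorithm if the largest green element is of moderate size. -/
lemma integral_ge_of_moderate (h : Outcomes N K P g V β J') (hN : 100 ≤ N) (hn : n < 2 ^ N)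
    (hKn : K < n) {S : Finset (Fin n)}
    (hSG : S ⊆ P.green.erase g) (hSV : ∑ e ∈ S, (P.value e : ℝ) = V) (hSK : S.card ≤ K)
    (hg : level N (P.value g) ≤ ((β + (N ^ 3 : ℕ) : ℤ) : WithBot ℤ)) :
    V * (1 - 12 / N) ≤ ∫ u, ((∑ e ∈ ((ofScale N K).alg (N ^ 3 * N ^ 14)).selected P () u,
      P.value e : ℝ≥0) : ℝ) := by
  have hN0 : 0 < N := by omega
  have hN' : (0 : ℝ) < N := Nat.cast_pos.2 hN0
  have hN100 : (100 : ℝ) ≤ N := by exact_mod_cast hN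
  have hV : 0 < V := (h fun _ => 0).V_pos
  have hle := (h fun _ => 0).le_V
  have hlt := (h fun _ => 0).V_lt
  change levelBase N ^ β ≤ V at hle
  change V < levelBase N ^ (β + 1) at hlt
  set m := N ^ 3 * N ^ 14 with hm
  have hmpos : 0 < m := by positivity
  have hρ := one_lt_levelBase hN0
  -- At this level `P = N ^ 43` elements are worth `V`, while `Q = N ^ 41` elements contribute at
  -- most `V / N` to the truncated sum.
  obtain ⟨κ, hκ1, hκ2⟩ := exists_mem_Ico_zpow (show 0 < V / N ^ 42 by positivity) hρ
  set a := β - (N ^ 3 : ℕ) - 1 with ha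
  have hbig := mul_pow_le_levelBase_zpow hN hn
  have hn1 : (1 : ℝ) ≤ n := by exact_mod_cast (by omega : 1 ≤ n)
  have hN42 : (1 : ℝ) ≤ N ^ 42 := one_le_pow₀ (by linarith)
  have hlow : levelBase N ^ (a + 1) * levelBase N ^ ((N ^ 3 : ℕ) : ℤ) = levelBase N ^ β := by
    rw [← zpow_add₀ (by linarith)]
    congr 1
    omega
  have hlow0 := levelBase_zpow_pos hN0 (a + 1)
  have hκβ : κ ≤ β := by
    have : levelBase N ^ κ < levelBase N ^ (β + 1) :=
      (hκ1.trans (div_le_self hV.le hN42)).trans_lt hlt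
    have := (zpow_lt_zpow_iff_right₀ hρ).1 this
    omega
  have hna0 : levelBase N ^ (a + 1) * (n * N ^ 42) ≤ V :=
    (mul_le_mul_of_nonneg_left hbig hlow0.le).trans (hlow.le.trans hle)
  have haκ : a < κ := by
    have : levelBase N ^ (a + 1) < levelBase N ^ (κ + 1) := by
      refine lt_of_le_of_lt ?_ hκ2
      rw [le_div_iff₀ (by positivity)]
      refine le_trans ?_ hna0
      gcongr
      exact le_mul_of_one_le_left (by positivity) hn1
    have := (zpow_lt_zpow_iff_right₀ hρ).1 this
    omega
  have hna : n * levelBase N ^ (a + 1) ≤ V / N := by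
    rw [le_div_iff₀ hN']
    refine le_trans ?_ hna0
    have : (N : ℝ) ≤ N ^ 42 := le_self_pow₀ (by linarith) (by norm_num)
    calc n * levelBase N ^ (a + 1) * N = levelBase N ^ (a + 1) * (n * N) := by ring
      _ ≤ _ := by gcongr
  have hVκ : V ≤ ((N ^ 43 : ℕ) : ℝ) * levelBase N ^ κ := by
    rw [div_lt_iff₀ (by positivity), zpow_add_one₀ (by linarith)] at hκ2
    have h1 := levelBase_zpow_pos hN0 κ
    have h2 := levelBase_le_two hN0
    push_cast
    calc V ≤ levelBase N ^ κ * levelBase N * N ^ 42 := hκ2.le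
      _ ≤ levelBase N ^ κ * N * N ^ 42 := by gcongr; linarith
      _ = _ := by ring
  have hQκ : ((N ^ 41 : ℕ) : ℝ) * levelBase N ^ κ ≤ V / N := by
    push_cast
    calc (N : ℝ) ^ 41 * levelBase N ^ κ ≤ N ^ 41 * (V / N ^ 42) := by gcongr
      _ = V / N := by field_simp
  have hQm : N ^ 3 * N ^ 14 * N ≤ N ^ 41 := by
    calc N ^ 3 * N ^ 14 * N = N ^ 18 := by ring
      _ ≤ _ := Nat.pow_le_pow_right hN0 (by norm_num)
  have hm₀ : N * (N + 2) ≤ N ^ 3 := by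
    calc N * (N + 2) ≤ N * (N * N) := Nat.mul_le_mul_left _ (by nlinarith)
      _ = N ^ 3 := by ring
  have hmain := le_integral_of_moderate (p := ofScale N K) (m₀ := N ^ 3) (K := K) hm hmpos h hSG hSV
    hSK (Q := N ^ 41) (a := a) (κ := κ) (Nat.pow_pos hN0) hm₀ hκβ haκ rfl hVκ hna hQκ hQm
    (card_failing_ofScale_le hN (hKn.trans hn)) le_rfl hg
  refine le_trans ?_ hmain
  change _ ≤ V - 9 * (V / N) - V * ((N + 1 : ℕ) / (N ^ 3 : ℕ)) - V * ((1 : ℕ) / (N ^ 3 : ℕ)) -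
      V * ((N + 1 : ℕ) / (N ^ 3 : ℕ)) -
      V * ((κ - a).toNat * (m * (N ^ 2 * m / (N ^ 41 : ℕ))))
  have hκa : (((κ - a).toNat : ℕ) : ℝ) ≤ N ^ 3 + 1 := by
    exact_mod_cast (by omega : (κ - a).toNat ≤ N ^ 3 + 1)
  have hbound : (N ^ 3 + 1 : ℝ) * (m * (N ^ 2 * m / (N ^ 41 : ℕ))) ≤ 1 / N := by
    rw [hm]
    push_cast
    have : ((N : ℝ) ^ 3 * N ^ 14 * (N ^ 2 * (N ^ 3 * N ^ 14) / N ^ 41)) = 1 / N ^ 5 := by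
      field_simp
    rw [this, mul_one_div, div_le_div_iff₀ (by positivity) hN']
    nlinarith [pow_pos hN' 4, pow_pos hN' 3, pow_pos hN' 2]
  have hEW : ((κ - a).toNat : ℝ) * (m * (N ^ 2 * m / (N ^ 41 : ℕ))) ≤ 1 / N := by
    refine le_trans ?_ hbound
    gcongr
  have hsmall : ((N + 1 : ℕ) : ℝ) / (N ^ 3 : ℕ) ≤ (1 / 2) * (1 / N) := by
    push_cast
    rw [← mul_div_assoc, div_le_div_iff₀ (by positivity) hN']
    nlinarith [pow_pos hN' 2]
  have hsmall' : ((1 : ℕ) : ℝ) / (N ^ 3 : ℕ) ≤ 1 / N := by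
    push_cast
    refine one_div_le_one_div_of_le hN' (le_self_pow₀ (by linarith) (by norm_num))
  have h1 := mul_le_mul_of_nonneg_left hsmall hV.le
  have h2 := mul_le_mul_of_nonneg_left hsmall' hV.le
  have h4 := mul_le_mul_of_nonneg_left hEW hV.le
  have h5 : V * (1 - 12 / N) = V - 12 * (V * (1 / N)) := by ring
  have h6 : V / N = V * (1 / N) := by ring
  rw [h5, h6]
  linarith

/-- The expected value of the algorithm if the largest green element is huge. -/
lemma integral_ge_of_huge (h : Outcomes N K P g V β J') (hN : 100 ≤ N) (hn : n < 2 ^ N)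
    {S : Finset (Fin n)}
    (hSG : S ⊆ P.green.erase g) (hSV : ∑ e ∈ S, (P.value e : ℝ) = V)
    (hg : ((β + (N ^ 3 : ℕ) : ℤ) : WithBot ℤ) ≤ level N (P.value g)) :
    V * (1 - 12 / N) ≤ ∫ u, ((∑ e ∈ ((ofScale N K).alg (N ^ 3 * N ^ 14)).selected P () u,
      P.value e : ℝ≥0) : ℝ) := by
  have hN0 : 0 < N := by omega
  have hN' : (0 : ℝ) < N := Nat.cast_pos.2 hN0
  have hN100 : (100 : ℝ) ≤ N := by exact_mod_cast hN
  have hV : 0 < V := (h fun _ => 0).V_pos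
  have hle := (h fun _ => 0).le_V
  have hlt := (h fun _ => 0).V_lt
  change levelBase N ^ β ≤ V at hle
  change V < levelBase N ^ (β + 1) at hlt
  set m := N ^ 3 * N ^ 14 with hm
  have hmpos : 0 < m := by positivity
  have hρ := one_lt_levelBase hN0
  have hbig := mul_pow_le_levelBase_zpow hN hn
  have hn1 : (1 : ℝ) ≤ n := by
    have := g.isLt
    exact_mod_cast (by omega : 1 ≤ n)
  have hW : (N ^ 3 : ℕ) * V ≤ levelBase N ^ (β + (N ^ 3 : ℕ)) := by
    rw [zpow_add₀ (by linarith)]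
    rw [zpow_add_one₀ (by linarith)] at hlt
    have hβ := levelBase_zpow_pos hN0 β
    have h1 : (N ^ 3 : ℕ) * (2 : ℝ) ≤ levelBase N ^ ((N ^ 3 : ℕ) : ℤ) := by
      refine le_trans ?_ hbig
      push_cast
      calc (N : ℝ) ^ 3 * 2 ≤ (N : ℝ) ^ 3 * (N : ℝ) ^ 39 := by
            gcongr
            have : (N : ℝ) ≤ N ^ 39 := le_self_pow₀ (by linarith) (by norm_num)
            linarith
        _ = 1 * (N : ℝ) ^ 42 := by ring
        _ ≤ (n : ℝ) * (N : ℝ) ^ 42 := by gcongr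
    calc (N ^ 3 : ℕ) * V ≤ (N ^ 3 : ℕ) * (levelBase N ^ β * 2) := by
          gcongr
          exact hlt.le.trans (mul_le_mul_of_nonneg_left (levelBase_le_two hN0) hβ.le)
      _ = levelBase N ^ β * ((N ^ 3 : ℕ) * 2) := by ring
      _ ≤ _ := by gcongr
  -- At most `n` elements below this level cannot add up to `V`.
  obtain ⟨e₂, he₂S, he₂⟩ : ∃ e ∈ S, ((β - (N ^ 3 : ℕ) : ℤ) : WithBot ℤ) ≤
      level N (P.value e) := by
    by_contra hcon
    push Not at hcon
    set y := levelBase N ^ (β - (N ^ 3 : ℕ))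
    have hy : 0 < y := levelBase_zpow_pos hN0 _
    have h1 : ∀ e ∈ S, (P.value e : ℝ) ≤ y := fun e he => by
      have := hcon e he
      rw [← not_le, le_level_iff hN0] at this
      exact (not_le.1 this).le
    have h2 := Finset.sum_le_card_nsmul _ _ _ h1
    rw [hSV, nsmul_eq_mul] at h2
    have h3 : (S.card : ℝ) ≤ n := by exact_mod_cast (Finset.card_le_univ S).trans (by simp)
    have h4 : y * levelBase N ^ ((N ^ 3 : ℕ) : ℤ) = levelBase N ^ β := by
      simp only [y]
      rw [← zpow_add₀ (by linarith)]
      congr 1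
      omega
    have h5 : y * (n * 2) ≤ V := by
      refine le_trans ?_ (h4.le.trans hle)
      refine mul_le_mul_of_nonneg_left (le_trans ?_ hbig) hy.le
      gcongr
      have : (N : ℝ) ≤ N ^ 42 := le_self_pow₀ (by linarith) (by norm_num)
      linarith
    nlinarith
  have hmain := le_integral_of_huge (p := ofScale N K) (m₀ := N ^ 3) hm hmpos h hW (hSG he₂S) he₂ hg
  refine le_trans ?_ hmain
  change _ ≤ V - V * ((N + 2 : ℕ) / (N ^ 3 : ℕ))
  have hsmall : ((N + 2 : ℕ) : ℝ) / (N ^ 3 : ℕ) ≤ 12 / N := by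
    push_cast
    rw [div_le_div_iff₀ (by positivity) hN']
    nlinarith [pow_pos hN' 2]
  have := mul_le_mul_of_nonneg_left hsmall hV.le
  linarith

end SlotParams

/-! ### Conclusion. -/

/-- The algorithm that selects everything, or nothing. -/
noncomputable def OnlineAlg.const (b : Bool) : OnlineAlg where
  Seed := Unit
  law := Measure.dirac ()
  select _ _ _ := b
  measurable_select _ := measurable_const

lemma OnlineAlg.expectedValue_nonneg {n : ℕ} (A : OnlineAlg) (P : ByzInstance n) :
    0 ≤ A.expectedValue P := integral_nonneg fun _ => NNReal.coe_nonneg _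

lemma OnlineAlg.selected_const_true {n : ℕ} (P : ByzInstance n) (s : Unit)
    (u : Fin n → unitInterval) : (OnlineAlg.const true).selected P s u = Finset.univ := by
  simp [selected, const]

lemma OnlineAlg.expectedValue_const_true {n : ℕ} (P : ByzInstance n) :
    (OnlineAlg.const true).expectedValue P = ∑ e, (P.value e : ℝ) := by
  unfold expectedValue
  have : ∀ z : (OnlineAlg.const true).Seed × (Fin n → unitInterval),
      (OnlineAlg.const true).selected P z.1 z.2 = Finset.univ :=
    fun z => selected_const_true P z.1 z.2
  simp [this]

theorem theorem1 :
    ∃ p : Polynomial ℝ, ∀ (ε : ℝ) (n K : ℕ), 0 < ε → ε ≤ 1 →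
      p.eval (ε⁻¹ * Real.log (n : ℝ)) ≤ (K : ℝ) →
      ∃ A : OnlineAlg,
        (∀ (P : ByzInstance n) (s : A.Seed) (u : Fin n → unitInterval),
          (A.selected P s u).card ≤ K) ∧
        ∀ (P : ByzInstance n) (g : Fin n), P.IsGreenMax g →
          (P.benchmark K g : ℝ) ≤ (1 + ε) * A.expectedValue P := by
  -- The precision will be `N = ⌈1000 x⌉ < 1000 x + 1`, and the budget needs `N ^ 58 ≤ K`.
  refine ⟨(1000 * Polynomial.X + 1) ^ 58, fun ε n K hε hε1 hK => ?_⟩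
  -- If `n ≤ K`, everything may be selected. Otherwise `n ≥ 2`, so `N` is large, and `K < n < 2 ^ N`
  -- bounds the number of failing slots.
  rcases le_or_gt n K with hnK | hKn
  · refine ⟨OnlineAlg.const true, fun P s u => ?_, fun P g hg => ?_⟩
    · exact (Finset.card_le_univ _).trans (by simpa using hnK)
    · rw [OnlineAlg.expectedValue_const_true]
      obtain ⟨S, -, -, h⟩ := P.exists_sum_eq_benchmark K g
      rw [← h]
      have h1 : ∑ e ∈ S, (P.value e : ℝ) ≤ ∑ e, (P.value e : ℝ) :=
        Finset.sum_le_sum_of_subset_of_nonneg (Finset.subset_univ _)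
          fun e _ _ => NNReal.coe_nonneg _
      have h2 : 0 ≤ ∑ e, (P.value e : ℝ) := Finset.sum_nonneg fun e _ => NNReal.coe_nonneg _
      nlinarith
  simp only [Polynomial.eval_pow, Polynomial.eval_add, Polynomial.eval_mul, Polynomial.eval_X,
    Polynomial.eval_one, Polynomial.eval_ofNat] at hK
  set x := ε⁻¹ * Real.log n with hx
  have hn1 : 1 ≤ n := by omega
  have hlog0 : 0 ≤ Real.log n := Real.log_natCast_nonneg n
  have hx0 : 0 ≤ x := by positivity
  have hK1 : 1 ≤ K := by
    have : (1 : ℝ) ≤ (1000 * x + 1) ^ 58 := one_le_pow₀ (by linarith)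
    exact_mod_cast this.trans hK
  have hn2 : (2 : ℝ) ≤ n := by exact_mod_cast (by omega : 2 ≤ n)
  have hlog : 0.69 ≤ Real.log n := by
    have h1 := Real.log_le_log (by norm_num) hn2
    have h2 := Real.log_two_gt_d9
    linarith
  set N := ⌈1000 * x⌉₊ with hN
  have hN1 : 1000 * x ≤ N := Nat.le_ceil _
  have hN2 : (N : ℝ) < 1000 * x + 1 := Nat.ceil_lt_add_one (by positivity)
  have hεx : ε * x = Real.log n := by rw [hx]; field_simp
  have hxlog : Real.log n ≤ x := by rw [← hεx]; nlinarith
  have hN100 : 100 ≤ N := by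
    have : (100 : ℝ) ≤ N := by linarith
    exact_mod_cast this
  have hKN : N ^ 58 ≤ K := by
    have : (N : ℝ) ^ 58 ≤ K := le_trans (by gcongr) hK
    exact_mod_cast this
  have hnN : n < 2 ^ N := by
    have h1 : Real.log n < Real.log (2 ^ N) := by
      rw [Real.log_pow]
      have := Real.log_two_gt_d9
      nlinarith
    have h2 : (n : ℝ) < 2 ^ N := (Real.log_lt_log_iff (by linarith) (by positivity)).1 h1
    exact_mod_cast h2
  -- The factor 1000 in `N` makes the total loss `12 / N` at most `ε / 2`.
  have hNε : (1 : ℝ) ≤ (1 + ε) * (1 - 12 / N) := by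
    have h1 : 24 ≤ ε * N := by nlinarith
    have hN' : (0 : ℝ) < N := by linarith
    have h2 : 12 / (N : ℝ) ≤ ε / 2 := by rw [div_le_iff₀ hN']; linarith
    nlinarith
  refine ⟨(SlotParams.ofScale N K).alg (N ^ 3 * N ^ 14),
    fun P s u => SlotParams.card_selected_ofScale_le hN100 hKN P s u, fun P g hg => ?_⟩
  rcases (NNReal.coe_nonneg (P.benchmark K g)).eq_or_lt with hV | hV
  · rw [← hV]
    exact mul_nonneg (by linarith) (OnlineAlg.expectedValue_nonneg _ _)
  obtain ⟨β, J', h⟩ := SlotParams.exists_outcomes hN100 hnN hK1 hg hV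
  obtain ⟨S, hSG, hSK, hSV⟩ := P.exists_sum_eq_benchmark K g
  have key : (P.benchmark K g : ℝ) * (1 - 12 / N) ≤
      ((SlotParams.ofScale N K).alg (N ^ 3 * N ^ 14)).expectedValue P := by
    rw [SlotParams.expectedValue_alg]
    rcases le_total (level N (P.value g)) ((β + (N ^ 3 : ℕ) : ℤ) : WithBot ℤ) with hgl | hgl
    · exact SlotParams.integral_ge_of_moderate h hN100 hnN hKn hSG hSV hSK hgl
    · exact SlotParams.integral_ge_of_huge h hN100 hnN hSG hSV hgl
  calc (P.benchmark K g : ℝ) ≤ P.benchmark K g * ((1 + ε) * (1 - 12 / N)) :=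
        le_mul_of_one_le_right hV.le hNε
    _ = (1 + ε) * (P.benchmark K g * (1 - 12 / N)) := by ring
    _ ≤ _ := by gcongr
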